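/- Let $E\subset\mathbb{R}^2$ be a simple polygonal environment: a compact set that is the closure of its interior and whose boundary is a simple closed polygon with $n\ge 3$ edges (no two consecutive edges being collinear). Let $r$ be the number of its reflex vertices, i.e. vertices with interior angle greater than $\pi$. For $p\in E$ let $V(p)=\{q\in E: [p,q]\subset E\}$ be the set of points visible from $p$. A visibility gap of $p$ with respect to a closed region $R\subset E$ is a segment $[a,b]$, $a\neq b$, with $]a,b[\,\subset\operatorname{int}R$, $[a,b]\subset\partial V(p)$ and $a,b\in\partial R$; it is dividing if moreover $[a,b]\subset\overline{\operatorname{int}V(p)}$ (this excludes only one-dimensional spikes of $V(p)$ with unseen points on both sides). The Reflex Vertex Straddling (RVS) deployment in $E$ with root position $p_0\in E$ is the following rooted tree of agents, each having a final position $p$ and a region $R$ in its charge. The root has position $p_0$ and region $E$. An agent with position $p$ and region $R$ has exactly one child for each dividing visibility gap $[a,b]$ of $p$ with respect to $R$; the position of the child is the end of the gap furthest from $p$, and its region is the part of $R$ across the gap, that is, the closure of the set of points of $R\setminus[a,b]$ that do not lie in the connected component of $p$ in $R\setminus[a,b]$. Then: (1) For every root position $p_0\in E$ the RVS deployment is finite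 and uses at most $r+1$ agents, and every point of $E$ is visible from the final position of at least one agent. (2) $r+1\le n-2$. (3) Suppose that $E$ is orthogonal (consecutive edges are perpendicular). Then the RVS deployment uses at most $\frac n2-1$ agents for every root position $p_0\in E$, and at most $\frac n2-2$ agents whenever the root is placed at a reflex vertex. Reflex vertices exist unless $n=4$ (a rectangle); hence for $n\neq 4$ no more than $\frac n2-2$ agents are required for a suitable choice of the root. -/

import Mathlib

/-- The Euclidean plane. -/
abbrev Plane : Type := EuclideanSpace ℝ (Fin 2)

/-- A simple polygonal environment with `n` edges: a compact set, equal to the closure of its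
interior, whose boundary is a simple closed polygon with `n` edges and `n` genuine corners
`vertex 0, …, vertex (n - 1)` in cyclic order. (Two consecutive edges meet in their common
end point only, because the three vertices involved are not collinear.) -/
structure PolygonalEnvironment (n : ℕ) where
  carrier : Set Plane
  vertex : ZMod n → Plane
  three_le : 3 ≤ n
  corner : ∀ i, ¬ Collinear ℝ {vertex i, vertex (i + 1), vertex (i + 1 + 1)}
  edges_disjoint : ∀ i j, j ≠ i → j ≠ i + 1 → i ≠ j + 1 →
    Disjoint (segment ℝ (vertex i) (vertex (i + 1))) (segment ℝ (vertex j) (vertex (j + 1)))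
  isCompact : IsCompact carrier
  closure_interior : closure (interior carrier) = carrier
  frontier_eq : frontier carrier = ⋃ i, segment ℝ (vertex i) (vertex (i + 1))

namespace PolygonalEnvironment

variable {n : ℕ}

/-- The `i`-th vertex is reflex (its interior angle exceeds `π`): the environment is not convex
in any neighbourhood of the vertex. -/
def IsReflex (E : PolygonalEnvironment n) (i : ZMod n) : Prop :=
  ∀ ε : ℝ, 0 < ε → ¬ Convex ℝ (E.carrier ∩ Metric.ball (E.vertex i) ε)

/-- The number `r` of reflex vertices. -/
noncomputable def numReflex (E : PolygonalEnvironment n) : ℕ :=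
  Set.ncard {i : ZMod n | E.IsReflex i}

/-- Consecutive edges are perpendicular. -/
def IsOrthogonal (E : PolygonalEnvironment n) : Prop :=
  ∀ i, inner ℝ (E.vertex (i + 1) - E.vertex i) (E.vertex (i + 1 + 1) - E.vertex (i + 1)) = 0

end PolygonalEnvironment

/-- The set of points of `E` visible from `p`. -/
def visibilitySet (E : Set Plane) (p : Plane) : Set Plane :=
  {q | q ∈ E ∧ segment ℝ p q ⊆ E}

/-- `[a, b]` is a visibility gap of `p` with respect to the region `R`. -/
def IsVisibilityGap (E R : Set Plane) (p a b : Plane) : Prop :=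
  a ≠ b ∧ openSegment ℝ a b ⊆ interior R ∧ segment ℝ a b ⊆ frontier (visibilitySet E p) ∧
    a ∈ frontier R ∧ b ∈ frontier R

/-- A visibility gap that divides a portion seen from `p` from an unseen one: it borders the
interior of the visibility set of `p`. This only excludes a segment that is itself a
one-dimensional spike of the visibility set (a line of sight that has grazed two reflex vertices
on opposite sides), with unseen points on both sides. -/
def IsDividingGap (E R : Set Plane) (p a b : Plane) : Prop :=
  IsVisibilityGap E R p a b ∧ segment ℝ a b ⊆ closure (interior (visibilitySet E p))

/-- The part of `R` that lies across the segment `[a, b]` from `p`, as a closed set. -/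
def regionAcross (R : Set Plane) (p a b : Plane) : Set Plane :=
  closure ((R \ segment ℝ a b) \ connectedComponentIn (R \ segment ℝ a b) p)

/-- `RVSAgent E p₀ R p`: the Reflex Vertex Straddling deployment in `E` with root position `p₀`
has an agent with final position `p` that is in charge of the region `R`. The root is in charge
of `E`. An agent at `p` in charge of `R` has one child for each of its dividing gaps with respect
to `R`; the child moves to the end of the gap that is furthest from `p` and is in charge of the
part of `R` across the gap. -/
inductive RVSAgent (E : Set Plane) (p₀ : Plane) : Set Plane → Plane → Prop
  | base : RVSAgent E p₀ E p₀
  | child {R : Set Plane} {p a b : Plane} : RVSAgent E p₀ R p → IsDividingGap E R p a b →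
      dist p a < dist p b → RVSAgent E p₀ (regionAcross R p a b) b

/-- The agents of the deployment, each recorded as (region in its charge, final position), so
that two agents at the same position in charge of different regions are counted separately. -/
def rvsAgents (E : Set Plane) (p₀ : Plane) : Set (Set Plane × Plane) :=
  {A | RVSAgent E p₀ A.1 A.2}

/-! The bound is an injection. Every agent except the root stands at the far end of a gap `[a, b]`,
whose near end `a` is grazed by a line of sight of its parent that then continues into the interior.
At an inner point of an edge or at a convex corner this is impossible, so `a` is a reflex vertex
(`exists_isReflexCorner_of_grazing`). A gap is a chord that cuts the interior into two connected
sides (`exists_sides`); the child's region is the side away from the parent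
(`Region.regionAcross_eq`), and the gaps of the child avoid the gap through which it came. Hence the
reflex vertices still available to an agent (`pending`) shrink strictly from parent to child and are
disjoint for siblings. So `a` determines the agent, and there are at most `r + 1` agents. A root
placed at a reflex vertex uses that vertex up and saves one agent.

The separation by a chord comes from an angle function. Both ends lie on the boundary polygon, and
adding the angles under which the pieces of a boundary path between them are seen gives a continuous
branch, off the boundary, of the angle under which `[a, b]` is seen. On the open chord this branch
is constant; off the chord it never takes that value. Smaller and larger values give the two sides.

For coverage, take an unseen interior point of a region. The component of the part not bordered by
the interior of the visibility set touches the seen part at a point `y` that is blocked on exactly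
one side; the maximal segment of the ray through `y` inside the region is a dividing gap with the
unseen point across it (`Region.exists_gap_of_unseen`). Descending to that child lowers the number
of pending vertices, so the descent ends. Boundary points follow because visibility sets are closed
and the agents finite in number.

The counts in terms of `n` use that the boundary turns by `2 * π` in all (`exists_turning`), proved
by a discrete version of Hopf's secant argument. A convex corner contributes less than `π` and a
reflex one less than `0`, so there are at least three convex corners; in the orthogonal case the
contributions are `π / 2` and `-π / 2`, so `n = 2 * r + 4`. -/

open Set Filter Topology Metric

/-! ### Plane geometry with the wedge product -/

/-- The planar wedge (cross) product. -/
def wedge (u v : Plane) : ℝ := u 0 * v 1 - u 1 * v 0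

lemma wedge_add_right (u v w : Plane) : wedge u (v + w) = wedge u v + wedge u w := by
  simp [wedge]; ring

lemma wedge_sub_right (u v w : Plane) : wedge u (v - w) = wedge u v - wedge u w := by
  simp [wedge]; ring

lemma wedge_sub_left (u v w : Plane) : wedge (u - v) w = wedge u w - wedge v w := by
  simp [wedge]; ring

lemma wedge_smul_right (t : ℝ) (u v : Plane) : wedge u (t • v) = t * wedge u v := by
  simp [wedge]; ring

lemma wedge_smul_left (t : ℝ) (u v : Plane) : wedge (t • u) v = t * wedge u v := by
  simp [wedge]; ring

@[simp] lemma wedge_self (u : Plane) : wedge u u = 0 := by simp [wedge]; ring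

@[simp] lemma wedge_zero_right (u : Plane) : wedge u 0 = 0 := by simp [wedge]

@[simp] lemma wedge_zero_left (u : Plane) : wedge 0 u = 0 := by simp [wedge]

lemma wedge_swap (u v : Plane) : wedge u v = - wedge v u := by simp [wedge]; ring

lemma wedge_neg_right (u v : Plane) : wedge u (-v) = - wedge u v := by simp [wedge]; ring

lemma Plane.ext' {u v : Plane} (h0 : u 0 = v 0) (h1 : u 1 = v 1) : u = v := by
  ext i; fin_cases i <;> assumption

@[fun_prop]
lemma Continuous.wedge {X : Type*} [TopologicalSpace X] {f g : X → Plane} (hf : Continuous f)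
    (hg : Continuous g) : Continuous fun x => wedge (f x) (g x) := by
  unfold _root_.wedge; fun_prop

lemma exists_smul_of_wedge_eq_zero {u v : Plane} (hu : u ≠ 0) (h : wedge u v = 0) :
    ∃ t : ℝ, v = t • u := by
  unfold wedge at h
  by_cases h0 : u 0 = 0
  · have h1 : u 1 ≠ 0 := fun h1 => hu (Plane.ext' (by simpa using h0) (by simpa using h1))
    refine ⟨v 1 / u 1, Plane.ext' ?_ ?_⟩
    · have : v 0 = 0 := by
        rw [h0] at h; simpa [h1] using h
      simp [h0, this]
    · simp [h1]
  · refine ⟨v 0 / u 0, Plane.ext' ?_ ?_⟩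
    · simp [h0]
    · simp; field_simp; linarith

lemma wedge_ne_zero_of_not_collinear {a b c : Plane} (h : ¬ Collinear ℝ {a, b, c}) :
    wedge (b - a) (c - b) ≠ 0 := by
  intro h0
  apply h
  by_cases hab : b = a
  · subst hab; simpa using collinear_pair ℝ b c
  · obtain ⟨t, ht⟩ := exists_smul_of_wedge_eq_zero (sub_ne_zero.2 hab) h0
    rw [collinear_iff_of_mem (p₀ := a) (by simp)]
    refine ⟨b - a, ?_⟩
    simp only [mem_insert_iff, mem_singleton_iff, forall_eq_or_imp, forall_eq, vadd_eq_add]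
    refine ⟨⟨0, by simp⟩, ⟨1, by simp⟩, ⟨1 + t, ?_⟩⟩
    rw [add_smul, ← ht]; simp

/-- Coordinates with respect to two linearly independent vectors. -/
lemma eq_wedge_coord {e f : Plane} (h : wedge e f ≠ 0) (q : Plane) :
    q = (wedge q f / wedge e f) • e + (wedge e q / wedge e f) • f := by
  apply Plane.ext' <;> simp <;> field_simp <;> simp [wedge] <;> ring

lemma add_smul_sub_mem_segment {a b : Plane} {t : ℝ} (h0 : 0 ≤ t) (h1 : t ≤ 1) :
    a + t • (b - a) ∈ segment ℝ a b := by
  rw [segment_eq_image']; exact ⟨t, ⟨h0, h1⟩, rfl⟩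

lemma add_smul_sub_mem_openSegment {a b : Plane} {t : ℝ} (h0 : 0 < t) (h1 : t < 1) :
    a + t • (b - a) ∈ openSegment ℝ a b := by
  rw [openSegment_eq_image']; exact ⟨t, ⟨h0, h1⟩, rfl⟩

lemma mem_segment_iff {a b x : Plane} :
    x ∈ segment ℝ a b ↔ ∃ t : ℝ, 0 ≤ t ∧ t ≤ 1 ∧ x = a + t • (b - a) := by
  rw [segment_eq_image']
  constructor
  · rintro ⟨t, ⟨h0, h1⟩, rfl⟩; exact ⟨t, h0, h1, rfl⟩
  · rintro ⟨t, h0, h1, rfl⟩; exact ⟨t, ⟨h0, h1⟩, rfl⟩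

lemma mem_openSegment_iff {a b x : Plane} :
    x ∈ openSegment ℝ a b ↔ ∃ t : ℝ, 0 < t ∧ t < 1 ∧ x = a + t • (b - a) := by
  rw [openSegment_eq_image']
  constructor
  · rintro ⟨t, ⟨h0, h1⟩, rfl⟩; exact ⟨t, h0, h1, rfl⟩
  · rintro ⟨t, h0, h1, rfl⟩; exact ⟨t, ⟨h0, h1⟩, rfl⟩

lemma wedge_sub_eq_zero_of_mem_segment {a b x : Plane} (h : x ∈ segment ℝ a b) :
    wedge (b - a) (x - a) = 0 := by
  obtain ⟨t, -, -, rfl⟩ := mem_segment_iff.1 h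
  simp [wedge_smul_right]

lemma isCompact_segment (a b : Plane) : IsCompact (segment ℝ a b) := by
  rw [segment_eq_image']
  exact isCompact_Icc.image (by fun_prop)

lemma isClosed_segment (a b : Plane) : IsClosed (segment ℝ a b) := (isCompact_segment a b).isClosed

lemma isPreconnected_segment (a b : Plane) : IsPreconnected (segment ℝ a b) :=
  (convex_segment a b).isPreconnected

/-- A preconnected set that misses the frontier of a set lies in its interior or outside. -/
lemma IsPreconnected.subset_interior_or_subset_compl {X : Type*} [TopologicalSpace X]
    {S E : Set X} (hS : IsPreconnected S) (h : Disjoint S (frontier E)) :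
    S ⊆ interior E ∨ S ⊆ (closure E)ᶜ := by
  apply hS.subset_or_subset isOpen_interior isClosed_closure.isOpen_compl
  · exact disjoint_compl_right.mono_left (interior_subset.trans subset_closure)
  · intro x hx
    by_cases hc : x ∈ closure E
    · left
      by_contra hi
      exact disjoint_left.1 h hx ⟨hc, hi⟩
    · exact Or.inr hc

/-- The open half-discs of a disc through its centre are nonempty. -/
lemma exists_mem_ball_wedge_pos {u : Plane} (hu : u ≠ 0) (z : Plane) {ε : ℝ} (hε : 0 < ε) :
    ∃ q ∈ ball z ε, 0 < wedge u (q - z) := by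
  -- The quarter turn of `u`, so that `wedge u w` is the squared length of `u`.
  set w : Plane := !₂[-u 1, u 0]
  have hw : 0 < wedge u w := by
    have : wedge u w = u 0 ^ 2 + u 1 ^ 2 := by simp [wedge, w]; ring
    rw [this]
    by_contra h
    push Not at h
    exact hu (Plane.ext' (by simpa using by nlinarith [sq_nonneg (u 0), sq_nonneg (u 1)])
      (by simpa using by nlinarith [sq_nonneg (u 0), sq_nonneg (u 1)]))
  have hw0 : w ≠ 0 := by rintro h; simp [h] at hw
  have hn : 0 < ‖w‖ := norm_pos_iff.2 hw0
  refine ⟨z + (ε / (2 * ‖w‖)) • w, ?_, ?_⟩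
  · simp only [mem_ball, dist_self_add_left, norm_smul, norm_div, Real.norm_eq_abs, norm_mul, abs_of_pos hε,
      abs_norm, Nat.abs_ofNat]
    field_simp; norm_num
  · rw [add_sub_cancel_left, wedge_smul_right]; positivity

lemma convex_wedge_pos (c : ℝ) (u z : Plane) : Convex ℝ {q | 0 < c * wedge u (q - z)} := by
  intro x hx y hy a b ha hb hab
  simp only [mem_ofPred_eq] at *
  have : c * wedge u (a • x + b • y - z) = a * (c * wedge u (x - z)) + b * (c * wedge u (y - z)) := by
    have : a • x + b • y - z = a • (x - z) + b • (y - z) := by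
      rw [smul_sub, smul_sub, sub_add_sub_comm, ← add_smul, hab, one_smul]
    rw [this, wedge_add_right, wedge_smul_right, wedge_smul_right]; ring
  rw [this]
  rcases ha.eq_or_lt with rfl | ha
  · simp at hab; subst hab; simpa using hy
  · have := mul_pos ha hx; have := mul_nonneg hb hy.le; linarith

lemma convex_wedge_nonneg (c : ℝ) (u z : Plane) : Convex ℝ {q | 0 ≤ c * wedge u (q - z)} := by
  intro x hx y hy a b ha hb hab
  simp only [mem_ofPred_eq] at *
  have : c * wedge u (a • x + b • y - z) = a * (c * wedge u (x - z)) + b * (c * wedge u (y - z)) := by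
    have : a • x + b • y - z = a • (x - z) + b • (y - z) := by
      rw [smul_sub, smul_sub, sub_add_sub_comm, ← add_smul, hab, one_smul]
    rw [this, wedge_add_right, wedge_smul_right, wedge_smul_right]; ring
  rw [this]; positivity

/-! ### Local shape of the environment at edges and corners -/

namespace PolygonalEnvironment

variable {n : ℕ} (E : PolygonalEnvironment n)

/-- The direction vector of the `i`-th edge. -/
def dir (i : ZMod n) : Plane := E.vertex (i + 1) - E.vertex i

/-- The `i`-th edge. -/
def edge (i : ZMod n) : Set Plane := segment ℝ (E.vertex i) (E.vertex (i + 1))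

lemma neZero {n : ℕ} (E : PolygonalEnvironment n) : NeZero n := ⟨by have := E.three_le; omega⟩

lemma mem_frontier_iff {z : Plane} : z ∈ frontier E.carrier ↔ ∃ i, z ∈ E.edge i := by
  rw [E.frontier_eq]; simp [edge]

lemma isClosed_edge (i : ZMod n) : IsClosed (E.edge i) := isClosed_segment _ _

lemma isClosed : IsClosed E.carrier := E.isCompact.isClosed

lemma frontier_subset : frontier E.carrier ⊆ E.carrier := E.isClosed.frontier_subset

lemma vertex_mem_frontier (i : ZMod n) : E.vertex i ∈ frontier E.carrier :=
  E.mem_frontier_iff.2 ⟨i, left_mem_segment _ _ _⟩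

lemma mem_interior_or_mem_frontier {z : Plane} (h : z ∈ E.carrier) :
    z ∈ interior E.carrier ∨ z ∈ frontier E.carrier := by
  by_cases hi : z ∈ interior E.carrier
  · exact Or.inl hi
  · exact Or.inr ⟨subset_closure h, hi⟩

lemma wedge_dir_ne_zero (i : ZMod n) : wedge (E.dir i) (E.dir (i + 1)) ≠ 0 :=
  wedge_ne_zero_of_not_collinear (E.corner i)

lemma dir_ne_zero (i : ZMod n) : E.dir i ≠ 0 := by
  intro h
  have := E.wedge_dir_ne_zero i
  simp [h] at this

lemma wedge_dir_sub_eq_zero {i : ZMod n} {q : Plane} (h : q ∈ E.edge i) :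
    wedge (E.dir i) (q - E.vertex i) = 0 :=
  wedge_sub_eq_zero_of_mem_segment h

lemma wedge_dir_sub_eq_zero' {i : ZMod n} {q : Plane} (h : q ∈ E.edge i) :
    wedge (E.dir i) (q - E.vertex (i + 1)) = 0 := by
  have h1 := E.wedge_dir_sub_eq_zero h
  have : q - E.vertex (i + 1) = (q - E.vertex i) - E.dir i := by simp [dir]
  rw [this, wedge_sub_right, h1, wedge_self, sub_zero]

/-- The directions of consecutive edges form a basis, and a common point has both coordinates zero
relative to the common vertex. -/
lemma eq_vertex_of_mem_edge_of_mem_edge_succ {i : ZMod n} {q : Plane} (h : q ∈ E.edge i)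
    (h' : q ∈ E.edge (i + 1)) : q = E.vertex (i + 1) := by
  have h1 := E.wedge_dir_sub_eq_zero' h
  have h2 := E.wedge_dir_sub_eq_zero h'
  have := eq_wedge_coord (E.wedge_dir_ne_zero i) (q - E.vertex (i + 1))
  rw [h1, wedge_swap, h2] at this
  simpa [sub_eq_zero] using this

lemma adjacent_of_mem_edge {i j : ZMod n} {q : Plane} (h : q ∈ E.edge i) (h' : q ∈ E.edge j) :
    j = i ∨ j = i + 1 ∨ i = j + 1 := by
  by_contra hc
  push Not at hc
  exact disjoint_left.1 (E.edges_disjoint i j hc.1 hc.2.1 hc.2.2) h h'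

lemma eq_of_mem_openSegment_of_mem_edge {i j : ZMod n} {q : Plane}
    (h : q ∈ openSegment ℝ (E.vertex i) (E.vertex (i + 1))) (h' : q ∈ E.edge j) : j = i := by
  have hi : q ∈ E.edge i := openSegment_subset_segment _ _ _ h
  have hne : E.vertex i ≠ E.vertex (i + 1) := fun hh => E.dir_ne_zero i (by simp [dir, hh])
  rcases E.adjacent_of_mem_edge hi h' with rfl | rfl | rfl
  · rfl
  · have := E.eq_vertex_of_mem_edge_of_mem_edge_succ hi h'
    subst this
    exact absurd (right_mem_openSegment_iff.1 h) hne
  · have := E.eq_vertex_of_mem_edge_of_mem_edge_succ h' hi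
    subst this
    exact absurd (left_mem_openSegment_iff.1 h) hne

lemma vertex_mem_edge {i j : ZMod n} (h : E.vertex (i + 1) ∈ E.edge j) : j = i ∨ j = i + 1 := by
  have h1 : E.vertex (i + 1) ∈ E.edge i := right_mem_segment _ _ _
  have h2 : E.vertex (i + 1) ∈ E.edge (i + 1) := left_mem_segment _ _ _
  rcases E.adjacent_of_mem_edge h1 h with rfl | rfl | rfl
  · exact Or.inl rfl
  · exact Or.inr rfl
  · have := E.eq_vertex_of_mem_edge_of_mem_edge_succ h h1
    exact absurd (by simp [dir, this]) (E.dir_ne_zero (j + 1))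

/-- The edges that miss `z` are finitely many closed sets, so a small disc avoids them all. The
local descriptions of edges and corners start from such a disc. -/
lemma exists_ball_frontier (z : Plane) : ∃ ε > 0, ∀ q ∈ ball z ε, q ∈ frontier E.carrier →
    ∃ j, z ∈ E.edge j ∧ q ∈ E.edge j := by
  have := E.neZero
  have hcl : IsClosed (⋃ j ∈ {j | z ∉ E.edge j}, E.edge j) :=
    (toFinite _).isClosed_biUnion fun j _ => E.isClosed_edge j
  have hz : z ∈ (⋃ j ∈ {j | z ∉ E.edge j}, E.edge j)ᶜ := by simp
  obtain ⟨ε, hε, hb⟩ := Metric.isOpen_iff.1 hcl.isOpen_compl z hz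
  refine ⟨ε, hε, fun q hq hqF => ?_⟩
  obtain ⟨j, hj⟩ := E.mem_frontier_iff.1 hqF
  refine ⟨j, ?_, hj⟩
  by_contra hzj
  exact hb hq (mem_biUnion (show j ∈ {j | z ∉ E.edge j} from hzj) hj)

/-- A disc about a boundary point whose complement of the boundary is divided into two connected
pieces: one piece belongs to the interior, the other to the exterior. -/
lemma interior_exterior_dichotomy {z : Plane} (hz : z ∈ frontier E.carrier) {B A A' : Set Plane}
    (hB : B ∈ 𝓝 z) (hA : IsPreconnected A) (hA' : IsPreconnected A')
    (hAF : Disjoint A (frontier E.carrier)) (hAF' : Disjoint A' (frontier E.carrier))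
    (hcov : ∀ q ∈ B, q ∈ frontier E.carrier ∨ q ∈ A ∨ q ∈ A') :
    (∀ q ∈ B, (q ∈ E.carrier ↔ q ∉ A') ∧ (q ∈ interior E.carrier ↔ q ∈ A)) ∨
      (∀ q ∈ B, (q ∈ E.carrier ↔ q ∉ A) ∧ (q ∈ interior E.carrier ↔ q ∈ A')) := by
  have key : ∀ A A' : Set Plane, A ⊆ interior E.carrier → A' ⊆ (closure E.carrier)ᶜ →
      (∀ q ∈ B, q ∈ frontier E.carrier ∨ q ∈ A ∨ q ∈ A') →
      (∀ q ∈ B, (q ∈ E.carrier ↔ q ∉ A') ∧ (q ∈ interior E.carrier ↔ q ∈ A)) := by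
    intro A A' h h' hc q hq
    have hA'E : q ∈ A' → q ∉ E.carrier := fun h1 h2 => h' h1 (subset_closure h2)
    refine ⟨⟨fun h1 h2 => hA'E h2 h1, fun h1 => ?_⟩, fun h1 => ?_, fun h1 => h h1⟩
    · rcases hc q hq with h2 | h2 | h2
      · exact E.frontier_subset h2
      · exact interior_subset (h h2)
      · exact absurd h2 h1
    · rcases hc q hq with h2 | h2 | h2
      · exact absurd h1 h2.2
      · exact h2
      · exact absurd (interior_subset h1) (hA'E h2)
  -- Each piece is wholly interior or wholly exterior. Both interior would contradict that `z` is a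
  -- limit of points outside; both exterior would contradict that the environment is the closure of
  -- its interior.
  rcases hA.subset_interior_or_subset_compl hAF with h | h <;>
    rcases hA'.subset_interior_or_subset_compl hAF' with h' | h'
  · exfalso
    have hz' : z ∈ closure E.carrierᶜ := by
      rw [frontier_eq_closure_inter_closure] at hz; exact hz.2
    obtain ⟨q, hq, hqE⟩ := mem_closure_iff_nhds.1 hz' B hB
    rcases hcov q hq with h1 | h1 | h1
    · exact hqE (E.frontier_subset h1)
    · exact hqE (interior_subset (h h1))
    · exact hqE (interior_subset (h' h1))
  · exact Or.inl (key A A' h h' hcov)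
  · exact Or.inr (key A' A h' h fun q hq => by have := hcov q hq; tauto)
  · exfalso
    have hz' : z ∈ closure (interior E.carrier) := by
      rw [E.closure_interior]; exact E.frontier_subset hz
    obtain ⟨q, hq, hqE⟩ := mem_closure_iff_nhds.1 hz' B hB
    rcases hcov q hq with h1 | h1 | h1
    · exact h1.2 hqE
    · exact h h1 (subset_closure (interior_subset hqE))
    · exact h' h1 (subset_closure (interior_subset hqE))

/-- Near an inner point of an edge the environment is a half-plane. -/
lemma local_edge {i : ZMod n} {z : Plane}
    (h : z ∈ openSegment ℝ (E.vertex i) (E.vertex (i + 1))) :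
    ∃ s : ℝ, (s = 1 ∨ s = -1) ∧ ∃ ε > 0, ∀ q ∈ ball z ε,
      (q ∈ E.carrier ↔ 0 ≤ s * wedge (E.dir i) (q - z)) ∧
      (q ∈ interior E.carrier ↔ 0 < s * wedge (E.dir i) (q - z)) := by
  obtain ⟨ε₀, hε₀, hF⟩ := E.exists_ball_frontier z
  obtain ⟨τ, hτ0, hτ1, hzτ⟩ := mem_openSegment_iff.1 h
  have hzE : z ∈ E.edge i := openSegment_subset_segment _ _ _ h
  have hzF : z ∈ frontier E.carrier := E.mem_frontier_iff.2 ⟨i, hzE⟩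
  have he : 0 < ‖E.dir i‖ := norm_pos_iff.2 (E.dir_ne_zero i)
  -- The second term is the distance from `z` to the nearer end of the edge, so inside the disc the
  -- edge coincides with its line.
  set ε := min ε₀ (min τ (1 - τ) * ‖E.dir i‖) with hεdef
  have hm : 0 < min τ (1 - τ) := lt_min hτ0 (by linarith)
  have hε : 0 < ε := lt_min hε₀ (by positivity)
  have hFiff : ∀ q ∈ ball z ε, (q ∈ frontier E.carrier ↔ wedge (E.dir i) (q - z) = 0) := by
    intro q hq
    constructor
    · intro hqF
      obtain ⟨j, hj, hqj⟩ := hF q (ball_subset_ball (min_le_left _ _) hq) hqF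
      obtain rfl := E.eq_of_mem_openSegment_of_mem_edge h hj
      have h1 := E.wedge_dir_sub_eq_zero hqj
      have h2 := E.wedge_dir_sub_eq_zero hj
      have : q - z = (q - E.vertex j) - (z - E.vertex j) := by abel
      rw [this, wedge_sub_right, h1, h2, sub_zero]
    · intro h0
      obtain ⟨t, ht⟩ := exists_smul_of_wedge_eq_zero (E.dir_ne_zero i) h0
      have hlt : ‖q - z‖ < min τ (1 - τ) * ‖E.dir i‖ :=
        lt_of_lt_of_le (by rwa [mem_ball, dist_eq_norm] at hq) (min_le_right _ _)
      rw [ht, norm_smul] at hlt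
      have hlt' : |t| < min τ (1 - τ) := lt_of_mul_lt_mul_right hlt he.le
      have h1 := abs_lt.1 (hlt'.trans_le (min_le_left _ _))
      have h2 := abs_lt.1 (hlt'.trans_le (min_le_right _ _))
      refine E.mem_frontier_iff.2 ⟨i, mem_segment_iff.2 ⟨τ + t, by linarith, by linarith, ?_⟩⟩
      rw [add_smul, ← add_assoc, ← hzτ]
      exact (sub_eq_iff_eq_add'.1 ht)
  have hA : ∀ s : ℝ, IsPreconnected (ball z ε ∩ {q | 0 < s * wedge (E.dir i) (q - z)}) :=
    fun s => ((convex_ball z ε).inter (convex_wedge_pos s _ z)).isPreconnected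
  have hAF : ∀ s : ℝ,
      Disjoint (ball z ε ∩ {q | 0 < s * wedge (E.dir i) (q - z)}) (frontier E.carrier) := by
    intro s
    rw [disjoint_left]
    rintro q ⟨hq, hq'⟩ hqF
    rw [mem_ofPred_eq, (hFiff q hq).1 hqF] at hq'
    simp at hq'
  rcases E.interior_exterior_dichotomy hzF (ball_mem_nhds z hε) (hA 1) (hA (-1)) (hAF 1) (hAF (-1))
    (fun q hq => by
      rw [hFiff q hq]
      rcases lt_trichotomy (wedge (E.dir i) (q - z)) 0 with h1 | h1 | h1
      · right; right; exact ⟨hq, by simpa using h1⟩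
      · left; exact h1
      · right; left; exact ⟨hq, by simpa using h1⟩) with h1 | h1
  · refine ⟨1, Or.inl rfl, ε, hε, fun q hq => ?_⟩
    obtain ⟨h2, h3⟩ := h1 q hq
    rw [h2, h3]
    simp [hq.out]
  · refine ⟨-1, Or.inr rfl, ε, hε, fun q hq => ?_⟩
    obtain ⟨h2, h3⟩ := h1 q hq
    rw [h2, h3]
    simp [hq.out]

/-- The environment is convex near the vertex `i + 1`: it coincides with the convex cone spanned by
the two edges. -/
def IsConvexCorner (i : ZMod n) : Prop :=
  ∃ ε > 0, ∀ q ∈ ball (E.vertex (i + 1)) ε,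
    (q ∈ E.carrier ↔
      0 ≤ wedge (E.dir i) (E.dir (i + 1)) * wedge (E.dir i) (q - E.vertex (i + 1)) ∧
      0 ≤ wedge (E.dir i) (E.dir (i + 1)) * wedge (E.dir (i + 1)) (q - E.vertex (i + 1))) ∧
    (q ∈ interior E.carrier ↔
      0 < wedge (E.dir i) (E.dir (i + 1)) * wedge (E.dir i) (q - E.vertex (i + 1)) ∧
      0 < wedge (E.dir i) (E.dir (i + 1)) * wedge (E.dir (i + 1)) (q - E.vertex (i + 1)))

/-- Near the vertex `i + 1` the environment is the complement of the open convex cone spanned by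
the two edges. -/
def IsReflexCorner (i : ZMod n) : Prop :=
  ∃ ε > 0, ∀ q ∈ ball (E.vertex (i + 1)) ε,
    (q ∈ E.carrier ↔
      0 ≤ -wedge (E.dir i) (E.dir (i + 1)) * wedge (E.dir i) (q - E.vertex (i + 1)) ∨
      0 ≤ -wedge (E.dir i) (E.dir (i + 1)) * wedge (E.dir (i + 1)) (q - E.vertex (i + 1))) ∧
    (q ∈ interior E.carrier ↔
      0 < -wedge (E.dir i) (E.dir (i + 1)) * wedge (E.dir i) (q - E.vertex (i + 1)) ∨
      0 < -wedge (E.dir i) (E.dir (i + 1)) * wedge (E.dir (i + 1)) (q - E.vertex (i + 1)))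

end PolygonalEnvironment

lemma add_smul_mem_ball {z v : Plane} {ε : ℝ} (hv : v ≠ 0) (hε : 0 < ε) :
    ∃ η > 0, ∀ t : ℝ, |t| ≤ η → z + t • v ∈ ball z ε := by
  have hn : 0 < ‖v‖ := norm_pos_iff.2 hv
  refine ⟨ε / (2 * ‖v‖), by positivity, fun t ht => ?_⟩
  rw [mem_ball, dist_self_add_left, norm_smul, Real.norm_eq_abs]
  calc |t| * ‖v‖ ≤ ε / (2 * ‖v‖) * ‖v‖ := by gcongr
    _ < ε := by field_simp; norm_num

/-- The part of a disc in a non-convex sector at its centre is connected. -/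
lemma isPreconnected_ball_inter_reflex_sector {e f z : Plane} (h : wedge e f ≠ 0) {ε : ℝ}
    (hε : 0 < ε) : IsPreconnected (ball z ε ∩ {q | 0 < -wedge e f * wedge e (q - z) ∨
      0 < -wedge e f * wedge f (q - z)}) := by
  have : ball z ε ∩ {q | 0 < -wedge e f * wedge e (q - z) ∨ 0 < -wedge e f * wedge f (q - z)} =
      (ball z ε ∩ {q | 0 < -wedge e f * wedge e (q - z)}) ∪
      (ball z ε ∩ {q | 0 < -wedge e f * wedge f (q - z)}) := by
    rw [← inter_union_distrib_left]; rfl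
  rw [this]
  have hef : e - f ≠ 0 := by
    rw [sub_ne_zero]; rintro rfl; simp at h
  -- The sector is a union of two half-discs, each convex; the direction `e - f` points into both of
  -- them.
  obtain ⟨η, hη, hb⟩ := add_smul_mem_ball (z := z) hef hε
  have hq := hb η (by rw [abs_of_pos hη])
  have hp : 0 < wedge e f ^ 2 := by positivity
  refine IsPreconnected.union (z + η • (e - f)) ⟨hq, ?_⟩ ⟨hq, ?_⟩
    ((convex_ball z ε).inter (convex_wedge_pos _ e z)).isPreconnected
    ((convex_ball z ε).inter (convex_wedge_pos _ f z)).isPreconnected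
  · rw [mem_ofPred_eq, add_sub_cancel_left, wedge_smul_right, wedge_sub_right, wedge_self]
    have := mul_pos hη hp
    linarith
  · rw [mem_ofPred_eq, add_sub_cancel_left, wedge_smul_right, wedge_sub_right, wedge_self,
      wedge_swap f e]
    have := mul_pos hη hp
    linarith

namespace PolygonalEnvironment

variable {n : ℕ} (E : PolygonalEnvironment n)

/-- The two edges, which leave the vertex in the directions `-e` and `f`, cut a small disc into a
convex and a non-convex sector, and exactly one of these is inside. The factor `wedge e f` in the
inequalities makes the description independent of the orientation of the polygon. -/
lemma isConvexCorner_or_isReflexCorner (i : ZMod n) :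
    E.IsConvexCorner i ∨ E.IsReflexCorner i := by
  have hK := E.wedge_dir_ne_zero i
  unfold IsConvexCorner IsReflexCorner
  obtain ⟨ε₀, hε₀, hF⟩ := E.exists_ball_frontier (E.vertex (i + 1))
  have he0 := E.dir_ne_zero i
  have hf0 := E.dir_ne_zero (i + 1)
  have hedge : ∀ q, q ∈ E.edge i ↔ ∃ t : ℝ, 0 ≤ t ∧ t ≤ 1 ∧
      q - E.vertex (i + 1) = -t • E.dir i := by
    intro q
    rw [edge, segment_symm, mem_segment_iff]
    simp only [dir]
    refine exists_congr fun t => and_congr_right fun _ => and_congr_right fun _ => ?_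
    rw [sub_eq_iff_eq_add', neg_smul, ← smul_neg, neg_sub]
  have hedge' : ∀ q, q ∈ E.edge (i + 1) ↔ ∃ t : ℝ, 0 ≤ t ∧ t ≤ 1 ∧
      q - E.vertex (i + 1) = t • E.dir (i + 1) := by
    intro q
    rw [edge, mem_segment_iff]
    refine exists_congr fun t => and_congr_right fun _ => and_congr_right fun _ => ?_
    rw [sub_eq_iff_eq_add', dir]
  have hzF := E.vertex_mem_frontier (i + 1)
  set z := E.vertex (i + 1)
  set e := E.dir i
  set f := E.dir (i + 1)
  set K := wedge e f with hKdef
  have hK2 : 0 < K ^ 2 := by positivity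
  have he : 0 < ‖e‖ := norm_pos_iff.2 he0
  have hf : 0 < ‖f‖ := norm_pos_iff.2 hf0
  -- The disc is smaller than both edges, so that inside it they look like rays.
  set ε := min ε₀ (min ‖e‖ ‖f‖)
  have hε : 0 < ε := lt_min hε₀ (lt_min he hf)
  have hFiff : ∀ q ∈ ball z ε, (q ∈ frontier E.carrier ↔
      (K * wedge e (q - z) = 0 ∧ 0 ≤ K * wedge f (q - z)) ∨
      (K * wedge f (q - z) = 0 ∧ 0 ≤ K * wedge e (q - z))) := by
    intro q hq
    have hqn : ‖q - z‖ < ε := by simpa [dist_eq_norm] using hq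
    constructor
    · intro hqF
      obtain ⟨j, hj, hqj⟩ := hF q (ball_subset_ball (min_le_left _ _) hq) hqF
      rcases E.vertex_mem_edge hj with rfl | rfl
      · left
        obtain ⟨t, ht0, -, ht⟩ := (hedge q).1 hqj
        rw [ht, wedge_smul_right, wedge_smul_right, wedge_self, wedge_swap f e, ← hKdef]
        refine ⟨by ring, ?_⟩
        have : K * (-t * -K) = t * K ^ 2 := by ring
        rw [this]; positivity
      · right
        obtain ⟨t, ht0, -, ht⟩ := (hedge' q).1 hqj
        rw [ht, wedge_smul_right, wedge_smul_right, wedge_self, ← hKdef]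
        refine ⟨by ring, ?_⟩
        have : K * (t * K) = t * K ^ 2 := by ring
        rw [this]; positivity
    · rintro (⟨h1, h2⟩ | ⟨h1, h2⟩)
      · obtain ⟨t, ht⟩ := exists_smul_of_wedge_eq_zero he0 ((mul_eq_zero.1 h1).resolve_left hK)
        rw [ht, wedge_smul_right, wedge_swap f e, ← hKdef] at h2
        have h3 : t ≤ 0 := by
          by_contra hc; push Not at hc
          have := mul_pos hc hK2; nlinarith
        rw [ht, norm_smul] at hqn
        have h4 : |t| * ‖e‖ < 1 * ‖e‖ := by
          rw [one_mul]; exact hqn.trans_le ((min_le_right _ _).trans (min_le_left _ _))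
        have h5 := abs_lt.1 (lt_of_mul_lt_mul_right h4 he.le)
        exact E.mem_frontier_iff.2 ⟨i, (hedge q).2 ⟨-t, by linarith, by linarith, by rw [ht]; simp⟩⟩
      · obtain ⟨t, ht⟩ := exists_smul_of_wedge_eq_zero hf0 ((mul_eq_zero.1 h1).resolve_left hK)
        rw [ht, wedge_smul_right, ← hKdef] at h2
        have h3 : 0 ≤ t := by
          by_contra hc; push Not at hc
          have := mul_pos (neg_pos.2 hc) hK2; nlinarith
        rw [ht, norm_smul] at hqn
        have h4 : |t| * ‖f‖ < 1 * ‖f‖ := by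
          rw [one_mul]; exact hqn.trans_le ((min_le_right _ _).trans (min_le_right _ _))
        have h5 := abs_lt.1 (lt_of_mul_lt_mul_right h4 hf.le)
        exact E.mem_frontier_iff.2 ⟨i + 1, (hedge' q).2 ⟨t, by linarith, by linarith, by rw [ht]⟩⟩
  have hAF : Disjoint (ball z ε ∩ {q | 0 < K * wedge e (q - z) ∧ 0 < K * wedge f (q - z)})
      (frontier E.carrier) := by
    rw [disjoint_left]
    rintro q ⟨hq, hq1, hq2⟩ hqF
    rcases (hFiff q hq).1 hqF with h | h <;> linarith [h.1]
  have hAF' : Disjoint (ball z ε ∩ {q | 0 < -K * wedge e (q - z) ∨ 0 < -K * wedge f (q - z)})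
      (frontier E.carrier) := by
    rw [disjoint_left]
    rintro q ⟨hq, hq'⟩ hqF
    rcases (hFiff q hq).1 hqF with h | h <;> rcases hq' with h' | h' <;> linarith [h.1, h.2]
  have hA : IsPreconnected (ball z ε ∩ {q | 0 < K * wedge e (q - z) ∧ 0 < K * wedge f (q - z)}) :=
    ((convex_ball z ε).inter
      ((convex_wedge_pos K e z).inter (convex_wedge_pos K f z))).isPreconnected
  have hA' : IsPreconnected
      (ball z ε ∩ {q | 0 < -K * wedge e (q - z) ∨ 0 < -K * wedge f (q - z)}) :=
    isPreconnected_ball_inter_reflex_sector hK hε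
  rcases E.interior_exterior_dichotomy hzF (ball_mem_nhds z hε) hA hA' hAF hAF'
    (fun q hq => by
      rw [hFiff q hq]
      simp only [mem_inter_iff, hq, true_and, mem_ofPred_eq]
      rcases lt_trichotomy (K * wedge e (q - z)) 0 with h1 | h1 | h1 <;>
      rcases lt_trichotomy (K * wedge f (q - z)) 0 with h2 | h2 | h2
      · right; right; left; linarith
      · right; right; left; linarith
      · right; right; left; linarith
      · right; right; right; linarith
      · left; left; exact ⟨h1, h2.ge⟩
      · left; left; exact ⟨h1, h2.le⟩
      · right; right; right; linarith
      · left; right; exact ⟨h2, h1.le⟩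
      · right; left; exact ⟨h1, h2⟩) with h1 | h1
  · left
    refine ⟨ε, hε, fun q hq => ?_⟩
    obtain ⟨h2, h3⟩ := h1 q hq
    rw [h2, h3]
    simp [hq.out]
  · right
    refine ⟨ε, hε, fun q hq => ?_⟩
    obtain ⟨h2, h3⟩ := h1 q hq
    rw [h2, h3]
    simp only [mem_inter_iff, hq, true_and, mem_ofPred_eq, not_and_or, not_lt, neg_mul,
      Left.nonneg_neg_iff]

end PolygonalEnvironment

/-! ### Conic neighbourhoods, grazing points and reflex corners -/

namespace PolygonalEnvironment

variable {n : ℕ} (E : PolygonalEnvironment n)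

lemma frontier_cases {z : Plane} (hz : z ∈ frontier E.carrier) :
    (∃ i, z = E.vertex (i + 1)) ∨ ∃ i, z ∈ openSegment ℝ (E.vertex i) (E.vertex (i + 1)) := by
  obtain ⟨i, hi⟩ := E.mem_frontier_iff.1 hz
  rw [edge, ← insert_endpoints_openSegment] at hi
  rcases hi with rfl | rfl | hi
  · exact Or.inl ⟨i - 1, by simp⟩
  · exact Or.inl ⟨i, rfl⟩
  · exact Or.inr ⟨i, hi⟩

/-- Every point of the environment has a neighbourhood in which the environment is a cone. -/
lemma exists_conic_ball {z : Plane} (hz : z ∈ E.carrier) : ∃ ε > 0, ∀ q ∈ ball z ε,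
    ∀ t : ℝ, 0 < t → z + t • (q - z) ∈ ball z ε →
      (z + t • (q - z) ∈ E.carrier ↔ q ∈ E.carrier) := by
  rcases E.mem_interior_or_mem_frontier hz with hi | hF
  · obtain ⟨ε, hε, hb⟩ := Metric.isOpen_iff.1 isOpen_interior z hi
    exact ⟨ε, hε, fun q hq t _ hqt =>
      iff_of_true (interior_subset (hb hqt)) (interior_subset (hb hq))⟩
  · have key : ∀ (t : ℝ) (c x : ℝ), 0 < t → (0 ≤ c * (t * x) ↔ 0 ≤ c * x) := fun t c x ht => by
      rw [mul_left_comm, mul_nonneg_iff_of_pos_left ht]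
    rcases E.frontier_cases hF with ⟨i, rfl⟩ | ⟨i, hi⟩
    · rcases E.isConvexCorner_or_isReflexCorner i with ⟨ε, hε, h⟩ | ⟨ε, hε, h⟩ <;>
      · refine ⟨ε, hε, fun q hq t ht hqt => ?_⟩
        rw [(h _ hqt).1, (h q hq).1, add_sub_cancel_left, wedge_smul_right, wedge_smul_right,
          key _ _ _ ht, key _ _ _ ht]
    · obtain ⟨s, -, ε, hε, h⟩ := E.local_edge hi
      refine ⟨ε, hε, fun q hq t ht hqt => ?_⟩
      rw [(h _ hqt).1, (h q hq).1, add_sub_cancel_left, wedge_smul_right, key _ _ _ ht]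

/-- In each local shape the interior fills a half-disc, a convex sector or a non-convex sector, all
connected. So the interior cannot reach a boundary point from two separate directions; this is how
simplicity of the polygon enters the global connectedness and separation results. -/
lemma exists_isPreconnected_ball {z : Plane} (hF : z ∈ frontier E.carrier) : ∃ ε > 0, ∀ δ > 0,
    δ ≤ ε → IsPreconnected (ball z δ ∩ interior E.carrier) := by
  have key : ∀ (δ ε : ℝ) (S : Set Plane), δ ≤ ε → (∀ q ∈ ball z ε, q ∈ interior E.carrier ↔ q ∈ S) →
      ball z δ ∩ interior E.carrier = ball z δ ∩ S := by
    intro δ ε S hδ h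
    ext q
    simp only [mem_inter_iff]
    exact and_congr_right fun hq => h q (ball_subset_ball hδ hq)
  rcases E.frontier_cases hF with ⟨i, rfl⟩ | ⟨i, hi⟩
  · rcases E.isConvexCorner_or_isReflexCorner i with ⟨ε, hε, h⟩ | ⟨ε, hε, h⟩
    · refine ⟨ε, hε, fun δ hδ hle => ?_⟩
      rw [key δ ε _ hle fun q hq => (h q hq).2]
      exact ((convex_ball _ δ).inter
        ((convex_wedge_pos _ _ _).inter (convex_wedge_pos _ _ _))).isPreconnected
    · refine ⟨ε, hε, fun δ hδ hle => ?_⟩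
      rw [key δ ε _ hle fun q hq => (h q hq).2]
      exact isPreconnected_ball_inter_reflex_sector (E.wedge_dir_ne_zero i) hδ
  · obtain ⟨s, -, ε, hε, h⟩ := E.local_edge hi
    refine ⟨ε, hε, fun δ hδ hle => ?_⟩
    rw [key δ ε _ hle fun q hq => (h q hq).2]
    exact ((convex_ball _ δ).inter (convex_wedge_pos _ _ _)).isPreconnected

/-- A boundary point grazed by a line of sight that continues into the interior is a reflex
corner. -/
lemma exists_isReflexCorner_of_grazing {a p c : Plane} (ha : a ∈ frontier E.carrier)
    (hapc : a ∈ openSegment ℝ p c) (hpc : segment ℝ p c ⊆ E.carrier)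
    (hac : openSegment ℝ a c ⊆ interior E.carrier) :
    ∃ i, E.IsReflexCorner i ∧ a = E.vertex (i + 1) := by
  obtain ⟨τ, hτ0, hτ1, haτ⟩ := mem_openSegment_iff.1 hapc
  have hd : c - p ≠ 0 := by
    intro h
    rw [sub_eq_zero] at h
    subst h
    have : a = c := by simpa using haτ
    subst this
    exact ha.2 (hac (by simp))
  -- Near `a` the line of sight enters the interior forwards and stays in the environment backwards.
  -- In a half-plane or a convex cone this is impossible: a linear form that is positive forwards is
  -- negative backwards.
  have main : ∀ ε > 0, ∃ η : ℝ, 0 < η ∧ a + η • (c - p) ∈ ball a ε ∧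
      a + (-η) • (c - p) ∈ ball a ε ∧ a + η • (c - p) ∈ interior E.carrier ∧
      a + (-η) • (c - p) ∈ E.carrier := by
    intro ε hε
    obtain ⟨η₀, hη₀, hb⟩ := add_smul_mem_ball (z := a) hd hε
    set η := min η₀ (min τ ((1 - τ) / 2))
    have hη : 0 < η := lt_min hη₀ (lt_min hτ0 (by linarith))
    have h1 : η ≤ η₀ := min_le_left _ _
    have h2 : η ≤ τ := (min_le_right _ _).trans (min_le_left _ _)
    have h3 : η ≤ (1 - τ) / 2 := (min_le_right _ _).trans (min_le_right _ _)
    refine ⟨η, hη, hb _ (by rwa [abs_of_pos hη]), hb _ (by rwa [abs_neg, abs_of_pos hη]), hac ?_,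
      hpc ?_⟩
    · refine mem_openSegment_iff.2 ⟨η / (1 - τ), div_pos hη (by linarith), ?_, ?_⟩
      · rw [div_lt_one (by linarith)]; linarith
      · have : c - a = (1 - τ) • (c - p) := by rw [haτ, sub_smul, one_smul]; abel
        rw [this, smul_smul, div_mul_cancel₀ _ (by linarith)]
    · refine mem_segment_iff.2 ⟨τ - η, by linarith, by linarith, ?_⟩
      nth_rw 1 [haτ]
      rw [sub_smul, neg_smul]; abel
  rcases E.frontier_cases ha with ⟨i, rfl⟩ | ⟨i, hi⟩
  · refine ⟨i, ?_, rfl⟩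
    rcases E.isConvexCorner_or_isReflexCorner i with ⟨ε, hε, h⟩ | h
    · exfalso
      obtain ⟨η, hη, hb, hb', h1, h2⟩ := main ε hε
      have h3 := ((h _ hb).2.1 h1).1
      have h4 := ((h _ hb').1.1 h2).1
      rw [add_sub_cancel_left, wedge_smul_right] at h3 h4
      linarith
    · exact h
  · exfalso
    obtain ⟨s, -, ε, hε, h⟩ := E.local_edge hi
    obtain ⟨η, hη, hb, hb', h1, h2⟩ := main ε hε
    have h3 := (h _ hb).2.1 h1
    have h4 := (h _ hb').1.1 h2
    rw [add_sub_cancel_left, wedge_smul_right] at h3 h4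
    linarith

lemma IsConvexCorner.not_isReflex {E : PolygonalEnvironment n} {i : ZMod n}
    (h : E.IsConvexCorner i) : ¬ E.IsReflex (i + 1) := by
  obtain ⟨ε, hε, h⟩ := h
  intro hr
  apply hr ε hε
  have : E.carrier ∩ ball (E.vertex (i + 1)) ε = ball (E.vertex (i + 1)) ε ∩
      ({q | 0 ≤ wedge (E.dir i) (E.dir (i + 1)) * wedge (E.dir i) (q - E.vertex (i + 1))} ∩
       {q | 0 ≤ wedge (E.dir i) (E.dir (i + 1)) *
        wedge (E.dir (i + 1)) (q - E.vertex (i + 1))}) := by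
    rw [inter_comm]
    ext q
    simp only [mem_inter_iff]
    exact and_congr_right fun hq => (h q hq).1
  rw [this]
  exact (convex_ball _ _).inter ((convex_wedge_nonneg _ _ _).inter (convex_wedge_nonneg _ _ _))

/-- Take a point on each of the two edges, equally far along in units of `dir`: both belong to the
environment, but their midpoint falls into the open cone that is missing. -/
lemma IsReflexCorner.isReflex {E : PolygonalEnvironment n} {i : ZMod n}
    (h : E.IsReflexCorner i) : E.IsReflex (i + 1) := by
  obtain ⟨ε, hε, h⟩ := h
  intro ε' hε' hc
  have hK := E.wedge_dir_ne_zero i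
  have hK2 : 0 < wedge (E.dir i) (E.dir (i + 1)) ^ 2 := by positivity
  obtain ⟨η₁, hη₁, hb₁⟩ := add_smul_mem_ball (z := E.vertex (i + 1)) (E.dir_ne_zero i)
    (lt_min hε hε')
  obtain ⟨η₂, hη₂, hb₂⟩ := add_smul_mem_ball (z := E.vertex (i + 1)) (E.dir_ne_zero (i + 1))
    (lt_min hε hε')
  set η := min η₁ η₂
  have hη : 0 < η := lt_min hη₁ hη₂
  have h1 := hb₁ (-η) (by rw [abs_neg, abs_of_pos hη]; exact min_le_left _ _)
  have h2 := hb₂ η (by rw [abs_of_pos hη]; exact min_le_right _ _)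
  set z := E.vertex (i + 1)
  set e := E.dir i
  set f := E.dir (i + 1)
  have hm := hc.add_smul_sub_mem (x := z + (-η) • e) (y := z + η • f) (t := 1 / 2)
    ⟨(h _ (ball_subset_ball (min_le_left _ _) h1)).1.2 (Or.inl (by simp [wedge_neg_right, wedge_smul_right])),
      ball_subset_ball (min_le_right _ _) h1⟩
    ⟨(h _ (ball_subset_ball (min_le_left _ _) h2)).1.2 (Or.inr (by simp [wedge_smul_right])),
      ball_subset_ball (min_le_right _ _) h2⟩ ⟨by norm_num, by norm_num⟩
  have hmb := (convex_ball z (min ε ε')).add_smul_sub_mem h1 h2 (t := 1 / 2)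
    ⟨by norm_num, by norm_num⟩
  have hm' : z + (-η) • e + (1 / 2 : ℝ) • (z + η • f - (z + (-η) • e)) - z =
      (-(η / 2)) • e + (η / 2) • f := by
    module
  have := (h _ (ball_subset_ball (min_le_left _ _) hmb)).1.1 hm.1
  rw [hm'] at this
  simp only [wedge_add_right, wedge_smul_right, wedge_self, wedge_swap f e] at this
  have hηK := mul_pos hη hK2
  rcases this with h | h <;> nlinarith

lemma isReflexCorner_iff (i : ZMod n) : E.IsReflexCorner i ↔ E.IsReflex (i + 1) := by
  refine ⟨fun h => h.isReflex, fun h => ?_⟩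
  rcases E.isConvexCorner_or_isReflexCorner i with h' | h'
  · exact absurd h h'.not_isReflex
  · exact h'

/-! ### Connectedness of the boundary and of the interior -/

lemma isPreconnected_frontier : IsPreconnected (frontier E.carrier) := by
  have := E.neZero
  have hF : frontier E.carrier = ⋃ k : ℕ, E.edge (k : ZMod n) := by
    ext z
    rw [E.mem_frontier_iff, mem_iUnion]
    refine ⟨fun ⟨i, hi⟩ => ?_, fun ⟨k, hk⟩ => ⟨k, hk⟩⟩
    obtain ⟨k, rfl⟩ := ZMod.natCast_zmod_surjective i
    exact ⟨k, hi⟩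
  rw [hF]
  refine IsPreconnected.iUnion_of_chain (fun k => isPreconnected_segment _ _) fun k => ?_
  refine ⟨E.vertex (k + 1 : ZMod n), right_mem_segment _ _ _, ?_⟩
  simp only [Nat.succ_eq_succ, Nat.succ_eq_add_one, Nat.cast_add, Nat.cast_one]
  exact left_mem_segment _ _ _

/-- If the interior split into two open pieces, the closures of the pieces would both meet the
boundary and together cover it. As the boundary is connected, some boundary point would lie in both
closures, whereas the interior is connected near that point. -/
lemma isPreconnected_interior : IsPreconnected (interior E.carrier) := by
  rintro u v hu hv huv hneu hnev
  by_contra hdis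
  have hfr : ∀ u v : Set Plane, IsOpen u → IsOpen v → interior E.carrier ⊆ u ∪ v →
      (interior E.carrier ∩ u).Nonempty → ¬ (interior E.carrier ∩ (u ∩ v)).Nonempty →
      (frontier E.carrier ∩ closure (interior E.carrier ∩ u)).Nonempty := by
    intro u v hu hv huv hne hdis
    have hbdd : Bornology.IsBounded (interior E.carrier ∩ u) :=
      E.isCompact.isBounded.subset (inter_subset_left.trans interior_subset)
    obtain ⟨x, hx⟩ := nonempty_frontier_iff.2 ⟨hne, by
      rintro h
      rw [h] at hbdd
      exact NormedSpace.unbounded_univ ℝ Plane hbdd⟩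
    refine ⟨x, ?_, hx.1⟩
    have hxE : x ∈ E.carrier :=
      closure_minimal (inter_subset_left.trans interior_subset) E.isClosed hx.1
    rcases E.mem_interior_or_mem_frontier hxE with hi | hF
    · exfalso
      rcases huv hi with h | h
      · exact hx.2 ((isOpen_interior.inter hu).interior_eq.symm ▸ ⟨hi, h⟩)
      · obtain ⟨y, hy, hy'⟩ := mem_closure_iff_nhds.1 hx.1 v (hv.mem_nhds h)
        exact hdis ⟨y, hy'.1, hy'.2, hy⟩
    · exact hF
  have h1 := hfr u v hu hv huv hneu hdis
  have h2 := hfr v u hv hu (by rwa [union_comm]) hnev (by rwa [inter_comm u v] at hdis)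
  obtain ⟨z, hzF, hzu, hzv⟩ := isPreconnected_closed_iff.1 E.isPreconnected_frontier _ _
    isClosed_closure isClosed_closure (by
      rw [← closure_union, ← inter_union_distrib_left, inter_eq_left.2 huv, E.closure_interior]
      exact E.frontier_subset) h1 h2
  obtain ⟨ε, hε, hball⟩ := E.exists_isPreconnected_ball hzF
  obtain ⟨x, hx, hx'⟩ := mem_closure_iff_nhds.1 hzu _ (ball_mem_nhds z hε)
  obtain ⟨y, hy, hy'⟩ := mem_closure_iff_nhds.1 hzv _ (ball_mem_nhds z hε)
  obtain ⟨w, hw, hw'⟩ := hball ε hε le_rfl u v hu hv (inter_subset_right.trans huv)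
    ⟨x, ⟨hx, hx'.1⟩, hx'.2⟩ ⟨y, ⟨hy, hy'.1⟩, hy'.2⟩
  exact hdis ⟨w, hw.2, hw'⟩

/-! ### Orientation: the side of its edges on which the environment lies -/

/-- The points near which the environment contains the side `s` of the line of the `i`-th edge. -/
def sideSet (i : ZMod n) (s : ℝ) : Set Plane :=
  {y | ∃ ε > 0, ∀ q ∈ ball y ε, 0 < s * wedge (E.dir i) (q - E.vertex i) → q ∈ E.carrier}

lemma isOpen_sideSet (i : ZMod n) (s : ℝ) : IsOpen (E.sideSet i s) := by
  rw [Metric.isOpen_iff]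
  rintro y ⟨ε, hε, h⟩
  refine ⟨ε / 2, by positivity, fun y' hy' => ⟨ε / 2, by positivity, fun q hq hs => h q ?_ hs⟩⟩
  have := dist_triangle q y' y
  simp only [mem_ball] at *
  linarith

lemma wedge_dir_sub_of_mem_edge {i : ZMod n} {z : Plane} (h : z ∈ E.edge i) (q : Plane) :
    wedge (E.dir i) (q - E.vertex i) = wedge (E.dir i) (q - z) := by
  have : q - E.vertex i = (q - z) + (z - E.vertex i) := by abel
  rw [this, wedge_add_right, E.wedge_dir_sub_eq_zero h, add_zero]

lemma mul_pos_of_mem_sideSet {i : ZMod n} {s t : ℝ} {z : Plane} (hs : s ≠ 0) (ht : t ≠ 0)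
    (hz : z ∈ openSegment ℝ (E.vertex i) (E.vertex (i + 1)))
    (h1 : z ∈ E.sideSet i s) (h2 : z ∈ E.sideSet i t) : 0 < s * t := by
  have hzE : z ∈ E.edge i := openSegment_subset_segment _ _ _ hz
  obtain ⟨r, hr, ε, hε, h⟩ := E.local_edge hz
  have hr0 : r ≠ 0 := by rcases hr with rfl | rfl <;> norm_num
  have key : ∀ s : ℝ, s ≠ 0 → z ∈ E.sideSet i s → 0 < s * r := by
    rintro s hs ⟨δ, hδ, hsδ⟩
    obtain ⟨q, hq, hpos⟩ := exists_mem_ball_wedge_pos (u := s • E.dir i)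
      (smul_ne_zero hs (E.dir_ne_zero i)) z (lt_min hε hδ)
    rw [wedge_smul_left] at hpos
    have hqE := hsδ q (ball_subset_ball (min_le_right _ _) hq)
      (by rwa [E.wedge_dir_sub_of_mem_edge hzE])
    have h3 := (h q (ball_subset_ball (min_le_left _ _) hq)).1.1 hqE
    have h4 : 0 ≤ (s * r) * wedge (E.dir i) (q - z) ^ 2 := by nlinarith
    have h5 : wedge (E.dir i) (q - z) ≠ 0 := by rintro h0; simp [h0] at hpos
    have h6 : 0 ≤ s * r := nonneg_of_mul_nonneg_left h4 (by positivity)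
    exact lt_of_le_of_ne h6 (mul_ne_zero hs hr0).symm
  have h3 := key s hs h1
  have h4 := key t ht h2
  have : 0 < (s * t) * r ^ 2 := by nlinarith [mul_pos h3 h4]
  exact pos_of_mul_pos_left this (by positivity)

/-- The sets of points with the environment on the side `1` or `-1` are open, cover the open edge
and do not meet on it. The open edge is connected, so one of them contains all of it. -/
lemma exists_side (i : ZMod n) : ∃ s : ℝ, (s = 1 ∨ s = -1) ∧
    openSegment ℝ (E.vertex i) (E.vertex (i + 1)) ⊆ E.sideSet i s := by
  have hpre : IsPreconnected (openSegment ℝ (E.vertex i) (E.vertex (i + 1))) :=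
    (convex_openSegment _ _).isPreconnected
  have hcov : openSegment ℝ (E.vertex i) (E.vertex (i + 1)) ⊆
      E.sideSet i 1 ∪ E.sideSet i (-1) := by
    intro z hz
    have hzE : z ∈ E.edge i := openSegment_subset_segment _ _ _ hz
    obtain ⟨r, hr, ε, hε, h⟩ := E.local_edge hz
    have : z ∈ E.sideSet i r := ⟨ε, hε, fun q hq hq' => interior_subset ((h q hq).2.2
      (by rwa [E.wedge_dir_sub_of_mem_edge hzE] at hq'))⟩
    rcases hr with rfl | rfl
    · exact Or.inl this
    · exact Or.inr this
  by_contra hc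
  push Not at hc
  have h1 := hc 1 (Or.inl rfl)
  have h2 := hc (-1) (Or.inr rfl)
  rw [not_subset] at h1 h2
  obtain ⟨x, hx, hx'⟩ := h1
  obtain ⟨y, hy, hy'⟩ := h2
  obtain ⟨w, hw, hw1, hw2⟩ := hpre _ _ (E.isOpen_sideSet i 1) (E.isOpen_sideSet i (-1)) hcov
    ⟨y, hy, (hcov hy).resolve_right hy'⟩ ⟨x, hx, (hcov hx).resolve_left hx'⟩
  have := E.mul_pos_of_mem_sideSet one_ne_zero (by norm_num) hw hw1 hw2
  norm_num at this

lemma mem_openSegment_edge (i : ZMod n) {η : ℝ} (h0 : 0 < η) (h1 : η < 1) :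
    E.vertex (i + 1) + (-η) • E.dir i ∈ openSegment ℝ (E.vertex i) (E.vertex (i + 1)) := by
  refine mem_openSegment_iff.2 ⟨1 - η, by linarith, by linarith, ?_⟩
  rw [dir]; module

lemma mem_openSegment_edge_succ (i : ZMod n) {η : ℝ} (h0 : 0 < η) (h1 : η < 1) :
    E.vertex (i + 1) + η • E.dir (i + 1) ∈
      openSegment ℝ (E.vertex (i + 1)) (E.vertex (i + 1 + 1)) :=
  add_smul_sub_mem_openSegment h0 h1

/-- At a corner, both edges have the environment on the same side. -/
lemma exists_mem_sideSet_of_corner (i : ZMod n) {c : ℝ}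
    (hc : (c = wedge (E.dir i) (E.dir (i + 1)) ∧ E.IsConvexCorner i) ∨
      (c = - wedge (E.dir i) (E.dir (i + 1)) ∧ E.IsReflexCorner i)) :
    (∃ y ∈ openSegment ℝ (E.vertex i) (E.vertex (i + 1)), y ∈ E.sideSet i c) ∧
    (∃ y ∈ openSegment ℝ (E.vertex (i + 1)) (E.vertex (i + 1 + 1)), y ∈ E.sideSet (i + 1) c) := by
  have hK := E.wedge_dir_ne_zero i
  have hK2 : 0 < wedge (E.dir i) (E.dir (i + 1)) ^ 2 := by positivity
  have hz : E.vertex (i + 1) ∈ E.edge i := right_mem_segment _ _ _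
  have hpts : ∀ ε > 0, ∃ η : ℝ, 0 < η ∧ η < 1 ∧
      E.vertex (i + 1) + (-η) • E.dir i ∈ ball (E.vertex (i + 1)) ε ∧
      E.vertex (i + 1) + η • E.dir (i + 1) ∈ ball (E.vertex (i + 1)) ε := by
    intro ε hε
    obtain ⟨η₁, hη₁, hb₁⟩ := add_smul_mem_ball (z := E.vertex (i + 1)) (E.dir_ne_zero i) hε
    obtain ⟨η₂, hη₂, hb₂⟩ := add_smul_mem_ball (z := E.vertex (i + 1)) (E.dir_ne_zero (i + 1)) hε
    have hη : 0 < min (1 / 2) (min η₁ η₂) := lt_min (by norm_num) (lt_min hη₁ hη₂)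
    refine ⟨_, hη, (min_le_left _ _).trans_lt (by norm_num), hb₁ _ ?_, hb₂ _ ?_⟩
    · rw [abs_neg, abs_of_pos hη]; exact (min_le_right _ _).trans (min_le_left _ _)
    · rw [abs_of_pos hη]; exact (min_le_right _ _).trans (min_le_right _ _)
  rcases hc with ⟨rfl, ε, hε, h⟩ | ⟨rfl, ε, hε, h⟩
  · obtain ⟨η, hη, hη1, hb1, hb2⟩ := hpts ε hε
    have hηK := mul_pos hη hK2
    refine ⟨⟨_, E.mem_openSegment_edge i hη hη1, ?_⟩, ⟨_, E.mem_openSegment_edge_succ i hη hη1, ?_⟩⟩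
    · have hopen : IsOpen {q | 0 < wedge (E.dir i) (E.dir (i + 1)) *
          wedge (E.dir (i + 1)) (q - E.vertex (i + 1))} :=
        isOpen_lt (by fun_prop) (by fun_prop)
      obtain ⟨δ, hδ, hδb⟩ := Metric.isOpen_iff.1 (isOpen_ball.inter hopen)
        (E.vertex (i + 1) + (-η) • E.dir i) ⟨hb1, by
          rw [mem_ofPred_eq, add_sub_cancel_left, wedge_smul_right, wedge_swap (E.dir (i + 1))]
          linarith⟩
      refine ⟨δ, hδ, fun q hq hq' => interior_subset ((h q (hδb hq).1).2.2 ⟨?_, (hδb hq).2⟩)⟩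
      rwa [E.wedge_dir_sub_of_mem_edge hz] at hq'
    · have hopen : IsOpen {q | 0 < wedge (E.dir i) (E.dir (i + 1)) *
          wedge (E.dir i) (q - E.vertex (i + 1))} :=
        isOpen_lt (by fun_prop) (by fun_prop)
      obtain ⟨δ, hδ, hδb⟩ := Metric.isOpen_iff.1 (isOpen_ball.inter hopen)
        (E.vertex (i + 1) + η • E.dir (i + 1)) ⟨hb2, by
          rw [mem_ofPred_eq, add_sub_cancel_left, wedge_smul_right]
          linarith⟩
      exact ⟨δ, hδ, fun q hq hq' => interior_subset ((h q (hδb hq).1).2.2 ⟨(hδb hq).2, hq'⟩)⟩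
  · obtain ⟨η, hη, hη1, hb1, hb2⟩ := hpts ε hε
    refine ⟨⟨_, E.mem_openSegment_edge i hη hη1, ?_⟩, ⟨_, E.mem_openSegment_edge_succ i hη hη1, ?_⟩⟩
    · obtain ⟨δ, hδ, hδb⟩ := Metric.isOpen_iff.1 isOpen_ball _ hb1
      refine ⟨δ, hδ, fun q hq hq' => interior_subset ((h q (hδb hq)).2.2 (Or.inl ?_))⟩
      rwa [E.wedge_dir_sub_of_mem_edge hz] at hq'
    · obtain ⟨δ, hδ, hδb⟩ := Metric.isOpen_iff.1 isOpen_ball _ hb2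
      exact ⟨δ, hδ, fun q hq hq' => interior_subset ((h q (hδb hq)).2.2 (Or.inr hq'))⟩

/-- The environment lies on the same side of all its oriented edges; its convex and reflex
corners are told apart by the direction in which the boundary turns. -/
lemma exists_orientation : ∃ s : ℝ, (s = 1 ∨ s = -1) ∧ ∀ i,
    (E.IsConvexCorner i → 0 < s * wedge (E.dir i) (E.dir (i + 1))) ∧
    (E.IsReflexCorner i → s * wedge (E.dir i) (E.dir (i + 1)) < 0) := by
  have := E.neZero
  choose s hs hside using E.exists_side
  have hs0 : ∀ i, s i ≠ 0 := fun i => by rcases hs i with h | h <;> rw [h] <;> norm_num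
  have key : ∀ i c, ((c = wedge (E.dir i) (E.dir (i + 1)) ∧ E.IsConvexCorner i) ∨
      (c = - wedge (E.dir i) (E.dir (i + 1)) ∧ E.IsReflexCorner i)) →
      0 < s i * c ∧ 0 < s (i + 1) * c := by
    intro i c hc
    have hc0 : c ≠ 0 := by
      have := E.wedge_dir_ne_zero i
      rcases hc with ⟨rfl, -⟩ | ⟨rfl, -⟩
      · exact this
      · exact neg_ne_zero.2 this
    obtain ⟨⟨y, hy, hy'⟩, ⟨x, hx, hx'⟩⟩ := E.exists_mem_sideSet_of_corner i hc
    exact ⟨E.mul_pos_of_mem_sideSet (hs0 _) hc0 hy (hside i hy) hy',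
      E.mul_pos_of_mem_sideSet (hs0 _) hc0 hx (hside _ hx) hx'⟩
  -- One and the same `c` marks the inner side of both edges at a corner, so the sign passes from
  -- each edge to the next and round the polygon.
  have hstep : ∀ i, s (i + 1) = s i := by
    intro i
    obtain ⟨c, hc⟩ : ∃ c, ((c = wedge (E.dir i) (E.dir (i + 1)) ∧ E.IsConvexCorner i) ∨
      (c = - wedge (E.dir i) (E.dir (i + 1)) ∧ E.IsReflexCorner i)) := by
      rcases E.isConvexCorner_or_isReflexCorner i with h | h
      · exact ⟨_, Or.inl ⟨rfl, h⟩⟩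
      · exact ⟨_, Or.inr ⟨rfl, h⟩⟩
    obtain ⟨h1, h2⟩ := key i c hc
    rcases hs i with h | h <;> rcases hs (i + 1) with h' | h' <;> rw [h, h'] <;>
      rw [h] at h1 <;> rw [h'] at h2 <;> linarith
  have hconst : ∀ k : ℕ, s (k : ZMod n) = s 0 := by
    intro k
    induction k with
    | zero => simp
    | succ k ih => rw [Nat.cast_succ, hstep, ih]
  refine ⟨s 0, hs 0, fun i => ?_⟩
  obtain ⟨k, rfl⟩ := ZMod.natCast_zmod_surjective i
  rw [← hconst k]
  refine ⟨fun h => (key _ _ (Or.inl ⟨rfl, h⟩)).1, fun h => ?_⟩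
  have := (key _ _ (Or.inr ⟨rfl, h⟩)).1
  linarith

end PolygonalEnvironment

/-! ### Continuous angles and separation by a chord -/

/-- The complex number with the coordinates of a point of the plane. -/
def toComplex (q : Plane) : ℂ := ⟨q 0, q 1⟩

lemma toComplex_sub (p q : Plane) : toComplex (p - q) = toComplex p - toComplex q := by
  apply Complex.ext <;> simp [toComplex]

lemma toComplex_smul (t : ℝ) (q : Plane) : toComplex (t • q) = t * toComplex q := by
  apply Complex.ext <;> simp [toComplex]

lemma toComplex_injective : Function.Injective toComplex := fun _ _ h =>
  Plane.ext' (congrArg Complex.re h) (congrArg Complex.im h)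

@[simp] lemma toComplex_zero : toComplex 0 = 0 := by apply Complex.ext <;> simp [toComplex]

lemma toComplex_ne_zero {q : Plane} (h : q ≠ 0) : toComplex q ≠ 0 := fun h0 =>
  h (toComplex_injective (by simpa using h0))

@[fun_prop]
lemma continuous_toComplex : Continuous toComplex := by
  have : toComplex = fun q => ((q 0 : ℝ) : ℂ) + ((q 1 : ℝ) : ℂ) * Complex.I := by
    funext q; apply Complex.ext <;> simp [toComplex]
  rw [this]
  fun_prop

lemma mem_segment_of_sub_eq_smul {a b z : Plane} {w : ℝ} (hw : w ≤ 0)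
    (h : z - b = w • (z - a)) : z ∈ segment ℝ a b := by
  have h1 : 0 < 1 - w := by linarith
  refine mem_segment_iff.2 ⟨1 / (1 - w), by positivity, (div_le_one h1).2 (by linarith), ?_⟩
  have h2 : b - a = (1 - w) • (z - a) := by
    rw [sub_smul, ← h, one_smul]; abel
  rw [h2, smul_smul, one_div_mul_cancel h1.ne', one_smul]; abel

/-- There is a continuous choice, off the set `F`, of the angle under which `[a, b]` is seen. -/
def HasAngle (F : Set Plane) (a b : Plane) : Prop :=
  ∃ h : Plane → ℝ, ContinuousOn h Fᶜ ∧ ∀ z ∉ F, ∃ r : ℝ, 0 < r ∧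
    toComplex (z - b) = r * Complex.exp (h z * Complex.I) * toComplex (z - a)

lemma HasAngle.trans {F : Set Plane} {a b c : Plane} (h1 : HasAngle F a b) (h2 : HasAngle F b c) :
    HasAngle F a c := by
  obtain ⟨h, hc, hh⟩ := h1
  obtain ⟨k, kc, hk⟩ := h2
  refine ⟨h + k, hc.add kc, fun z hz => ?_⟩
  obtain ⟨r, hr, e1⟩ := hh z hz
  obtain ⟨s, hs, e2⟩ := hk z hz
  refine ⟨s * r, mul_pos hs hr, ?_⟩
  rw [e2, e1, Pi.add_apply]
  push_cast
  rw [add_mul, Complex.exp_add]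
  ring

lemma HasAngle.symm {F : Set Plane} {a b : Plane} (h1 : HasAngle F a b) : HasAngle F b a := by
  obtain ⟨h, hc, hh⟩ := h1
  refine ⟨-h, hc.neg, fun z hz => ?_⟩
  obtain ⟨r, hr, e1⟩ := hh z hz
  refine ⟨r⁻¹, inv_pos.2 hr, ?_⟩
  have hr' : (r : ℂ) ≠ 0 := by exact_mod_cast hr.ne'
  rw [e1, Pi.neg_apply]
  push_cast
  rw [neg_mul, Complex.exp_neg]
  field_simp

/-- The quotient `(z - b) / (z - a)` is a nonpositive real only for `z` on the segment, so off the
segment its principal argument is continuous. -/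
lemma hasAngle_of_segment_subset {F : Set Plane} {a b : Plane} (h : segment ℝ a b ⊆ F) :
    HasAngle F a b := by
  have hz0 : ∀ z ∉ F, toComplex (z - a) ≠ 0 := by
    intro z hz
    apply toComplex_ne_zero
    rw [sub_ne_zero]
    rintro rfl
    exact hz (h (left_mem_segment _ _ _))
  have hslit : ∀ z ∉ F, toComplex (z - b) / toComplex (z - a) ∈ Complex.slitPlane := by
    intro z hz
    by_contra hc
    rw [Complex.mem_slitPlane_iff] at hc
    push Not at hc
    obtain ⟨hre, him⟩ := hc
    apply hz
    apply h
    apply mem_segment_of_sub_eq_smul hre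
    apply toComplex_injective
    rw [toComplex_smul]
    have : ((toComplex (z - b) / toComplex (z - a)).re : ℂ) = toComplex (z - b) / toComplex (z - a) :=
      Complex.ext (by simp) (by simp [him])
    rw [this, div_mul_cancel₀ _ (hz0 z hz)]
  refine ⟨fun z => (toComplex (z - b) / toComplex (z - a)).arg, ?_, ?_⟩
  · intro z hz
    have h1 : ContinuousAt (fun z => toComplex (z - b) / toComplex (z - a)) z :=
      ContinuousAt.div (by fun_prop) (by fun_prop) (hz0 z hz)
    exact (ContinuousAt.comp (f := fun z => toComplex (z - b) / toComplex (z - a))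
      (Complex.continuousAt_arg (hslit z hz)) h1).continuousWithinAt
  · intro z hz
    refine ⟨‖toComplex (z - b) / toComplex (z - a)‖,
      norm_pos_iff.2 (Complex.slitPlane_ne_zero (hslit z hz)), ?_⟩
    rw [Complex.norm_mul_exp_arg_mul_I, div_mul_cancel₀ _ (hz0 z hz)]

/-- The boundary contains a polygonal path between `a` and `b`; the angles of its pieces add up to
an angle for the whole. -/
lemma PolygonalEnvironment.hasAngle {n : ℕ} (E : PolygonalEnvironment n) {a b : Plane}
    (ha : a ∈ frontier E.carrier) (hb : b ∈ frontier E.carrier) :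
    HasAngle (frontier E.carrier) a b := by
  have := E.neZero
  have hedge : ∀ i, E.edge i ⊆ frontier E.carrier := fun i z hz => E.mem_frontier_iff.2 ⟨i, hz⟩
  have hv : ∀ k : ℕ, HasAngle (frontier E.carrier) (E.vertex 0) (E.vertex (k : ZMod n)) := by
    intro k
    induction k with
    | zero =>
      apply hasAngle_of_segment_subset
      simpa using E.vertex_mem_frontier 0
    | succ k ih =>
      refine ih.trans (hasAngle_of_segment_subset ?_)
      rw [Nat.cast_succ]
      exact hedge _
  have hz : ∀ z ∈ frontier E.carrier, HasAngle (frontier E.carrier) (E.vertex 0) z := by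
    intro z hz
    obtain ⟨i, hi⟩ := E.mem_frontier_iff.1 hz
    obtain ⟨k, rfl⟩ := ZMod.natCast_zmod_surjective i
    exact (hv k).trans (hasAngle_of_segment_subset
      (((convex_segment _ _).segment_subset (left_mem_segment _ _ _) hi).trans (hedge _)))
  exact (hz a ha).symm.trans (hz b hb)

/-- The chord `[a, b]` divides the open region `Ω` into the two connected open sets `C` and `D`,
where `C` is on the side of the chord given by the sign of `s`. -/
structure Sides (Ω : Set Plane) (a b : Plane) (C D : Set Plane) (s : ℝ) : Prop where
  ne : a ≠ b
  sign_ne : s ≠ 0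
  isOpen_left : IsOpen C
  isOpen_right : IsOpen D
  isPreconnected_left : IsPreconnected C
  isPreconnected_right : IsPreconnected D
  disjoint : Disjoint C D
  union_eq : C ∪ D = Ω \ segment ℝ a b
  collar : ∀ y ∈ openSegment ℝ a b, ∃ ε > 0, ∀ q ∈ ball y ε,
    (0 < s * wedge (b - a) (q - a) → q ∈ C) ∧ (s * wedge (b - a) (q - a) < 0 → q ∈ D) ∧
    (wedge (b - a) (q - a) = 0 → q ∈ openSegment ℝ a b)

lemma Sides.symm {Ω : Set Plane} {a b : Plane} {C D : Set Plane} {s : ℝ} (h : Sides Ω a b C D s) :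
    Sides Ω a b D C (-s) where
  ne := h.ne
  sign_ne := neg_ne_zero.2 h.sign_ne
  isOpen_left := h.isOpen_right
  isOpen_right := h.isOpen_left
  isPreconnected_left := h.isPreconnected_right
  isPreconnected_right := h.isPreconnected_left
  disjoint := h.disjoint.symm
  union_eq := by rw [union_comm, h.union_eq]
  collar := fun y hy => by
    obtain ⟨ε, hε, hc⟩ := h.collar y hy
    refine ⟨ε, hε, fun q hq => ?_⟩
    obtain ⟨h1, h2, h3⟩ := hc q hq
    exact ⟨fun h => h2 (by linarith), fun h => h1 (by linarith), h3⟩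

lemma wedge_sub_of_mem_segment {a b y : Plane} (hy : y ∈ segment ℝ a b) (q : Plane) :
    wedge (b - a) (q - a) = wedge (b - a) (q - y) := by
  have : q - a = (q - y) + (y - a) := by abel
  rw [this, wedge_add_right, wedge_sub_eq_zero_of_mem_segment hy, add_zero]

lemma exists_mem_ball_wedge_sub_pos {a b y : Plane} (hab : a ≠ b) {s : ℝ} (hs : s ≠ 0)
    (hy : y ∈ openSegment ℝ a b) {ε : ℝ} (hε : 0 < ε) :
    ∃ q ∈ ball y ε, 0 < s * wedge (b - a) (q - a) := by
  obtain ⟨q, hq, hq'⟩ := exists_mem_ball_wedge_pos (u := s • (b - a))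
    (smul_ne_zero hs (sub_ne_zero.2 hab.symm)) y hε
  exact ⟨q, hq, by
    rwa [wedge_sub_of_mem_segment (openSegment_subset_segment _ _ _ hy), ← wedge_smul_left]⟩

/-- Suppose `u` and `v` split `C`. The points of the open chord at which the strip on the side of
`C` lies in `u`, and those for which it lies in `v`, form disjoint open sets that cover the chord,
so one of them is the whole chord. If it is the one of `u`, then `C ∩ v` stays away from the chord
and from `D`, so it is open and closed in the connected `Ω`. -/
lemma isPreconnected_of_collar {Ω : Set Plane} {a b : Plane} {C D : Set Plane} {s : ℝ}
    (hΩ : IsPreconnected Ω) (hab : a ≠ b) (hs : s ≠ 0) (ha : a ∉ Ω) (hb : b ∉ Ω)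
    (hC : IsOpen C) (hD : IsOpen D)
    (hCD : Disjoint C D) (hun : C ∪ D = Ω \ segment ℝ a b)
    (hcol : ∀ y ∈ openSegment ℝ a b, ∃ ε > 0, ∀ q ∈ ball y ε,
      (0 < s * wedge (b - a) (q - a) → q ∈ C) ∧ (s * wedge (b - a) (q - a) < 0 → q ∈ D) ∧
      (wedge (b - a) (q - a) = 0 → q ∈ openSegment ℝ a b)) : IsPreconnected C := by
  intro u v hu hv huv hneu hnev
  by_contra hdis
  have hCΩ : C ⊆ Ω := fun x hx => (hun ▸ Or.inl hx : x ∈ Ω \ segment ℝ a b).1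
  have hCseg : ∀ x ∈ C, x ∉ segment ℝ a b :=
    fun x hx => (hun ▸ Or.inl hx : x ∈ Ω \ segment ℝ a b).2
  let W : Set Plane → Set Plane := fun u =>
    {y | ∃ ε > 0, ∀ q ∈ ball y ε, 0 < s * wedge (b - a) (q - a) → q ∈ C ∩ u}
  have hWo : ∀ u, IsOpen (W u) := by
    intro u
    rw [Metric.isOpen_iff]
    rintro y ⟨ε, hε, h⟩
    refine ⟨ε / 2, by positivity, fun y' hy' => ⟨ε / 2, by positivity, fun q hq hs => h q ?_ hs⟩⟩
    have := dist_triangle q y' y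
    simp only [mem_ball] at *
    linarith
  have hcov : openSegment ℝ a b ⊆ W u ∪ W v := by
    intro y hy
    obtain ⟨ε, hε, hc⟩ := hcol y hy
    have hpre : IsPreconnected (ball y ε ∩ {q | 0 < s * wedge (b - a) (q - a)}) :=
      ((convex_ball _ _).inter (convex_wedge_pos _ _ _)).isPreconnected
    have hsub : ball y ε ∩ {q | 0 < s * wedge (b - a) (q - a)} ⊆ C := fun q hq => (hc q hq.1).1 hq.2
    by_contra hno
    rw [mem_union, not_or] at hno
    have : ∀ u v : Set Plane, C ⊆ u ∪ v → y ∉ W u →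
        ((ball y ε ∩ {q | 0 < s * wedge (b - a) (q - a)}) ∩ v).Nonempty := by
      intro u v huv hyu
      by_contra hemp
      rw [not_nonempty_iff_eq_empty] at hemp
      refine hyu ⟨ε, hε, fun q hq hq' => ⟨hsub ⟨hq, hq'⟩, ?_⟩⟩
      rcases huv (hsub ⟨hq, hq'⟩) with h | h
      · exact h
      · exact absurd (hemp ▸ ⟨⟨hq, hq'⟩, h⟩ : q ∈ (∅ : Set Plane)) (notMem_empty _)
    obtain ⟨w, hw, hw'⟩ := hpre u v hu hv (hsub.trans huv)
      (this v u (by rwa [union_comm]) hno.2) (this u v huv hno.1)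
    exact hdis ⟨w, hsub hw, hw'⟩
  have hno : ¬ (openSegment ℝ a b ∩ (W u ∩ W v)).Nonempty := by
    rintro ⟨y, hy, ⟨ε, hε, h1⟩, ⟨δ, hδ, h2⟩⟩
    obtain ⟨q, hq, hq'⟩ := exists_mem_ball_wedge_sub_pos hab hs hy (lt_min hε hδ)
    exact hdis ⟨q, (h1 q (ball_subset_ball (min_le_left _ _) hq) hq').1,
      (h1 q (ball_subset_ball (min_le_left _ _) hq) hq').2,
      (h2 q (ball_subset_ball (min_le_right _ _) hq) hq').2⟩
  have hfinal : ∀ u v : Set Plane, IsOpen u → IsOpen v → C ⊆ u ∪ v → (C ∩ u).Nonempty →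
      (C ∩ v).Nonempty → ¬ (C ∩ (u ∩ v)).Nonempty → ¬ openSegment ℝ a b ⊆ W u := by
    intro u v hu hv huv hneu hnev hdis hW
    have hopen := (hC.inter hv)
    obtain ⟨x, hx, hx1, hx2⟩ := hΩ (C ∩ v) (closure (C ∩ v))ᶜ hopen isClosed_closure.isOpen_compl
      (by
        intro q hq
        by_cases hqs : q ∈ segment ℝ a b
        · right
          have hqo : q ∈ openSegment ℝ a b := mem_openSegment_of_ne_left_right
            (by rintro rfl; exact ha hq) (by rintro rfl; exact hb hq) hqs
          obtain ⟨ε, hε, hc⟩ := hcol q hqo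
          obtain ⟨δ, hδ, hc'⟩ := hW hqo
          intro hcl
          obtain ⟨x, hx, hxC, hxv⟩ := mem_closure_iff_nhds.1 hcl _ (ball_mem_nhds q (lt_min hε hδ))
          obtain ⟨h1, h2, h3⟩ := hc x (ball_subset_ball (min_le_left _ _) hx)
          rcases lt_trichotomy (s * wedge (b - a) (x - a)) 0 with h | h | h
          · exact disjoint_left.1 hCD hxC (h2 h)
          · exact hCseg x hxC (openSegment_subset_segment _ _ _
              (h3 ((mul_eq_zero.1 h).resolve_left hs)))
          · exact hdis ⟨x, hxC, (hc' x (ball_subset_ball (min_le_right _ _) hx) h).2, hxv⟩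
        · have hq' : q ∈ C ∪ D := by rw [hun]; exact ⟨hq, hqs⟩
          have hfar : ∀ V : Set Plane, IsOpen V → Disjoint V (C ∩ v) → q ∈ V →
              q ∈ (closure (C ∩ v))ᶜ := fun V hV hd hqV hcl => by
            obtain ⟨x, hx, hx'⟩ := mem_closure_iff_nhds.1 hcl V (hV.mem_nhds hqV)
            exact disjoint_left.1 hd hx hx'
          rcases hq' with hqC | hqD
          · rcases huv hqC with h | h
            · right
              refine hfar _ (hC.inter hu) ?_ ⟨hqC, h⟩
              rw [disjoint_left]
              rintro x ⟨h1, h2⟩ ⟨-, h3⟩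
              exact hdis ⟨x, h1, h2, h3⟩
            · exact Or.inl ⟨hqC, h⟩
          · right
            exact hfar D hD (hCD.symm.mono_right inter_subset_left) hqD)
      (by obtain ⟨x, hx⟩ := hnev; exact ⟨x, hCΩ hx.1, hx⟩)
      (by
        obtain ⟨x, hx⟩ := hneu
        refine ⟨x, hCΩ hx.1, fun hcl => ?_⟩
        obtain ⟨y, hy, hy'⟩ := mem_closure_iff_nhds.1 hcl _ ((hC.inter hu).mem_nhds hx)
        exact hdis ⟨y, hy.1, hy.2, hy'.2⟩)
    exact hx2 (subset_closure hx1)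
  have hpre : IsPreconnected (openSegment ℝ a b) := (convex_openSegment _ _).isPreconnected
  have h1 := hfinal u v hu hv huv hneu hnev hdis
  have h2 := hfinal v u hv hu (by rwa [union_comm]) hnev hneu (by rwa [inter_comm v u])
  rw [not_subset] at h1 h2
  obtain ⟨x, hx, hx'⟩ := h1
  obtain ⟨y, hy, hy'⟩ := h2
  exact hno (hpre _ _ (hWo u) (hWo v) hcov ⟨y, hy, (hcov hy).resolve_right hy'⟩
    ⟨x, hx, (hcov hx).resolve_left hx'⟩)

lemma im_toComplex_mul_conj (u v : Plane) :
    (toComplex v * (starRingEnd ℂ) (toComplex u)).im = wedge u v := by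
  simp [toComplex, wedge]; ring

/-- A chord between two points of `F`, within a connected open set that misses `F`, separates that
set when the two points are related by a continuous choice of angle off `F`. -/
lemma exists_sides {F Ω : Set Plane} (hΩo : IsOpen Ω) (hΩ : IsPreconnected Ω) (hΩF : Ω ⊆ Fᶜ)
    {a b : Plane} (ha : a ∈ F) (hb : b ∈ F) (hab : a ≠ b) (hsub : openSegment ℝ a b ⊆ Ω)
    (hang : HasAngle F a b) : ∃ C D, Sides Ω a b C D 1 := by
  obtain ⟨h, hc, hh⟩ := hang
  have hcΩ : ContinuousOn h Ω := hc.mono hΩF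
  -- On the chord `y - b` is a negative multiple of `y - a`.
  have hexp : ∀ y ∈ openSegment ℝ a b, Complex.exp (h y * Complex.I) = -1 := by
    intro y hy
    obtain ⟨r, hr, e⟩ := hh y (hΩF (hsub hy))
    obtain ⟨t, ht0, ht1, rfl⟩ := mem_openSegment_iff.1 hy
    have e1 : toComplex (a + t • (b - a) - b) = ((t - 1 : ℝ) : ℂ) * toComplex (b - a) := by
      rw [← toComplex_smul]; congr 1; module
    have e2 : toComplex (a + t • (b - a) - a) = ((t : ℝ) : ℂ) * toComplex (b - a) := by
      rw [← toComplex_smul]; congr 1; module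
    have h0 : toComplex (b - a) ≠ 0 := toComplex_ne_zero (sub_ne_zero.2 hab.symm)
    rw [e1, e2, ← mul_assoc] at e
    have e3 := mul_right_cancel₀ h0 e
    have e4 : ‖((t - 1 : ℝ) : ℂ)‖ = r * t := by
      rw [e3, norm_mul, norm_mul, Complex.norm_exp_ofReal_mul_I, Complex.norm_real,
        Complex.norm_real, Real.norm_of_nonneg hr.le, Real.norm_of_nonneg ht0.le, mul_one]
    rw [Complex.norm_real, Real.norm_of_nonpos (by linarith)] at e4
    have e5 : ((t - 1 : ℝ) : ℂ) = -(r * t : ℝ) := by rw [← e4]; push_cast; ring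
    rw [e5] at e3
    have h1 : ((r * t : ℝ) : ℂ) ≠ 0 := by exact_mod_cast (mul_pos hr ht0).ne'
    apply mul_left_cancel₀ h1
    rw [mul_neg_one, e3]; push_cast; ring
  have hcs : ∀ y ∈ openSegment ℝ a b, Real.cos (h y) = -1 ∧ Real.sin (h y) = 0 := by
    intro y hy
    have := hexp y hy
    constructor
    · rw [← Complex.exp_ofReal_mul_I_re, this]; simp
    · rw [← Complex.exp_ofReal_mul_I_im, this]; simp
  obtain ⟨y₀, hy₀⟩ : (openSegment ℝ a b).Nonempty := ⟨_, add_smul_sub_mem_openSegment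
    (t := 1 / 2) (by norm_num) (by norm_num)⟩
  -- The values of `h` on the chord are odd multiples of `π`. If `h` increased, the intermediate
  -- value theorem would give a value larger by at most `π`, which is too small a step.
  have hle : ∀ x ∈ openSegment ℝ a b, ∀ y ∈ openSegment ℝ a b, h y ≤ h x := by
    intro x hx y hy
    by_contra hlt
    push Not at hlt
    have hpre : IsPreconnected (h '' openSegment ℝ a b) :=
      (convex_openSegment _ _).isPreconnected.image _ (hcΩ.mono hsub)
    have hI := hpre.Icc_subset (mem_image_of_mem h hx) (mem_image_of_mem h hy)
    obtain ⟨z, hz, hzt⟩ := hI (show min (h y) (h x + Real.pi) ∈ Icc (h x) (h y) from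
      ⟨le_min hlt.le (by linarith [Real.pi_pos]), min_le_left _ _⟩)
    have hgt : h x < h z := by rw [hzt]; exact lt_min hlt (by linarith [Real.pi_pos])
    have hle : h z ≤ h x + Real.pi := by rw [hzt]; exact min_le_right _ _
    have : Real.cos (h z - h x) = 1 := by
      rw [Real.cos_sub, (hcs x hx).1, (hcs z hz).1, (hcs x hx).2]; ring
    rw [Real.cos_eq_one_iff_of_lt_of_lt (by linarith [Real.pi_pos]) (by linarith [Real.pi_pos])]
      at this
    linarith
  set h0 := h y₀
  have hconst : ∀ y ∈ openSegment ℝ a b, h y = h0 := fun y hy =>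
    le_antisymm (hle _ hy₀ _ hy) (hle _ hy _ hy₀)
  have hO : IsOpen (Ω \ segment ℝ a b) := hΩo.sdiff (isClosed_segment a b)
  have hcO : ContinuousOn h (Ω \ segment ℝ a b) := hcΩ.mono sdiff_subset
  -- The angle `h0` means that `z - b` is a negative multiple of `z - a`, that is, that `z` lies on
  -- the segment.
  have hne : ∀ z ∈ Ω \ segment ℝ a b, h z ≠ h0 := by
    rintro z ⟨hz, hzs⟩ he
    obtain ⟨r, hr, e⟩ := hh z (hΩF hz)
    rw [he, hexp y₀ hy₀] at e
    apply hzs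
    apply mem_segment_of_sub_eq_smul (w := -r) (by linarith)
    apply toComplex_injective
    rw [e, toComplex_smul]; push_cast; ring
  have hC : IsOpen ((Ω \ segment ℝ a b) ∩ h ⁻¹' Iio h0) := hcO.isOpen_inter_preimage hO isOpen_Iio
  have hD : IsOpen ((Ω \ segment ℝ a b) ∩ h ⁻¹' Ioi h0) := hcO.isOpen_inter_preimage hO isOpen_Ioi
  have hdisj : Disjoint ((Ω \ segment ℝ a b) ∩ h ⁻¹' Iio h0)
      ((Ω \ segment ℝ a b) ∩ h ⁻¹' Ioi h0) := by
    rw [disjoint_left]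
    rintro z ⟨-, h1⟩ ⟨-, h2⟩
    exact lt_asymm (show h z < h0 from h1) (show h0 < h z from h2)
  have hun : ((Ω \ segment ℝ a b) ∩ h ⁻¹' Iio h0) ∪ ((Ω \ segment ℝ a b) ∩ h ⁻¹' Ioi h0) =
      Ω \ segment ℝ a b := by
    rw [← inter_union_distrib_left, inter_eq_left]
    exact fun z hz => lt_or_gt_of_ne (hne z hz)
  have hcol : ∀ y ∈ openSegment ℝ a b, ∃ ε > 0, ∀ q ∈ ball y ε,
      (0 < (1 : ℝ) * wedge (b - a) (q - a) → q ∈ (Ω \ segment ℝ a b) ∩ h ⁻¹' Iio h0) ∧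
      ((1 : ℝ) * wedge (b - a) (q - a) < 0 → q ∈ (Ω \ segment ℝ a b) ∩ h ⁻¹' Ioi h0) ∧
      (wedge (b - a) (q - a) = 0 → q ∈ openSegment ℝ a b) := by
    intro y hy
    have hca : ContinuousAt h y := hcΩ.continuousAt (hΩo.mem_nhds (hsub hy))
    have hnear : ∀ᶠ q in 𝓝 y, q ∈ Ω ∧ |h q - h0| < Real.pi := by
      filter_upwards [hΩo.mem_nhds (hsub hy), hca (Metric.ball_mem_nhds (h y) Real.pi_pos)]
        with q hqΩ hq
      refine ⟨hqΩ, ?_⟩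
      rwa [mem_preimage, mem_ball, hconst y hy, Real.dist_eq] at hq
    obtain ⟨ε, hε, hball⟩ := Metric.eventually_nhds_iff_ball.1 hnear
    refine ⟨ε, hε, fun q hq => ?_⟩
    obtain ⟨hqΩ, hqπ⟩ := hball q hq
    rw [abs_lt] at hqπ
    obtain ⟨r, hr, e⟩ := hh q (hΩF hqΩ)
    have hqa : toComplex (q - a) ≠ 0 :=
      toComplex_ne_zero (sub_ne_zero.2 (by rintro rfl; exact hΩF hqΩ ha))
    -- Near the chord `|h q - h0| < π`, so the sine tells which of `h q` and `h0` is larger, and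
    -- this formula ties that to the geometric side of the chord.
    have hw : wedge (b - a) (q - a) = -(r * Complex.normSq (toComplex (q - a))) *
        Real.sin (h q - h0) := by
      have h1 : wedge (b - a) (q - a) = wedge (q - a) (q - b) := by simp [wedge]; ring
      rw [h1, ← im_toComplex_mul_conj, e, mul_assoc, Complex.mul_conj, Real.sin_sub,
        (hcs y₀ hy₀).1, (hcs y₀ hy₀).2, mul_right_comm, ← Complex.ofReal_mul, Complex.im_ofReal_mul,
        Complex.exp_ofReal_mul_I_im]
      ring
    have hpos : 0 < r * Complex.normSq (toComplex (q - a)) :=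
      mul_pos hr (Complex.normSq_pos.2 hqa)
    have hseg : q ∈ segment ℝ a b → wedge (b - a) (q - a) = 0 := wedge_sub_eq_zero_of_mem_segment
    refine ⟨fun hp => ⟨⟨hqΩ, fun hs => ?_⟩, ?_⟩, fun hp => ⟨⟨hqΩ, fun hs => ?_⟩, ?_⟩, fun h00 => ?_⟩
    · rw [hseg hs] at hp; simp at hp
    · rw [one_mul, hw] at hp
      rw [mem_preimage, mem_Iio]
      by_contra hcon
      push Not at hcon
      have := Real.sin_nonneg_of_nonneg_of_le_pi (x := h q - h0) (by linarith) hqπ.2.le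
      nlinarith
    · rw [hseg hs] at hp; simp at hp
    · rw [one_mul, hw] at hp
      rw [mem_preimage, mem_Ioi]
      by_contra hcon
      push Not at hcon
      have := Real.sin_nonpos_of_nonpos_of_neg_pi_le (x := h q - h0) (by linarith) hqπ.1.le
      nlinarith
    · rw [hw, mul_eq_zero, Real.sin_eq_zero_iff_of_lt_of_lt hqπ.1 hqπ.2] at h00
      have he : h q = h0 := by
        rcases h00 with h00 | h00
        · linarith
        · linarith
      have hs : q ∈ segment ℝ a b := by
        by_contra hs
        exact hne q ⟨hqΩ, hs⟩ he
      exact mem_openSegment_of_ne_left_right (by rintro rfl; exact hΩF hqΩ ha)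
        (by rintro rfl; exact hΩF hqΩ hb) hs
  have haΩ : a ∉ Ω := fun h => hΩF h ha
  have hbΩ : b ∉ Ω := fun h => hΩF h hb
  exact ⟨_, _, hab, one_ne_zero, hC, hD,
    isPreconnected_of_collar hΩ hab one_ne_zero haΩ hbΩ hC hD hdisj hun hcol,
    isPreconnected_of_collar hΩ hab (neg_ne_zero.2 one_ne_zero) haΩ hbΩ hD hC hdisj.symm
      (by rw [union_comm, hun]) fun y hy => by
        obtain ⟨ε, hε, hc⟩ := hcol y hy
        refine ⟨ε, hε, fun q hq => ?_⟩
        obtain ⟨h1, h2, h3⟩ := hc q hq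
        exact ⟨fun h => h2 (by linarith), fun h => h1 (by linarith), h3⟩,
    hdisj, hun, hcol⟩

/-! ### The two sides of a chord and their closures -/

namespace Sides

variable {Ω : Set Plane} {a b : Plane} {C D : Set Plane} {s : ℝ}

lemma subset_left (h : Sides Ω a b C D s) : C ⊆ Ω \ segment ℝ a b :=
  h.union_eq ▸ subset_union_left

lemma subset_right (h : Sides Ω a b C D s) : D ⊆ Ω \ segment ℝ a b :=
  h.union_eq ▸ subset_union_right

lemma segment_subset_closure_left (h : Sides Ω a b C D s) : segment ℝ a b ⊆ closure C := by
  refine segment_subset_closure_openSegment.trans (closure_minimal ?_ isClosed_closure)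
  intro y hy
  rw [Metric.mem_closure_iff]
  intro δ hδ
  obtain ⟨ε, hε, hc⟩ := h.collar y hy
  obtain ⟨q, hq, hq'⟩ := exists_mem_ball_wedge_sub_pos h.ne h.sign_ne hy (lt_min hε hδ)
  exact ⟨q, (hc q (ball_subset_ball (min_le_left _ _) hq)).1 hq', by
    rw [dist_comm]; exact ball_subset_ball (min_le_right _ _) hq⟩

lemma segment_subset_closure_right (h : Sides Ω a b C D s) : segment ℝ a b ⊆ closure D :=
  h.symm.segment_subset_closure_left

lemma disjoint_closure_right (h : Sides Ω a b C D s) : Disjoint C (closure D) :=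
  h.disjoint.closure_right h.isOpen_left

lemma disjoint_closure_left (h : Sides Ω a b C D s) : Disjoint (closure C) D :=
  h.disjoint.closure_left h.isOpen_right

variable {n : ℕ} {E : PolygonalEnvironment n}

lemma closure_left_subset (h : Sides (interior E.carrier) a b C D s) : closure C ⊆ E.carrier :=
  closure_minimal (h.subset_left.trans (sdiff_subset.trans interior_subset)) E.isClosed

lemma subset_closure_union (h : Sides (interior E.carrier) a b C D s) :
    E.carrier ⊆ closure C ∪ closure D := by
  rw [← E.closure_interior]
  refine closure_minimal (fun x hx => ?_) (isClosed_closure.union isClosed_closure)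
  by_cases hs : x ∈ segment ℝ a b
  · exact Or.inl (h.segment_subset_closure_left hs)
  · have : x ∈ C ∪ D := by rw [h.union_eq]; exact ⟨hx, hs⟩
    exact this.imp (fun h => subset_closure h) fun h => subset_closure h

/-- An interior point off the chord lies in one of two disjoint open sets. Near a boundary point off
the chord the interior is connected and misses the chord, so it lies on one side only. -/
lemma closure_inter_closure_subset (h : Sides (interior E.carrier) a b C D s) :
    closure C ∩ closure D ⊆ segment ℝ a b := by
  rintro z ⟨hzC, hzD⟩
  by_contra hs
  rcases E.mem_interior_or_mem_frontier (h.closure_left_subset hzC) with hi | hF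
  · have : z ∈ C ∪ D := by rw [h.union_eq]; exact ⟨hi, hs⟩
    rcases this with h1 | h1
    · exact disjoint_left.1 h.disjoint_closure_right h1 hzD
    · exact disjoint_left.1 h.disjoint_closure_left hzC h1
  · obtain ⟨ε, hε, hb⟩ := E.exists_isPreconnected_ball hF
    obtain ⟨δ, hδ, hδs⟩ := Metric.isOpen_iff.1 (isClosed_segment a b).isOpen_compl z hs
    have hm : 0 < min ε δ := lt_min hε hδ
    obtain ⟨x, hx, hxC⟩ := mem_closure_iff_nhds.1 hzC _ (ball_mem_nhds z hm)
    obtain ⟨y, hy, hyD⟩ := mem_closure_iff_nhds.1 hzD _ (ball_mem_nhds z hm)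
    obtain ⟨w, -, hw1, hw2⟩ := hb _ hm (min_le_left _ _) C D h.isOpen_left h.isOpen_right
      (fun q hq => by
        rw [h.union_eq]
        exact ⟨hq.2, hδs (ball_subset_ball (min_le_right _ _) hq.1)⟩)
      ⟨x, ⟨hx, (h.subset_left hxC).1⟩, hxC⟩ ⟨y, ⟨hy, (h.subset_right hyD).1⟩, hyD⟩
    exact disjoint_left.1 h.disjoint hw1 hw2

/-- A connected subset of the environment can change sides only by meeting the chord. Later
arguments about regions and lines of sight mostly rest on this. -/
lemma subset_closure_right_of_mem (h : Sides (interior E.carrier) a b C D s) {S : Set Plane}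
    (hS : IsPreconnected S) (hSE : S ⊆ E.carrier) (hSs : Disjoint S (segment ℝ a b)) {x : Plane}
    (hx : x ∈ S) (hxD : x ∈ closure D) : S ⊆ closure D := by
  intro y hy
  by_contra hyD
  have hyC : y ∈ closure C := (h.subset_closure_union (hSE hy)).resolve_right hyD
  obtain ⟨w, hw, hw'⟩ := isPreconnected_closed_iff.1 hS (closure C) (closure D) isClosed_closure
    isClosed_closure (hSE.trans h.subset_closure_union) ⟨y, hy, hyC⟩ ⟨x, hx, hxD⟩
  exact disjoint_left.1 hSs hw (h.closure_inter_closure_subset hw')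

/-- The chord adds no interior points to the closure of `C`, since `D` accumulates at every point of
it. Hence a closed region and its open interior determine each other. -/
lemma interior_closure_left (h : Sides (interior E.carrier) a b C D s) :
    interior (closure C) = C := by
  refine subset_antisymm (fun x hx => ?_) (interior_maximal subset_closure h.isOpen_left)
  have hxE : x ∈ interior E.carrier := interior_mono h.closure_left_subset hx
  by_cases hs : x ∈ segment ℝ a b
  · exfalso
    obtain ⟨y, hy, hyD⟩ := mem_closure_iff_nhds.1 (h.segment_subset_closure_right hs) _
      (isOpen_interior.mem_nhds hx)
    exact disjoint_left.1 h.disjoint_closure_left (interior_subset hy) hyD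
  · have : x ∈ C ∪ D := by rw [h.union_eq]; exact ⟨hxE, hs⟩
    exact this.resolve_right fun hD =>
      disjoint_left.1 h.disjoint_closure_left (interior_subset hx) hD

lemma frontier_closure_left_subset (h : Sides (interior E.carrier) a b C D s) :
    frontier (closure C) ⊆ frontier E.carrier ∪ segment ℝ a b := by
  rintro x ⟨hx, hx'⟩
  rw [closure_closure] at hx
  rw [h.interior_closure_left] at hx'
  rcases E.mem_interior_or_mem_frontier (h.closure_left_subset hx) with hi | hF
  · right
    by_contra hs
    have : x ∈ C ∪ D := by rw [h.union_eq]; exact ⟨hi, hs⟩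
    exact disjoint_left.1 h.disjoint_closure_left hx (this.resolve_left hx')
  · exact Or.inl hF

end Sides

/-! ### Regions in charge of agents, and the radial chords that bound them -/

namespace PolygonalEnvironment

variable {n : ℕ} (E : PolygonalEnvironment n)

lemma interior_subset_compl_frontier : interior E.carrier ⊆ (frontier E.carrier)ᶜ :=
  fun _ hx hF => hF.2 hx

/-- The closure of `Ω` is a region in charge of an agent at `p`. Apart from the boundary of the
environment it is bounded by the segment `[k, p]`, and only the end `p` of that segment lies on a
line of sight from `p` into `Ω`. -/
structure Region (Ω : Set Plane) (k p : Plane) : Prop where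
  isOpen : IsOpen Ω
  isPreconnected : IsPreconnected Ω
  subset_interior : Ω ⊆ interior E.carrier
  interior_closure : interior (closure Ω) = Ω
  frontier_subset : frontier (closure Ω) ⊆ frontier E.carrier ∪ segment ℝ k p
  segment_subset : segment ℝ k p ⊆ closure Ω
  ray : ∀ w ∈ Ω, segment ℝ p w ⊆ E.carrier → ∀ x ∈ segment ℝ k p, x ∈ segment ℝ p w → x = p

variable {E} {Ω : Set Plane} {k p a b : Plane}

lemma Region.mem_closure (h : E.Region Ω k p) : p ∈ closure Ω :=
  h.segment_subset (right_mem_segment _ _ _)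

lemma Region.closure_subset (h : E.Region Ω k p) : closure Ω ⊆ E.carrier :=
  closure_minimal (h.subset_interior.trans interior_subset) E.isClosed

lemma Region.mem (h : E.Region Ω k p) : p ∈ E.carrier := h.closure_subset h.mem_closure

variable (E) in
/-- `[a, b]` is a chord of the environment on a ray from `p`, within the line of sight of `p` and
bordering points in the interior of the visibility set. -/
structure RadialChord (p a b : Plane) : Prop where
  ne : a ≠ b
  mem_left : a ∈ frontier E.carrier
  mem_right : b ∈ frontier E.carrier
  subset_interior : openSegment ℝ a b ⊆ interior E.carrier
  radial : a ∈ openSegment ℝ p b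
  visible : segment ℝ p b ⊆ E.carrier
  borders : segment ℝ a b ⊆ closure (interior (visibilitySet E.carrier p))

/-- A coordinate on the line of a gap: `b` is at `0`, `a` at `1`, and the agent at some `m > 1`. -/
lemma line_mem_segment_iff (hab : a ≠ b) {t : ℝ} :
    b + t • (a - b) ∈ segment ℝ a b ↔ 0 ≤ t ∧ t ≤ 1 := by
  rw [segment_symm, mem_segment_iff]
  constructor
  · rintro ⟨u, h0, h1, h⟩
    have := smul_left_injective ℝ (sub_ne_zero.2 hab) (add_left_cancel h)
    rw [show t = u from this]; exact ⟨h0, h1⟩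
  · rintro ⟨h0, h1⟩
    exact ⟨t, h0, h1, rfl⟩

lemma RadialChord.exists_eq (h : E.RadialChord p a b) : ∃ m : ℝ, 1 < m ∧ p = b + m • (a - b) := by
  obtain ⟨τ, h0, h1, rfl⟩ := mem_openSegment_iff.1 h.radial
  have h2 : 0 < 1 - τ := by linarith
  refine ⟨1 / (1 - τ), by rw [lt_div_iff₀ h2]; linarith, ?_⟩
  have : p + τ • (b - p) - b = (1 - τ) • (p - b) := by module
  rw [this, smul_smul, one_div_mul_cancel h2.ne', one_smul]; abel

lemma RadialChord.notMem (h : E.RadialChord p a b) : p ∉ segment ℝ a b := by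
  obtain ⟨m, hm, hp⟩ := h.exists_eq
  intro hs
  rw [hp, line_mem_segment_iff h.ne] at hs
  linarith [hs.2]

lemma RadialChord.exists_isReflexCorner (h : E.RadialChord p a b) :
    ∃ i, E.IsReflexCorner i ∧ a = E.vertex (i + 1) :=
  E.exists_isReflexCorner_of_grazing h.mem_left h.radial h.visible h.subset_interior

lemma RadialChord.exists_sides (h : E.RadialChord p a b) :
    ∃ C D s, Sides (interior E.carrier) a b C D s ∧ p ∈ closure D := by
  obtain ⟨C, D, hs⟩ := _root_.exists_sides isOpen_interior E.isPreconnected_interior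
    E.interior_subset_compl_frontier h.mem_left h.mem_right h.ne h.subset_interior
    (E.hasAngle h.mem_left h.mem_right)
  have hp : p ∈ E.carrier := h.visible (left_mem_segment _ _ _)
  rcases hs.subset_closure_union hp with h1 | h1
  · exact ⟨D, C, _, hs.symm, h1⟩
  · exact ⟨C, D, _, hs, h1⟩

/-- The segment `[k, p]` is connected, avoids the chord and contains `p`, so it lies on the side
`D`. The frontier of the region therefore misses `C`; as `C` is connected and accumulates at the
chord, which runs inside `Ω`, it lies in `Ω`. -/
lemma Region.left_subset (hR : E.Region Ω k p) (hsub : openSegment ℝ a b ⊆ Ω)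
    (hdis : Disjoint (segment ℝ k p) (segment ℝ a b)) {C D : Set Plane} {s : ℝ}
    (hs : Sides (interior E.carrier) a b C D s) (hp : p ∈ closure D) : C ⊆ Ω := by
  have hk : segment ℝ k p ⊆ closure D := hs.subset_closure_right_of_mem
    (isPreconnected_segment _ _) (hR.segment_subset.trans hR.closure_subset) hdis
    (right_mem_segment _ _ _) hp
  rcases hs.isPreconnected_left.subset_interior_or_subset_compl (E := closure Ω) (by
    rw [disjoint_left]
    intro x hx hxF
    rcases hR.frontier_subset hxF with h | h
    · exact h.2 (hs.subset_left hx).1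
    · exact disjoint_left.1 hs.disjoint_closure_right hx (hk h)) with h | h
  · rwa [hR.interior_closure] at h
  · exfalso
    have hy : a + (1 / 2 : ℝ) • (b - a) ∈ openSegment ℝ a b :=
      add_smul_sub_mem_openSegment (by norm_num) (by norm_num)
    obtain ⟨z, hz, hzC⟩ := mem_closure_iff_nhds.1
      (hs.segment_subset_closure_left (openSegment_subset_segment _ _ _ hy)) _
      (hR.isOpen.mem_nhds (hsub hy))
    exact h hzC (subset_closure (subset_closure hz))

/-- The same chord separates `Ω` itself. The strips along the chord match the sides of `Ω` with
those of the environment, which identifies `Ω ∩ D` with a side of `Ω`, and sides are connected. -/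
lemma Region.isPreconnected_inter_right (hR : E.Region Ω k p) (ha : a ∈ frontier E.carrier)
    (hb : b ∈ frontier E.carrier) (hsub : openSegment ℝ a b ⊆ Ω) {C D : Set Plane} {s : ℝ}
    (hs : Sides (interior E.carrier) a b C D s) : IsPreconnected (Ω ∩ D) := by
  obtain ⟨C₁, D₁, h₁⟩ := _root_.exists_sides hR.isOpen hR.isPreconnected
    (hR.subset_interior.trans E.interior_subset_compl_frontier) ha hb hs.ne hsub (E.hasAngle ha hb)
  have hy : a + (1 / 2 : ℝ) • (b - a) ∈ openSegment ℝ a b :=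
    add_smul_sub_mem_openSegment (by norm_num) (by norm_num)
  have key : ∀ (C₁ D₁ : Set Plane) (t : ℝ), Sides Ω a b C₁ D₁ t → 0 < t * s → Ω ∩ D = D₁ := by
    intro C₁ D₁ t h₁ ht
    have hcov : C₁ ⊆ C ∪ D ∧ D₁ ⊆ C ∪ D := by
      rw [hs.union_eq]
      exact ⟨fun x hx => ⟨hR.subset_interior (h₁.subset_left hx).1, (h₁.subset_left hx).2⟩,
        fun x hx => ⟨hR.subset_interior (h₁.subset_right hx).1, (h₁.subset_right hx).2⟩⟩
    obtain ⟨ε, hε, hc⟩ := hs.collar _ hy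
    obtain ⟨δ, hδ, hc'⟩ := h₁.collar _ hy
    have hside : ∀ w : ℝ, 0 < s * w ↔ 0 < t * w := by
      intro w
      rcases pos_and_pos_or_neg_and_neg_of_mul_pos ht with ⟨h1, h2⟩ | ⟨h1, h2⟩
      · rw [mul_pos_iff_of_pos_left h1, mul_pos_iff_of_pos_left h2]
      · rw [← neg_mul_neg s w, ← neg_mul_neg t w, mul_pos_iff_of_pos_left (neg_pos.2 h1),
          mul_pos_iff_of_pos_left (neg_pos.2 h2)]
    have hC : C₁ ⊆ C := by
      obtain ⟨q, hq, hpos⟩ := exists_mem_ball_wedge_sub_pos hs.ne hs.sign_ne hy (lt_min hε hδ)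
      have hqC := (hc q (ball_subset_ball (min_le_left _ _) hq)).1 hpos
      have hqC' := (hc' q (ball_subset_ball (min_le_right _ _) hq)).1 ((hside _).1 hpos)
      rcases h₁.isPreconnected_left.subset_or_subset hs.isOpen_left hs.isOpen_right hs.disjoint
        hcov.1 with h | h
      · exact h
      · exact absurd (h hqC') (disjoint_left.1 hs.disjoint hqC)
    have hD : D₁ ⊆ D := by
      obtain ⟨q, hq, hpos⟩ := exists_mem_ball_wedge_sub_pos hs.ne (neg_ne_zero.2 hs.sign_ne) hy
        (lt_min hε hδ)
      have hpos' : 0 < s * -wedge (b - a) (q - a) := by linarith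
      have hpos'' := (hside _).1 hpos'
      have hqC := (hc q (ball_subset_ball (min_le_left _ _) hq)).2.1 (by linarith)
      have hqC' := (hc' q (ball_subset_ball (min_le_right _ _) hq)).2.1 (by linarith)
      rcases h₁.isPreconnected_right.subset_or_subset hs.isOpen_left hs.isOpen_right hs.disjoint
        hcov.2 with h | h
      · exact absurd hqC (disjoint_left.1 hs.disjoint (h hqC'))
      · exact h
    refine subset_antisymm ?_ fun x hx => ⟨(h₁.subset_right hx).1, hD hx⟩
    rintro x ⟨hx, hxD⟩
    have : x ∈ C₁ ∪ D₁ := by rw [h₁.union_eq]; exact ⟨hx, (hs.subset_right hxD).2⟩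
    exact this.resolve_left fun h => disjoint_left.1 hs.disjoint (hC h) hxD
  rcases lt_or_gt_of_ne hs.sign_ne with h | h
  · rw [key D₁ C₁ (-1) h₁.symm (by linarith)]
    exact h₁.isPreconnected_left
  · rw [key C₁ D₁ 1 h₁ (by linarith)]
    exact h₁.isPreconnected_right

/-- The component of `p` off the chord is the part of the region in `closure D`. It is no larger
because it cannot cross the chord, and no smaller because `Ω ∩ D` is connected and dense in that
part. What remains is `closure C` without the chord. -/
lemma Region.regionAcross_eq (hR : E.Region Ω k p) (hch : E.RadialChord p a b)
    (hsub : openSegment ℝ a b ⊆ Ω)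
    (hdis : Disjoint (segment ℝ k p) (segment ℝ a b)) {C D : Set Plane} {s : ℝ}
    (hs : Sides (interior E.carrier) a b C D s) (hp : p ∈ closure D) :
    regionAcross (closure Ω) p a b = closure C := by
  have hCΩ := hR.left_subset hsub hdis hs hp
  have hpR : p ∈ closure Ω \ segment ℝ a b := ⟨hR.mem_closure, hch.notMem⟩
  have hle : connectedComponentIn (closure Ω \ segment ℝ a b) p ⊆ closure D :=
    hs.subset_closure_right_of_mem isPreconnected_connectedComponentIn
      ((connectedComponentIn_subset _ _).trans (sdiff_subset.trans hR.closure_subset))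
      (disjoint_sdiff_left.mono_left (connectedComponentIn_subset _ _))
      (mem_connectedComponentIn hpR) hp
  have hge : (closure Ω ∩ closure D) \ segment ℝ a b ⊆
      connectedComponentIn (closure Ω \ segment ℝ a b) p := by
    refine IsPreconnected.subset_connectedComponentIn ?_ ⟨⟨hR.mem_closure, hp⟩, hch.notMem⟩
      (fun x hx => ⟨hx.1.1, hx.2⟩)
    refine (hR.isPreconnected_inter_right hch.mem_left hch.mem_right hsub hs).subset_closure
      (fun x hx => ⟨⟨subset_closure hx.1, subset_closure hx.2⟩, (hs.subset_right hx.2).2⟩) ?_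
    rintro z ⟨⟨hzΩ, hzD⟩, hzs⟩
    have hzC : z ∉ closure C := fun h => hzs (hs.closure_inter_closure_subset ⟨h, hzD⟩)
    rw [mem_closure_iff_nhds]
    intro N hN
    have hN' : N ∩ (closure C ∪ segment ℝ a b)ᶜ ∈ 𝓝 z := inter_mem hN
      ((isClosed_closure.union (isClosed_segment a b)).isOpen_compl.mem_nhds (by
        rintro (h | h)
        · exact hzC h
        · exact hzs h))
    obtain ⟨y, ⟨hyN, hy⟩, hyΩ⟩ := mem_closure_iff_nhds.1 hzΩ _ hN'
    rw [mem_compl_iff, mem_union, not_or] at hy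
    have : y ∈ C ∪ D := by rw [hs.union_eq]; exact ⟨hR.subset_interior hyΩ, hy.2⟩
    exact ⟨y, hyN, hyΩ, this.resolve_left fun h => hy.1 (subset_closure h)⟩
  have heq : (closure Ω \ segment ℝ a b) \ connectedComponentIn (closure Ω \ segment ℝ a b) p =
      closure C \ segment ℝ a b := by
    ext z
    constructor
    · rintro ⟨⟨hzΩ, hzs⟩, hz⟩
      refine ⟨(hs.subset_closure_union (hR.closure_subset hzΩ)).resolve_right fun h => ?_, hzs⟩
      exact hz (hge ⟨⟨hzΩ, h⟩, hzs⟩)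
    · rintro ⟨hzC, hzs⟩
      exact ⟨⟨closure_mono hCΩ hzC, hzs⟩, fun h =>
        hzs (hs.closure_inter_closure_subset ⟨hzC, hle h⟩)⟩
  rw [regionAcross, heq]
  exact subset_antisymm (closure_minimal sdiff_subset isClosed_closure)
    (closure_mono fun x hx => ⟨subset_closure hx, (hs.subset_left hx).2⟩)

/-- Only `ray` needs an argument. If `b` saw a point `w` of `C` through another point of the chord,
`w` would lie on the same line beyond `a`, on the side of `p`. Then `[p, w]` would be covered by two
lines of sight from `b` and would avoid the chord, and so would link `p` to the wrong side. -/
lemma RadialChord.region (hch : E.RadialChord p a b) {C D : Set Plane} {s : ℝ}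
    (hs : Sides (interior E.carrier) a b C D s) (hp : p ∈ closure D) : E.Region C a b where
  isOpen := hs.isOpen_left
  isPreconnected := hs.isPreconnected_left
  subset_interior := hs.subset_left.trans sdiff_subset
  interior_closure := hs.interior_closure_left
  frontier_subset := hs.frontier_closure_left_subset
  segment_subset := hs.segment_subset_closure_left
  ray := by
    intro w hw hbw x hx hxw
    by_contra hxb
    obtain ⟨m, hm, hpm⟩ := hch.exists_eq
    rw [segment_symm] at hx
    obtain ⟨t, ht0, -, rfl⟩ := mem_segment_iff.1 hx
    obtain ⟨u, hu0, -, hxu⟩ := mem_segment_iff.1 hxw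
    have ht : 0 < t := lt_of_le_of_ne ht0 (by rintro rfl; simp at hxb)
    have hu : 0 < u := lt_of_le_of_ne hu0 (by
      rintro rfl
      rw [zero_smul, add_zero] at hxu
      exact hxb hxu)
    have hwν : w = b + (t / u) • (a - b) := by
      have := add_left_cancel hxu
      rw [div_eq_inv_mul, ← smul_smul, this, smul_smul, inv_mul_cancel₀ hu.ne', one_smul]; abel
    set ν := t / u
    have hν0 : 0 < ν := div_pos ht hu
    have hν : 1 < ν := by
      by_contra hc
      push Not at hc
      exact (hs.subset_left hw).2 (hwν ▸ (line_mem_segment_iff hs.ne).2 ⟨hν0.le, hc⟩)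
    have hpts : ∀ y ∈ segment ℝ p w, ∃ l : ℝ, 1 < l ∧ (l ≤ m ∨ l ≤ ν) ∧ y = b + l • (a - b) := by
      intro y hy
      obtain ⟨θ, h0, h1, rfl⟩ := mem_segment_iff.1 hy
      refine ⟨m + θ * (ν - m), ?_, ?_, ?_⟩
      · rcases le_total m ν with h | h <;> nlinarith
      · rcases le_total m ν with h | h
        · right; nlinarith
        · left; nlinarith
      · rw [hpm, hwν]; module
    have hsubE : segment ℝ p w ⊆ E.carrier := by
      intro y hy
      obtain ⟨l, hl, hlm, rfl⟩ := hpts y hy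
      rcases hlm with h | h
      · apply hch.visible
        rw [segment_symm]
        refine mem_segment_iff.2 ⟨l / m, by positivity, by rw [div_le_one (by linarith)]; exact h, ?_⟩
        rw [hpm, add_sub_cancel_left, smul_smul, div_mul_cancel₀ _ (by linarith)]
      · apply hbw
        refine mem_segment_iff.2 ⟨l / ν, by positivity, by rw [div_le_one (by linarith)]; exact h, ?_⟩
        rw [hwν, add_sub_cancel_left, smul_smul, div_mul_cancel₀ _ (by linarith)]
    have hwD := hs.subset_closure_right_of_mem (isPreconnected_segment p w) hsubE (by
      rw [disjoint_left]
      intro y hy hys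
      obtain ⟨l, hl, -, rfl⟩ := hpts y hy
      linarith [((line_mem_segment_iff hs.ne).1 hys).2]) (left_mem_segment _ _ _) hp
      (right_mem_segment _ _ _)
    exact disjoint_left.1 hs.disjoint_closure_right hw hwD

/-- Two chords on rays from `p` with a common inner point are equal. -/
lemma RadialChord.eq_of_mem {a' b' y : Plane} (h : E.RadialChord p a b)
    (h' : E.RadialChord p a' b') (hy : y ∈ openSegment ℝ a b) (hy' : y ∈ openSegment ℝ a' b') :
    a = a' ∧ b = b' := by
  have key : ∀ {a b : Plane}, E.RadialChord p a b → y ∈ openSegment ℝ a b →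
      ∃ α β : ℝ, α < 1 ∧ 1 < β ∧ a = p + α • (y - p) ∧ b = p + β • (y - p) := by
    intro a b h hy
    obtain ⟨τ, h0, h1, ha⟩ := mem_openSegment_iff.1 h.radial
    obtain ⟨t, ht0, ht1, hyt⟩ := mem_openSegment_iff.1 hy
    set c := τ + t * (1 - τ) with hc
    have hc0 : 0 < c := by nlinarith
    have hc1 : c < 1 := by nlinarith
    have hyc : y - p = c • (b - p) := by
      rw [hyt, ha, hc]; module
    refine ⟨τ / c, 1 / c, ?_, ?_, ?_, ?_⟩
    · rw [div_lt_one hc0]; nlinarith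
    · rw [lt_div_iff₀ hc0]; linarith
    · rw [hyc, smul_smul, div_mul_cancel₀ _ hc0.ne', ← ha]
    · rw [hyc, smul_smul, div_mul_cancel₀ _ hc0.ne', one_smul]; abel
  obtain ⟨α, β, hα, hβ, ha, hb⟩ := key h hy
  obtain ⟨α', β', hα', hβ', ha', hb'⟩ := key h' hy'
  have hin : ∀ {α β γ : ℝ}, α < γ → γ < β →
      p + γ • (y - p) ∈ openSegment ℝ (p + α • (y - p)) (p + β • (y - p)) := by
    intro α β γ h1 h2
    have h3 : 0 < β - α := by linarith
    refine mem_openSegment_iff.2 ⟨(γ - α) / (β - α), div_pos (by linarith) h3, ?_, ?_⟩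
    · rw [div_lt_one h3]; linarith
    · have : p + β • (y - p) - (p + α • (y - p)) = (β - α) • (y - p) := by module
      rw [this, smul_smul, div_mul_cancel₀ _ h3.ne']; module
  have hsub := h.subset_interior
  have hsub' := h'.subset_interior
  have m1 := h.mem_left
  have m2 := h.mem_right
  have m1' := h'.mem_left
  have m2' := h'.mem_right
  rw [ha, hb] at hsub
  rw [ha', hb'] at hsub'
  rw [ha] at m1
  rw [hb] at m2
  rw [ha'] at m1'
  rw [hb'] at m2'
  have e1 : α = α' := by
    rcases lt_trichotomy α α' with hlt | heq | hlt
    · exact absurd (hsub (hin hlt (by linarith))) m1'.2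
    · exact heq
    · exact absurd (hsub' (hin hlt (by linarith))) m1.2
  have e2 : β = β' := by
    rcases lt_trichotomy β β' with hlt | heq | hlt
    · exact absurd (hsub' (hin (by linarith) hlt)) m2.2
    · exact heq
    · exact absurd (hsub (hin (by linarith) hlt)) m2'.2
  exact ⟨by rw [ha, ha', e1], by rw [hb, hb', e2]⟩

/-- Both chords leave `a` in the direction away from `p`, so they overlap near `a`. -/
lemma RadialChord.eq_of_left_eq {b' : Plane} (h : E.RadialChord p a b)
    (h' : E.RadialChord p a b') : b = b' := by
  have key : ∀ {b : Plane}, E.RadialChord p a b → ∃ β : ℝ, 0 < β ∧ b = a + β • (a - p) := by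
    intro b h
    obtain ⟨τ, h0, h1, ha⟩ := mem_openSegment_iff.1 h.radial
    refine ⟨(1 - τ) / τ, div_pos (by linarith) h0, ?_⟩
    have : a - p = τ • (b - p) := by rw [ha]; abel
    rw [this, smul_smul, div_mul_cancel₀ _ h0.ne']
    nth_rw 1 [ha]
    module
  obtain ⟨β, hβ, hb⟩ := key h
  obtain ⟨β', hβ', hb'⟩ := key h'
  have hm : 0 < min β β' := lt_min hβ hβ'
  have hin : ∀ {γ β : ℝ}, 0 < γ → γ < β → a + γ • (a - p) ∈ openSegment ℝ a (a + β • (a - p)) := by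
    intro γ β h1 h2
    refine mem_openSegment_iff.2 ⟨γ / β, div_pos h1 (by linarith), ?_, ?_⟩
    · rw [div_lt_one (by linarith)]; exact h2
    · rw [add_sub_cancel_left, smul_smul, div_mul_cancel₀ _ (by linarith)]
  exact (h.eq_of_mem (y := a + (min β β' / 2) • (a - p)) h'
    (hb ▸ hin (by linarith) (by linarith [min_le_left β β']))
    (hb' ▸ hin (by linarith) (by linarith [min_le_right β β']))).2

/-- A point in the closure of the interior of the visibility set of `p` is not cut off from `p` by
a chord that does not contain it. -/
lemma RadialChord.mem_closure_right (h : E.RadialChord p a b) {C D : Set Plane} {s : ℝ}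
    (hs : Sides (interior E.carrier) a b C D s) (hp : p ∈ closure D) {y : Plane}
    (hy : y ∈ closure (interior (visibilitySet E.carrier p))) : y ∈ closure D := by
  have hbp : b - p ≠ 0 := by
    rw [sub_ne_zero]; rintro rfl; exact h.notMem (right_mem_segment _ _ _)
  rw [Metric.mem_closure_iff] at hy ⊢
  -- Interior points of the visibility set can be moved slightly off the line of the chord. The line
  -- of sight to such a point meets that line only at `p`, which is not on the chord.
  suffices hoff : ∀ q ∈ visibilitySet E.carrier p, wedge (b - p) (q - p) ≠ 0 → q ∈ closure D by
    intro ε hε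
    obtain ⟨q₀, hq₀, hd⟩ := hy (ε / 2) (by positivity)
    obtain ⟨δ, hδ, hδs⟩ := Metric.isOpen_iff.1 isOpen_interior q₀ hq₀
    have hex : ∃ q ∈ ball q₀ (min δ (ε / 4)), wedge (b - p) (q - p) ≠ 0 := by
      by_cases h0 : wedge (b - p) (q₀ - p) = 0
      · obtain ⟨q, hq, hq'⟩ := exists_mem_ball_wedge_pos hbp q₀ (lt_min hδ (by positivity : 0 < ε / 4))
        refine ⟨q, hq, ?_⟩
        have : q - p = (q - q₀) + (q₀ - p) := by abel
        rw [this, wedge_add_right, h0, add_zero]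
        exact hq'.ne'
      · exact ⟨q₀, mem_ball_self (lt_min hδ (by positivity)), h0⟩
    obtain ⟨q, hq, hq'⟩ := hex
    have hqD := hoff q (interior_subset (hδs (ball_subset_ball (min_le_left _ _) hq))) hq'
    rw [Metric.mem_closure_iff] at hqD
    obtain ⟨z, hz, hz'⟩ := hqD (ε / 4) (by positivity)
    refine ⟨z, hz, ?_⟩
    have h1 : dist q q₀ < ε / 4 := ball_subset_ball (min_le_right _ _) hq
    have h2 := dist_triangle4 y q₀ q z
    rw [dist_comm q₀ q] at h2
    linarith
  rintro q ⟨hqE, hq⟩ hne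
  refine hs.subset_closure_right_of_mem (isPreconnected_segment p q) hq ?_ (left_mem_segment _ _ _)
    hp (right_mem_segment _ _ _)
  rw [disjoint_left]
  intro x hx hxs
  obtain ⟨t, -, -, rfl⟩ := mem_segment_iff.1 hx
  have h1 : p + t • (q - p) ∈ segment ℝ p b := (convex_segment p b).segment_subset
    (openSegment_subset_segment _ _ _ h.radial) (right_mem_segment _ _ _) hxs
  have h2 := wedge_sub_eq_zero_of_mem_segment h1
  rw [add_sub_cancel_left, wedge_smul_right] at h2
  rcases mul_eq_zero.1 h2 with h3 | h3
  · rw [h3, zero_smul, add_zero] at hxs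
    exact h.notMem hxs
  · exact hne h3

/-- The regions across different chords on rays from `p` lie apart. -/
lemma RadialChord.closure_subset_closure {a' b' : Plane} (h : E.RadialChord p a b)
    (h' : E.RadialChord p a' b') (hne : ¬ (a = a' ∧ b = b')) {C D C' D' : Set Plane} {s s' : ℝ}
    (hs : Sides (interior E.carrier) a b C D s) (hp : p ∈ closure D)
    (hs' : Sides (interior E.carrier) a' b' C' D' s') (hp' : p ∈ closure D') :
    closure C ⊆ closure D' := by
  -- The chord `[a', b']` borders seen points and hence misses `C`, so `C` lies on one side of it.
  -- If that were `C'`, the chord `[a, b]`, itself bordered by seen points, would lie in both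
  -- closures and so on `[a', b']`, and the two chords would coincide.
  have hC : C ⊆ C' ∪ D' := by
    rw [hs'.union_eq]
    refine fun x hx => ⟨(hs.subset_left hx).1, fun hxs => ?_⟩
    exact disjoint_left.1 hs.disjoint_closure_right hx (h.mem_closure_right hs hp (h'.borders hxs))
  apply closure_mono
  rcases hs.isPreconnected_left.subset_or_subset hs'.isOpen_left hs'.isOpen_right hs'.disjoint hC
    with hsub | hsub
  · exfalso
    have hy : a + (1 / 2 : ℝ) • (b - a) ∈ openSegment ℝ a b :=
      add_smul_sub_mem_openSegment (by norm_num) (by norm_num)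
    have hys := openSegment_subset_segment ℝ _ _ hy
    have hy' := hs'.closure_inter_closure_subset
      ⟨closure_mono hsub (hs.segment_subset_closure_left hys),
        h'.mem_closure_right hs' hp' (h.borders hys)⟩
    have hyi := h.subset_interior hy
    exact hne (h.eq_of_mem h' hy (mem_openSegment_of_ne_left_right
      (by intro he; rw [← he] at hyi; exact h'.mem_left.2 hyi)
      (by intro he; rw [← he] at hyi; exact h'.mem_right.2 hyi) hy'))
  · exact hsub

end PolygonalEnvironment

/-! ### Visibility sets and blocked lines of sight -/

lemma isClosed_visibilitySet {E : Set Plane} (hE : IsClosed E) (p : Plane) :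
    IsClosed (visibilitySet E p) := by
  have : visibilitySet E p = ⋂ t ∈ Icc (0 : ℝ) 1, {q | p + t • (q - p) ∈ E} := by
    ext q
    simp only [visibilitySet, mem_ofPred_eq, mem_iInter]
    constructor
    · rintro ⟨-, h⟩ t ⟨h0, h1⟩
      exact h (add_smul_sub_mem_segment h0 h1)
    · intro h
      refine ⟨by simpa using h 1 ⟨by norm_num, le_rfl⟩, fun x hx => ?_⟩
      obtain ⟨t, h0, h1, rfl⟩ := mem_segment_iff.1 hx
      exact h t ⟨h0, h1⟩
  rw [this]
  exact isClosed_biInter fun t _ => hE.preimage (by fun_prop)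

/-- Along the segment `[p, x]` there are points outside `E` arbitrarily near, on the side of the
line given by the sign of `s`. -/
def Blocked (E : Set Plane) (p x : Plane) (s : ℝ) : Prop :=
  ∃ t : ℝ, 0 < t ∧ t < 1 ∧
    p + t • (x - p) ∈ closure {q | q ∉ E ∧ 0 < s * wedge (x - p) (q - p)}

lemma Blocked.exists_notMem_interior {E : Set Plane} {p x : Plane} {s : ℝ} (h : Blocked E p x s) :
    ∃ t : ℝ, 0 < t ∧ t < 1 ∧ p + t • (x - p) ∉ interior E := by
  obtain ⟨t, h0, h1, ht⟩ := h
  refine ⟨t, h0, h1, fun hi => ?_⟩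
  obtain ⟨q, hq, hq'⟩ := mem_closure_iff_nhds.1 ht _ (isOpen_interior.mem_nhds hi)
  exact hq'.1 (interior_subset hq)

/-- Moving `x` along its ray does not change the sides of the line, only the length of the ray that
counts. -/
lemma blocked_smul_iff {E : Set Plane} {p x : Plane} {s l : ℝ} (hl : 0 < l) :
    Blocked E p (p + l • (x - p)) s ↔ ∃ t : ℝ, 0 < t ∧ t < l ∧
      p + t • (x - p) ∈ closure {q | q ∉ E ∧ 0 < s * wedge (x - p) (q - p)} := by
  have hset : {q | q ∉ E ∧ 0 < s * wedge (p + l • (x - p) - p) (q - p)} =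
      {q | q ∉ E ∧ 0 < s * wedge (x - p) (q - p)} := by
    ext q
    simp only [mem_ofPred_eq, add_sub_cancel_left, wedge_smul_left]
    rw [mul_left_comm, mul_pos_iff_of_pos_left hl]
  rw [Blocked, hset]
  simp only [add_sub_cancel_left, smul_smul]
  constructor
  · rintro ⟨t, h0, h1, h⟩
    exact ⟨t * l, by positivity, by nlinarith, h⟩
  · rintro ⟨t, h0, h1, h⟩
    exact ⟨t / l, by positivity, by rwa [div_lt_one hl], by rwa [div_mul_cancel₀ _ hl.ne']⟩

lemma exists_wedge_ne_zero_of_isOpen {O : Set Plane} (hO : IsOpen O) (hne : O.Nonempty) {u : Plane}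
    (hu : u ≠ 0) (p : Plane) : ∃ q ∈ O, wedge u (q - p) ≠ 0 := by
  obtain ⟨q₀, hq₀⟩ := hne
  obtain ⟨δ, hδ, hb⟩ := Metric.isOpen_iff.1 hO q₀ hq₀
  by_cases h0 : wedge u (q₀ - p) = 0
  · obtain ⟨q, hq, hq'⟩ := exists_mem_ball_wedge_pos hu q₀ hδ
    refine ⟨q, hb hq, ?_⟩
    have : q - p = (q - q₀) + (q₀ - p) := by abel
    rw [this, wedge_add_right, h0, add_zero]
    exact hq'.ne'
  · exact ⟨q₀, hq₀, h0⟩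

lemma exists_mem_ball_mul_wedge_pos {p x q : Plane} {s : ℝ} (hs : s ≠ 0) (hx : x ≠ p)
    (hq : 0 ≤ s * wedge (x - p) (q - p)) {ε : ℝ} (hε : 0 < ε) :
    ∃ q' ∈ ball q ε, 0 < s * wedge (x - p) (q' - p) := by
  obtain ⟨q', hq', h⟩ := exists_mem_ball_wedge_pos (u := s • (x - p))
    (smul_ne_zero hs (sub_ne_zero.2 hx)) q hε
  refine ⟨q', hq', ?_⟩
  rw [wedge_smul_left] at h
  have : q' - p = (q' - q) + (q - p) := by abel
  rw [this, wedge_add_right, mul_add]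
  linarith

/-- Along a ray, the first point of a closed set. -/
lemma exists_first_hit {S : Set Plane} (hS : IsClosed S) {y v : Plane} {m : ℝ} (hm : 0 ≤ m)
    (hy : y ∉ S) (hx : y + m • v ∈ S) :
    ∃ t : ℝ, 0 < t ∧ t ≤ m ∧ y + t • v ∈ S ∧ ∀ u, 0 ≤ u → u < t → y + u • v ∉ S := by
  have hK : IsCompact (Icc 0 m ∩ {t : ℝ | y + t • v ∈ S}) :=
    isCompact_Icc.inter_right (hS.preimage (by fun_prop))
  obtain ⟨t, ⟨⟨h0, h1⟩, h2⟩, hmin⟩ := hK.exists_isLeast ⟨m, ⟨hm, le_rfl⟩, hx⟩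
  refine ⟨t, lt_of_le_of_ne h0 ?_, h1, h2, fun u hu hut hus => ?_⟩
  · rintro rfl
    exact hy (by simpa using h2)
  · exact absurd (hmin ⟨⟨hu, hut.le.trans h1⟩, hus⟩) (not_le.2 hut)

namespace PolygonalEnvironment

variable {n : ℕ} (E : PolygonalEnvironment n)

/-- Near `p` the environment is a cone with apex `p`, hence star-shaped about `p`. -/
lemma exists_ball_inter_subset_visibilitySet {p : Plane} (hp : p ∈ E.carrier) :
    ∃ ε > 0, ball p ε ∩ E.carrier ⊆ visibilitySet E.carrier p := by
  obtain ⟨ε, hε, h⟩ := E.exists_conic_ball hp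
  refine ⟨ε, hε, ?_⟩
  rintro q ⟨hq, hqE⟩
  refine ⟨hqE, fun x hx => ?_⟩
  have hxb : x ∈ ball p ε := (convex_ball p ε).segment_subset (mem_ball_self hε) hq hx
  obtain ⟨t, h0, h1, rfl⟩ := mem_segment_iff.1 hx
  rcases h0.eq_or_lt with rfl | h0
  · simpa using hp
  · exact (h q hq t h0 hxb).2 hqE

lemma mem_interior_visibilitySet_self {p : Plane} (hp : p ∈ interior E.carrier) :
    p ∈ interior (visibilitySet E.carrier p) := by
  obtain ⟨ε, hε, h⟩ := E.exists_ball_inter_subset_visibilitySet (interior_subset hp)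
  refine interior_maximal ?_ (isOpen_ball.inter isOpen_interior) ⟨mem_ball_self hε, hp⟩
  exact (inter_subset_inter_right _ interior_subset).trans h

variable {E}

/-- Away from `p`, compactness of the line of sight gives a tube of uniform width whose part on the
side `s` lies in the environment. Near `p`, where such tubes would shrink, the conic shape takes
over; `t₀` marks a point inside the conic disc. -/
lemma exists_ball_subset_visibilitySet_of_not_blocked {p x : Plane} {s : ℝ} (hp : p ∈ E.carrier)
    (hx : x ∈ interior E.carrier) (hs : ¬ Blocked E.carrier p x s) :
    ∃ δ > 0, ∀ q ∈ ball x δ, 0 < s * wedge (x - p) (q - p) → q ∈ visibilitySet E.carrier p := by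
  obtain ⟨ε, hε, hcon⟩ := E.exists_conic_ball hp
  obtain ⟨t₀, ht₀, ht₁, htε⟩ : ∃ t₀ : ℝ, 0 < t₀ ∧ t₀ ≤ 1 ∧ t₀ * ‖x - p‖ < ε / 2 := by
    refine ⟨min 1 (ε / (2 * (‖x - p‖ + 1))), lt_min one_pos (by positivity), min_le_left _ _, ?_⟩
    calc min 1 (ε / (2 * (‖x - p‖ + 1))) * ‖x - p‖
        ≤ ε / (2 * (‖x - p‖ + 1)) * ‖x - p‖ := by gcongr; exact min_le_right _ _
      _ < ε / 2 := by
        rw [div_mul_eq_mul_div, div_lt_div_iff₀ (by positivity) (by positivity)]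
        nlinarith [norm_nonneg (x - p)]
  set H : Set Plane := {q | q ∉ E.carrier ∧ 0 < s * wedge (x - p) (q - p)}
  set K : Set Plane := (fun t : ℝ => p + t • (x - p)) '' Icc t₀ 1
  have hK : IsCompact K := isCompact_Icc.image (by fun_prop)
  have hKO : K ⊆ interior E.carrier ∪ (closure H)ᶜ := by
    rintro _ ⟨t, ⟨h0, h1⟩, rfl⟩
    rcases h1.eq_or_lt with rfl | h1
    · left; simpa using hx
    · right
      exact fun hcl => hs ⟨t, by linarith, h1, hcl⟩
  obtain ⟨δ, hδ, hthick⟩ := hK.exists_thickening_subset_open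
    (isOpen_interior.union isClosed_closure.isOpen_compl) hKO
  refine ⟨min δ (ε / 2), lt_min hδ (by positivity), fun q hq hpos => ?_⟩
  have hqδ : dist q x < δ := ball_subset_ball (min_le_left _ _) hq
  have hqε : dist q x < ε / 2 := ball_subset_ball (min_le_right _ _) hq
  have hfar : ∀ t : ℝ, t₀ ≤ t → t ≤ 1 → p + t • (q - p) ∈ E.carrier := by
    intro t h0 h1
    have htpos : 0 < t := by linarith
    have hw : p + t • (q - p) ∈ thickening δ K := by
      rw [mem_thickening_iff]
      refine ⟨p + t • (x - p), ⟨t, ⟨h0, h1⟩, rfl⟩, ?_⟩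
      rw [dist_add_left, dist_smul₀, dist_sub_right, Real.norm_of_nonneg htpos.le]
      nlinarith [dist_nonneg (x := q) (y := x)]
    rcases hthick hw with h | h
    · exact interior_subset h
    · by_contra hno
      refine h (subset_closure ⟨hno, ?_⟩)
      rw [add_sub_cancel_left, wedge_smul_right, mul_left_comm]
      exact mul_pos htpos hpos
  refine ⟨by simpa using hfar 1 ht₁ le_rfl, fun y hy => ?_⟩
  obtain ⟨t, h0, h1, rfl⟩ := mem_segment_iff.1 hy
  rcases le_total t₀ t with h | h
  · exact hfar t h h1
  rcases h0.eq_or_lt with rfl | h0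
  · simpa using hp
  have hb : p + t₀ • (q - p) ∈ ball p ε := by
    rw [mem_ball, dist_self_add_left, norm_smul, Real.norm_of_nonneg ht₀.le]
    have h2 : ‖q - p‖ ≤ ‖q - x‖ + ‖x - p‖ := norm_sub_le_norm_sub_add_norm_sub _ _ _
    rw [dist_eq_norm] at hqε
    nlinarith [norm_nonneg (q - x)]
  have he : p + t • (q - p) = p + (t / t₀) • (p + t₀ • (q - p) - p) := by
    rw [add_sub_cancel_left, smul_smul, div_mul_cancel₀ _ ht₀.ne']
  have hle : t / t₀ ≤ 1 := (div_le_one ht₀).2 h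
  rw [he]
  refine (hcon _ hb (t / t₀) (by positivity) ?_).2 (hfar t₀ le_rfl ht₁)
  exact (convex_ball p ε).segment_subset (mem_ball_self hε) hb
    (add_smul_sub_mem_segment (by positivity) hle)

/-- At the blocking point `z` the environment is a cone, so one outside point `w` near `z` makes the
whole half-open segment from `z` to `w` lie outside. A line of sight to a point near `x` on that
side would have to cross it. -/
lemma exists_ball_notMem_visibilitySet_of_blocked {p x : Plane} {s : ℝ}
    (hx : x ∈ visibilitySet E.carrier p) (hs : Blocked E.carrier p x s) :
    ∃ δ > 0, ∀ q ∈ ball x δ, 0 < s * wedge (x - p) (q - p) → q ∉ visibilitySet E.carrier p := by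
  obtain ⟨τ, h0, h1, hz⟩ := hs
  set z := p + τ • (x - p) with hzdef
  have hzE : z ∈ E.carrier := hx.2 (add_smul_sub_mem_segment h0.le h1.le)
  obtain ⟨ε, hε, hcon⟩ := E.exists_conic_ball hzE
  obtain ⟨w, hw, hwE, hws⟩ := mem_closure_iff_nhds.1 hz _ (ball_mem_nhds z hε)
  set d := w - z with hd
  have hl : 0 < s * wedge (x - p) d := by
    have : d = (w - p) - τ • (x - p) := by rw [hd, hzdef]; abel
    rw [this, wedge_sub_right, wedge_smul_right, wedge_self]
    simpa using hws
  -- The three inequalities hold at `q = x` and persist nearby. They make the denominator positive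
  -- and put the crossing point before `q` on `[p, q]` and before `w` on `[z, w]`.
  have hopen : IsOpen {q | 0 < s * wedge (q - p) d ∧
      τ * (s * wedge (x - p) d) < s * wedge (q - p) d ∧
      τ * (s * wedge (x - p) (q - p)) < s * wedge (q - p) d} := by
    have hc : Continuous fun q : Plane => s * wedge (q - p) d := by fun_prop
    have hc' : Continuous fun q : Plane => τ * (s * wedge (x - p) (q - p)) := by fun_prop
    exact (isOpen_lt continuous_const hc).inter
      ((isOpen_lt continuous_const hc).inter (isOpen_lt hc' hc))
  obtain ⟨δ, hδ, hb⟩ := Metric.isOpen_iff.1 hopen x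
    ⟨hl, by nlinarith, by rw [wedge_self]; simpa using hl⟩
  refine ⟨δ, hδ, fun q hq hpos hV => ?_⟩
  obtain ⟨h2, h3, h4⟩ := hb hq
  have hid : ∀ u v w : Plane, wedge v w • u + wedge u v • w = wedge u w • v := by
    intro u v w
    apply Plane.ext' <;> simp [wedge] <;> ring
  set μ := s * wedge (q - p) d
  set σ := τ * (s * wedge (x - p) (q - p)) / μ
  have hσ : 0 < σ := div_pos (mul_pos h0 hpos) h2
  have hσ1 : σ ≤ 1 := ((div_lt_one h2).2 h4).le
  -- The crossing of the two lines by Cramer's rule, in the form of the identity `hid`.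
  have hpt : z + σ • (w - z) = p + (τ * (s * wedge (x - p) d) / μ) • (q - p) := by
    have hμ : μ • (z + σ • d) = μ • (p + (τ * (s * wedge (x - p) d) / μ) • (q - p)) := by
      have e1 : ∀ (c : ℝ) (u v : Plane), μ • (u + (c / μ) • v) = μ • u + c • v := fun c u v => by
        rw [smul_add, smul_smul, mul_div_cancel₀ _ h2.ne']
      rw [e1, e1]
      have := hid (x - p) (q - p) d
      have h5 : (τ * (s * wedge (x - p) d)) • (q - p) =
          (τ * s) • (wedge (x - p) d • (q - p)) := by rw [smul_smul, mul_assoc]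
      rw [h5, ← this, hzdef]
      module
    exact smul_right_injective _ h2.ne' hμ
  have hin : z + σ • (w - z) ∈ E.carrier := by
    rw [hpt]
    exact hV.2 (add_smul_sub_mem_segment (by positivity) ((div_lt_one h2).2 h3).le)
  have hball : z + σ • (w - z) ∈ ball z ε :=
    (convex_ball z ε).segment_subset (mem_ball_self hε) hw (add_smul_sub_mem_segment hσ.le hσ1)
  exact hwE ((hcon w hw σ hσ hball).1 hin)

lemma notMem_interior_visibilitySet_of_blocked {p x : Plane} {s : ℝ} (hs0 : s ≠ 0) (hxp : x ≠ p)
    (hx : x ∈ visibilitySet E.carrier p) (hs : Blocked E.carrier p x s) :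
    x ∉ interior (visibilitySet E.carrier p) := by
  intro hi
  obtain ⟨δ, hδ, h⟩ := exists_ball_notMem_visibilitySet_of_blocked hx hs
  obtain ⟨ε, hε, h'⟩ := Metric.isOpen_iff.1 isOpen_interior x hi
  obtain ⟨q, hq, hpos⟩ := exists_mem_ball_mul_wedge_pos (q := x) hs0 hxp (by simp) (lt_min hδ hε)
  exact h q (ball_subset_ball (min_le_left _ _) hq) hpos
    (interior_subset (h' (ball_subset_ball (min_le_right _ _) hq)))

/-- On an unblocked side the visibility set contains a closed half-disc. -/
lemma exists_ball_subset_closure_interior_of_not_blocked {p x : Plane} {s : ℝ} (hs0 : s ≠ 0)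
    (hxp : x ≠ p) (hp : p ∈ E.carrier) (hx : x ∈ interior E.carrier)
    (hs : ¬ Blocked E.carrier p x s) : ∃ δ > 0, ∀ q ∈ ball x δ,
      0 ≤ s * wedge (x - p) (q - p) → q ∈ closure (interior (visibilitySet E.carrier p)) := by
  obtain ⟨δ, hδ, h⟩ := exists_ball_subset_visibilitySet_of_not_blocked hp hx hs
  refine ⟨δ, hδ, fun q hq hq' => ?_⟩
  rw [Metric.mem_closure_iff]
  intro ε hε
  obtain ⟨r, hr, hr'⟩ := Metric.isOpen_iff.1 isOpen_ball q hq
  obtain ⟨q', hq1, hq2⟩ := exists_mem_ball_mul_wedge_pos hs0 hxp hq' (lt_min hr hε)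
  refine ⟨q', ?_, by rw [dist_comm]; exact ball_subset_ball (min_le_right _ _) hq1⟩
  have hopen : IsOpen (ball x δ ∩ {q | 0 < s * wedge (x - p) (q - p)}) :=
    isOpen_ball.inter (isOpen_lt (by fun_prop) (by fun_prop))
  exact interior_maximal (fun q hq => h q hq.1 hq.2) hopen
    ⟨hr' (ball_subset_ball (min_le_left _ _) hq1), hq2⟩

/-- With neither side blocked, two closed half-discs of visible points would fill a neighbourhood of
`x`. -/
lemma exists_blocked_of_mem_frontier {p x : Plane} (hp : p ∈ E.carrier)
    (hx : x ∈ interior E.carrier) (hxp : x ≠ p) (hF : x ∈ frontier (visibilitySet E.carrier p)) :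
    ∃ s : ℝ, (s = 1 ∨ s = -1) ∧ Blocked E.carrier p x s := by
  by_contra hno
  push Not at hno
  obtain ⟨δ, hδ, h⟩ := exists_ball_subset_closure_interior_of_not_blocked one_ne_zero hxp hp hx
    (hno 1 (Or.inl rfl))
  obtain ⟨δ', hδ', h'⟩ := exists_ball_subset_closure_interior_of_not_blocked
    (neg_ne_zero.2 one_ne_zero) hxp hp hx (hno (-1) (Or.inr rfl))
  apply hF.2
  refine interior_maximal ?_ isOpen_ball (mem_ball_self (lt_min hδ hδ'))
  intro q hq
  have hcl : closure (interior (visibilitySet E.carrier p)) ⊆ visibilitySet E.carrier p :=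
    closure_minimal interior_subset (isClosed_visibilitySet E.isClosed p)
  apply hcl
  rcases le_total 0 (wedge (x - p) (q - p)) with h0 | h0
  · exact h q (ball_subset_ball (min_le_left _ _) hq) (by linarith)
  · exact h' q (ball_subset_ball (min_le_right _ _) hq) (by linarith)

/-- Going back from `y` towards `p`, the first point not in the interior is grazed by the line of
sight, hence is a vertex. -/
lemma exists_vertex_mem_openSegment {p y : Plane} {s : ℝ} (hy : y ∈ interior E.carrier)
    (hyV : y ∈ visibilitySet E.carrier p) (hs : Blocked E.carrier p y s) :
    ∃ i, E.vertex i ∈ openSegment ℝ p y := by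
  obtain ⟨τ, h0, h1, hτ⟩ := hs.exists_notMem_interior
  obtain ⟨t, ht0, ht1, ha, hlast⟩ := exists_first_hit (S := (interior E.carrier)ᶜ) (v := p - y)
    isOpen_interior.isClosed_compl (y := y) (m := 1 - τ) (by linarith) (by simpa using hy) (by
      have : y + (1 - τ) • (p - y) = p + τ • (y - p) := by module
      rwa [this])
  have ha' : y + t • (p - y) ∈ openSegment ℝ p y := by
    rw [openSegment_symm]
    exact add_smul_sub_mem_openSegment ht0 (by linarith)
  obtain ⟨i, -, hi⟩ := E.exists_isReflexCorner_of_grazing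
    ((E.mem_interior_or_mem_frontier (hyV.2 (openSegment_subset_segment _ _ _ ha'))).resolve_left ha)
    ha' hyV.2 (by
      rw [openSegment_symm]
      intro x hx
      obtain ⟨u, hu0, hu1, rfl⟩ := mem_openSegment_iff.1 hx
      have := hlast (u * t) (by positivity) (by nlinarith)
      rw [add_sub_cancel_left, smul_smul]
      simpa using this)
  exact ⟨i + 1, hi ▸ ha'⟩

/-- Behind each inner point of the gap some vertex lies on its line of sight. There are infinitely
many such points and finitely many vertices, so two of them share a vertex, and the line of the gap
passes through `p`. As `p` is not on the open gap and `a` is nearer, `a` lies between `p` and `b`.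
-/
lemma radial_of_gap {p a b : Plane} (hp : p ∈ E.carrier) (hab : a ≠ b)
    (hint : openSegment ℝ a b ⊆ interior E.carrier)
    (hfr : segment ℝ a b ⊆ frontier (visibilitySet E.carrier p)) (hd : dist p a < dist p b) :
    a ∈ openSegment ℝ p b ∧ segment ℝ p b ⊆ E.carrier := by
  have := E.neZero
  have hVcl := isClosed_visibilitySet E.isClosed p
  have hV : segment ℝ a b ⊆ visibilitySet E.carrier p := fun x hx => hVcl.frontier_subset (hfr hx)
  refine ⟨?_, (hV (right_mem_segment _ _ _)).2⟩
  have hnep : ∀ y ∈ openSegment ℝ a b, y ≠ p := by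
    rintro y hy rfl
    exact (hfr (openSegment_subset_segment _ _ _ hy)).2
      (E.mem_interior_visibilitySet_self (hint hy))
  have hap : a ≠ p := by
    rintro rfl
    obtain ⟨ε, hε, hb⟩ := E.exists_ball_inter_subset_visibilitySet hp
    obtain ⟨η, hη, hηb⟩ := add_smul_mem_ball (z := a) (sub_ne_zero.2 hab.symm) hε
    have hm : 0 < min η (1 / 2) := lt_min hη (by norm_num)
    have hy : a + min η (1 / 2) • (b - a) ∈ openSegment ℝ a b :=
      add_smul_sub_mem_openSegment hm ((min_le_right _ _).trans_lt (by norm_num))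
    refine (hfr (openSegment_subset_segment _ _ _ hy)).2 (interior_maximal
      ((inter_subset_inter_right _ interior_subset).trans hb) (isOpen_ball.inter isOpen_interior)
      ⟨hηb _ ?_, hint hy⟩)
    rw [abs_of_pos hm]
    exact min_le_left _ _
  have hvert : ∀ y ∈ openSegment ℝ a b, ∃ i, E.vertex i ∈ openSegment ℝ p y := by
    intro y hy
    have hys := openSegment_subset_segment ℝ _ _ hy
    obtain ⟨s, -, hs⟩ := exists_blocked_of_mem_frontier hp (hint hy) (hnep y hy) (hfr hys)
    exact exists_vertex_mem_openSegment (hint hy) (hV hys) hs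
  have hyk : ∀ k : ℕ, a + (1 / ((k : ℝ) + 2)) • (b - a) ∈ openSegment ℝ a b := fun k =>
    add_smul_sub_mem_openSegment (by positivity) (by rw [div_lt_one (by positivity)]; linarith [(Nat.cast_nonneg k : (0 : ℝ) ≤ k)])
  choose f hf using fun k => hvert _ (hyk k)
  obtain ⟨k, l, hkl, hfkl⟩ := Finite.exists_ne_map_eq_of_infinite f
  have hline : ∀ k, wedge (E.vertex (f k) - p) (a - p) +
      1 / ((k : ℝ) + 2) * wedge (E.vertex (f k) - p) (b - a) = 0 := by
    intro k
    obtain ⟨t, h0, h1, ht⟩ := mem_openSegment_iff.1 (hf k)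
    have h2 : wedge (E.vertex (f k) - p) (a + (1 / ((k : ℝ) + 2)) • (b - a) - p) = 0 := by
      rw [ht, add_sub_cancel_left, wedge_smul_left, wedge_self, mul_zero]
    rw [← wedge_smul_right, ← wedge_add_right, ← h2]
    congr 1; abel
  have hu : E.vertex (f k) - p ≠ 0 := by
    rw [sub_ne_zero]
    intro he
    have := hf k
    rw [he, left_mem_openSegment_iff] at this
    exact hnep _ (hyk k) this.symm
  have e1 := hline k
  have e2 := hline l
  rw [← hfkl] at e2
  have hne : 1 / ((k : ℝ) + 2) ≠ 1 / ((l : ℝ) + 2) := by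
    intro he
    rw [div_eq_div_iff (by positivity) (by positivity)] at he
    exact hkl (by exact_mod_cast (by linarith : (k : ℝ) = l))
  have hβ0 : wedge (E.vertex (f k) - p) (b - a) = 0 := by
    have : (1 / ((k : ℝ) + 2) - 1 / ((l : ℝ) + 2)) * wedge (E.vertex (f k) - p) (b - a) = 0 := by
      linarith
    exact (mul_eq_zero.1 this).resolve_left (sub_ne_zero.2 hne)
  rw [hβ0, mul_zero, add_zero] at e1
  obtain ⟨α, hα⟩ := exists_smul_of_wedge_eq_zero hu e1
  obtain ⟨β, hβ⟩ := exists_smul_of_wedge_eq_zero hu hβ0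
  set u := E.vertex (f k) - p
  have hbp : b - p = (α + β) • u := by
    rw [add_smul, ← hα, ← hβ]; abel
  rw [dist_comm p a, dist_comm p b, dist_eq_norm, dist_eq_norm, hα, hbp, norm_smul, norm_smul] at hd
  have hd' : |α| < |α + β| := lt_of_mul_lt_mul_right hd (norm_nonneg _)
  have hα0 : α ≠ 0 := by
    rintro rfl
    rw [zero_smul, sub_eq_zero] at hα
    exact hap hα
  have hsq : α ^ 2 < (α + β) ^ 2 := sq_lt_sq.2 hd'
  -- Here `α` and `α + β` are the coordinates of `a` and `b` on the line from `p`. Opposite signs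
  -- would put `p` inside the gap.
  have hprod : 0 < α * (α + β) := by
    by_contra hc
    push Not at hc
    have hα2 : 0 < α ^ 2 := by positivity
    have hβα : α * β < 0 := by nlinarith
    have hβ0' : β ≠ 0 := by rintro rfl; simp at hβα
    have ht0 : 0 < -α / β := by
      have : -α / β = -(α * β) / β ^ 2 := by field_simp
      rw [this]; exact div_pos (by linarith) (by positivity)
    have ht1 : -α / β < 1 := by
      have : -α / β = -(α * β) / β ^ 2 := by field_simp
      rw [this, div_lt_one (by positivity)]
      nlinarith
    refine hnep p (mem_openSegment_iff.2 ⟨-α / β, ht0, ht1, ?_⟩) rfl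
    rw [hβ, smul_smul, div_mul_cancel₀ _ hβ0', neg_smul, ← hα]; abel
  have hαβ : α + β ≠ 0 := by rintro h; simp [h] at hprod
  refine mem_openSegment_iff.2 ⟨α / (α + β), ?_, ?_, ?_⟩
  · have : α / (α + β) = α * (α + β) / (α + β) ^ 2 := by field_simp
    rw [this]; positivity
  · have : α / (α + β) = α * (α + β) / (α + β) ^ 2 := by field_simp
    rw [this, div_lt_one (by positivity)]
    nlinarith
  · rw [hbp, smul_smul, div_mul_cancel₀ _ hαβ, ← hα]; abel

lemma exists_eq_add_smul_of_mem_openSegment {p a b : Plane} (h : a ∈ openSegment ℝ p b) :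
    ∃ m : ℝ, 1 < m ∧ p = b + m • (a - b) := by
  obtain ⟨τ, h0, h1, rfl⟩ := mem_openSegment_iff.1 h
  have h2 : 0 < 1 - τ := by linarith
  refine ⟨1 / (1 - τ), by rw [lt_div_iff₀ h2]; linarith, ?_⟩
  have : p + τ • (b - p) - b = (1 - τ) • (p - b) := by module
  rw [this, smul_smul, one_div_mul_cancel h2.ne', one_smul]; abel

/-! ### Dividing gaps of a region; unseen points lie across them -/

variable {Ω : Set Plane} {k p a b : Plane}

/-- The dividing gaps of an agent with respect to its region are chords of the environment. -/
lemma Region.radialChord (hR : E.Region Ω k p) (hg : IsDividingGap E.carrier (closure Ω) p a b)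
    (hd : dist p a < dist p b) : E.RadialChord p a b ∧ openSegment ℝ a b ⊆ Ω ∧
      Disjoint (segment ℝ k p) (segment ℝ a b) := by
  obtain ⟨⟨hab, hint, hfr, ha, hb⟩, hcl⟩ := hg
  rw [hR.interior_closure] at hint
  obtain ⟨hrad, hvis⟩ := radial_of_gap hR.mem hab (hint.trans hR.subset_interior) hfr hd
  obtain ⟨m, hm, hpm⟩ := exists_eq_add_smul_of_mem_openSegment hrad
  have hpab : p ∉ segment ℝ a b := by
    rw [hpm, line_mem_segment_iff hab]
    intro h
    linarith [h.2]
  -- A common point other than `b` lies on a line of sight into `Ω`, so by `ray` it would be `p`. If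
  -- `b` is common, so is an inner point of the gap, because it lies between `p` and `b`.
  have hdis : Disjoint (segment ℝ k p) (segment ℝ a b) := by
    rw [disjoint_left]
    intro x hxk hx
    have hx' := hx
    rw [segment_symm] at hx'
    obtain ⟨t, ht0, ht1, rfl⟩ := mem_segment_iff.1 hx'
    have hopen : ∀ {v : ℝ}, 0 < v → v < 1 → b + v • (a - b) ∈ openSegment ℝ a b := fun h0 h1 => by
      rw [openSegment_symm]; exact add_smul_sub_mem_openSegment h0 h1
    have hsegb : ∀ y ∈ openSegment ℝ a b, segment ℝ p y ⊆ segment ℝ p b := fun y hy =>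
      (convex_segment p b).segment_subset (left_mem_segment _ _ _)
        ((convex_segment p b).segment_subset (openSegment_subset_segment _ _ _ hrad)
          (right_mem_segment _ _ _) (openSegment_subset_segment _ _ _ hy))
    rcases ht0.eq_or_lt with rfl | ht0
    · rw [zero_smul, add_zero] at hxk
      have hw := hopen (v := 1 / 2) (by norm_num) (by norm_num)
      have hwb : b + (1 / 2 : ℝ) • (a - b) ∈ segment ℝ p b :=
        hsegb _ hw (right_mem_segment _ _ _)
      have hwk := (convex_segment k p).segment_subset (right_mem_segment ℝ k p) hxk hwb
      have := hR.ray _ (hint hw) ((hsegb _ hw).trans hvis) _ hwk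
        (right_mem_segment ℝ p _)
      exact hpab (this ▸ openSegment_subset_segment _ _ _ hw)
    · have hw := hopen (v := t / 2) (by positivity) (by linarith)
      have := hR.ray _ (hint hw) ((hsegb _ hw).trans hvis) _ hxk (by
        have hmt : 0 < m - t / 2 := by linarith
        refine mem_segment_iff.2 ⟨(m - t) / (m - t / 2), div_nonneg (by linarith) hmt.le,
          (div_le_one hmt).2 (by linarith), ?_⟩
        have h1 : b + (t / 2) • (a - b) - p = (-(m - t / 2)) • (a - b) := by rw [hpm]; module
        rw [h1, smul_smul, mul_neg, div_mul_cancel₀ _ hmt.ne', hpm]; module)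
      exact hpab (this ▸ hx)
  refine ⟨⟨hab, ?_, ?_, hint.trans hR.subset_interior, hrad, hvis, hcl⟩, hint, hdis⟩
  · exact (hR.frontier_subset ha).resolve_right fun h =>
      disjoint_left.1 hdis h (left_mem_segment _ _ _)
  · exact (hR.frontier_subset hb).resolve_right fun h =>
      disjoint_left.1 hdis h (right_mem_segment _ _ _)

/-- An unseen point of the region in charge of an agent lies across one of its dividing gaps. -/
lemma Region.exists_gap_of_unseen (hR : E.Region Ω k p) {x : Plane} (hx : x ∈ Ω)
    (hxV : x ∉ visibilitySet E.carrier p) :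
    ∃ a b, IsDividingGap E.carrier (closure Ω) p a b ∧ dist p a < dist p b ∧
      ∀ C D s, Sides (interior E.carrier) a b C D s → p ∈ closure D → x ∈ C := by
  set V := visibilitySet E.carrier p with hVdef
  have hVcl : IsClosed V := isClosed_visibilitySet E.isClosed p
  have hWV : closure (interior V) ⊆ V := closure_minimal interior_subset hVcl
  have hpE := hR.mem
  have hOo : IsOpen (Ω \ closure (interior V)) := hR.isOpen.sdiff isClosed_closure
  have hxO : x ∈ Ω \ closure (interior V) := ⟨hx, fun h => hxV (hWV h)⟩
  -- Removing `closure (interior V)` instead of `V` counts one-dimensional spikes as unseen, so they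
  -- do not split the component.
  set U := connectedComponentIn (Ω \ closure (interior V)) x with hU
  have hUo : IsOpen U := hOo.connectedComponentIn
  have hUsub : U ⊆ Ω \ closure (interior V) := connectedComponentIn_subset _ _
  have hxU : x ∈ U := mem_connectedComponentIn hxO
  obtain ⟨q₀, hq₀, hq₀W⟩ : ∃ q, q ∈ Ω ∧ q ∈ closure (interior V) := by
    obtain ⟨ε, hε, hb⟩ := E.exists_ball_inter_subset_visibilitySet hpE
    obtain ⟨q, hq, hqΩ⟩ := mem_closure_iff_nhds.1 hR.mem_closure _ (ball_mem_nhds p hε)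
    refine ⟨q, hqΩ, subset_closure (interior_maximal ?_ (isOpen_ball.inter hR.isOpen) ⟨hq, hqΩ⟩)⟩
    exact (inter_subset_inter_right _ (hR.subset_interior.trans interior_subset)).trans hb
  -- Otherwise `U` would be open and closed in the connected `Ω`, which also contains seen points,
  -- near `p`.
  obtain ⟨y, hyΩ, hyW, hyU⟩ : ∃ y ∈ Ω, y ∈ closure (interior V) ∧ y ∈ closure U := by
    by_contra hno
    push Not at hno
    obtain ⟨z, -, hz1, hz2⟩ := hR.isPreconnected U (closure U)ᶜ hUo isClosed_closure.isOpen_compl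
      (by
        intro z hz
        by_cases hzU : z ∈ closure U
        · left
          have hzO : z ∈ Ω \ closure (interior V) := ⟨hz, fun h => hno z hz h hzU⟩
          obtain ⟨w, hw, hwU⟩ := mem_closure_iff_nhds.1 hzU _
            (hOo.connectedComponentIn.mem_nhds (mem_connectedComponentIn hzO))
          rw [hU, connectedComponentIn_eq hwU, ← connectedComponentIn_eq hw]
          exact mem_connectedComponentIn hzO
        · exact Or.inr hzU) ⟨x, hx, hxU⟩ ⟨q₀, hq₀, hno q₀ hq₀ hq₀W⟩
    exact hz2 (subset_closure hz1)
  have hyV : y ∈ V := hWV hyW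
  have hyE := hR.subset_interior hyΩ
  have hyi : y ∉ interior V := by
    intro hi
    obtain ⟨z, hz, hzU⟩ := mem_closure_iff_nhds.1 hyU _ (isOpen_interior.mem_nhds hi)
    exact (hUsub hzU).2 (subset_closure hz)
  have hyp : y ≠ p := by
    rintro rfl
    exact hyi (E.mem_interior_visibilitySet_self hyE)
  have hyp0 : y - p ≠ 0 := sub_ne_zero.2 hyp
  obtain ⟨s, hs, hbl⟩ := exists_blocked_of_mem_frontier hpE hyE hyp ⟨subset_closure hyV, hyi⟩
  have hs0 : s ≠ 0 := by rcases hs with rfl | rfl <;> norm_num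
  -- Blocked on both sides, the visibility set near `y` would lie in a line and have no interior
  -- there.
  have hnbl : ¬ Blocked E.carrier p y (-s) := by
    intro hbl'
    obtain ⟨δ, hδ, h⟩ := exists_ball_notMem_visibilitySet_of_blocked hyV hbl
    obtain ⟨δ', hδ', h'⟩ := exists_ball_notMem_visibilitySet_of_blocked hyV hbl'
    obtain ⟨z, hz, hzV⟩ := mem_closure_iff_nhds.1 hyW _ (ball_mem_nhds y (lt_min hδ hδ'))
    obtain ⟨q, ⟨hq, hqV⟩, hq0⟩ := exists_wedge_ne_zero_of_isOpen
      (isOpen_ball.inter isOpen_interior) ⟨z, hz, hzV⟩ hyp0 p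
    rcases lt_or_gt_of_ne (mul_ne_zero hs0 hq0) with hlt | hlt
    · exact h' q (ball_subset_ball (min_le_right _ _) hq) (by linarith) (interior_subset hqV)
    · exact h q (ball_subset_ball (min_le_left _ _) hq) hlt (interior_subset hqV)
  have hyΩc : y ∉ Ωᶜ := fun h => h hyΩ
  -- the maximal open segment of the ray through `y` within the region
  obtain ⟨α, τ, hτ0, hτα, hα1, hαΩ, hτcl, hαin⟩ : ∃ α τ : ℝ, 0 < τ ∧ τ ≤ α ∧ α < 1 ∧
      p + α • (y - p) ∉ Ω ∧
      p + τ • (y - p) ∈ closure {q | q ∉ E.carrier ∧ 0 < s * wedge (y - p) (q - p)} ∧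
      ∀ l, α < l → l ≤ 1 → p + l • (y - p) ∈ Ω := by
    obtain ⟨τ, h0, h1, hτ⟩ := hbl
    have hzΩ : p + τ • (y - p) ∉ Ω := by
      intro h
      obtain ⟨q, hq, hq'⟩ := mem_closure_iff_nhds.1 hτ _ (hR.isOpen.mem_nhds h)
      exact hq'.1 (interior_subset (hR.subset_interior hq))
    obtain ⟨t, ht0, ht1, ht, hlast⟩ := exists_first_hit (v := p - y) hR.isOpen.isClosed_compl
      (m := 1 - τ) (by linarith) hyΩc (by
        have : y + (1 - τ) • (p - y) = p + τ • (y - p) := by module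
        rwa [this])
    refine ⟨1 - t, τ, h0, by linarith, by linarith, ?_, hτ, fun l hl hl1 => ?_⟩
    · have : p + (1 - t) • (y - p) = y + t • (p - y) := by module
      rwa [this]
    · have := hlast (1 - l) (by linarith) (by linarith)
      have he : y + (1 - l) • (p - y) = p + l • (y - p) := by module
      rw [he] at this
      simpa using this
  obtain ⟨β, hβ1, hβΩ, hβin⟩ : ∃ β : ℝ, 1 < β ∧ p + β • (y - p) ∉ Ω ∧
      ∀ l, 1 ≤ l → l < β → p + l • (y - p) ∈ Ω := by
    obtain ⟨M, hM⟩ := (E.isCompact.isBounded.subset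
      (hR.subset_interior.trans interior_subset)).subset_closedBall y
    have hn : 0 < ‖y - p‖ := norm_pos_iff.2 hyp0
    have hM0 : 0 ≤ M := dist_nonneg.trans (mem_closedBall.1 (hM hx))
    have hfar : y + ((M + 1) / ‖y - p‖) • (y - p) ∈ Ωᶜ := by
      intro h
      have h1 := mem_closedBall.1 (hM h)
      rw [dist_self_add_left, norm_smul, Real.norm_of_nonneg (by positivity),
        div_mul_cancel₀ _ hn.ne'] at h1
      linarith
    obtain ⟨t, ht0, -, ht, hlast⟩ := exists_first_hit hR.isOpen.isClosed_compl
      (m := (M + 1) / ‖y - p‖) (by positivity) hyΩc hfar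
    refine ⟨1 + t, by linarith, ?_, fun l hl hl1 => ?_⟩
    · have : p + (1 + t) • (y - p) = y + t • (y - p) := by module
      rwa [this]
    · have := hlast (l - 1) (by linarith) (by linarith)
      have he : y + (l - 1) • (y - p) = p + l • (y - p) := by module
      rw [he] at this
      simpa using this
  set a := p + α • (y - p) with ha
  set b := p + β • (y - p) with hb
  have hab' : b - a = (β - α) • (y - p) := by rw [ha, hb]; module
  have hαβ : 0 < β - α := by linarith
  have hab : a ≠ b := by
    intro h
    rw [← sub_eq_zero, ← neg_sub, hab', neg_eq_zero] at h
    exact (smul_ne_zero hαβ.ne' hyp0) h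
  have hin : ∀ l, α < l → l < β → p + l • (y - p) ∈ Ω := fun l h1 h2 => by
    rcases le_total l 1 with h | h
    · exact hαin l h1 h
    · exact hβin l h h2
  have hparam : ∀ w ∈ openSegment ℝ a b, ∃ l, α < l ∧ l < β ∧ w = p + l • (y - p) := by
    intro w hw
    obtain ⟨t, h0, h1, rfl⟩ := mem_openSegment_iff.1 hw
    refine ⟨α + t * (β - α), by nlinarith, by nlinarith, ?_⟩
    rw [hab', ha]; module
  have hsub : openSegment ℝ a b ⊆ Ω := by
    intro w hw
    obtain ⟨l, h1, h2, rfl⟩ := hparam w hw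
    exact hin l h1 h2
  have hcl : segment ℝ a b ⊆ closure Ω :=
    segment_subset_closure_openSegment.trans (closure_mono hsub)
  have hwV : ∀ l, α < l → l < β → p + l • (y - p) ∈ V := by
    intro l h1 h2
    refine ⟨interior_subset (hR.subset_interior (hin l h1 h2)), fun z hz => ?_⟩
    obtain ⟨t, ht0, ht1, rfl⟩ := mem_segment_iff.1 hz
    rw [add_sub_cancel_left, smul_smul]
    rcases le_total (t * l) 1 with h | h
    · exact hyV.2 (add_smul_sub_mem_segment (by nlinarith) h)
    · exact interior_subset (hR.subset_interior (hin (t * l) (by linarith) (by nlinarith)))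
  have hne : ∀ l, α < l → p + l • (y - p) ≠ p := by
    intro l h1 h
    rw [add_eq_left] at h
    exact smul_ne_zero (by linarith) hyp0 h
  have hgapV : openSegment ℝ a b ⊆ frontier V := by
    intro w hw
    obtain ⟨l, h1, h2, rfl⟩ := hparam w hw
    refine ⟨subset_closure (hwV l h1 h2), notMem_interior_visibilitySet_of_blocked hs0 (hne l h1)
      (hwV l h1 h2) ((blocked_smul_iff (by linarith)).2 ⟨τ, hτ0, by linarith, hτcl⟩)⟩
  -- Nothing blocks within `Ω`, so an obstacle on the side `-s` would come no later than `a` and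
  -- would already block `y`.
  have hgapW : openSegment ℝ a b ⊆ closure (interior V) := by
    intro w hw
    obtain ⟨l, h1, h2, rfl⟩ := hparam w hw
    obtain ⟨δ, hδ, h⟩ := exists_ball_subset_closure_interior_of_not_blocked
      (neg_ne_zero.2 hs0) (hne l h1) hpE (hR.subset_interior (hin l h1 h2)) (by
        intro hbl'
        obtain ⟨t, ht0, htl, ht⟩ := (blocked_smul_iff (by linarith)).1 hbl'
        have htα : t ≤ α := by
          by_contra hc
          push Not at hc
          obtain ⟨q, hq, hq'⟩ := mem_closure_iff_nhds.1 ht _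
            (hR.isOpen.mem_nhds (hin t hc (by linarith)))
          exact hq'.1 (interior_subset (hR.subset_interior hq))
        exact hnbl ⟨t, ht0, by linarith, ht⟩)
    exact h _ (mem_ball_self hδ) (by simp)
  have hgap : IsDividingGap E.carrier (closure Ω) p a b := by
    refine ⟨⟨hab, by rwa [hR.interior_closure],
      segment_subset_closure_openSegment.trans (closure_minimal hgapV isClosed_frontier), ?_, ?_⟩,
      segment_subset_closure_openSegment.trans (closure_minimal hgapW isClosed_closure)⟩
    · refine ⟨subset_closure (hcl (left_mem_segment _ _ _)), ?_⟩
      rwa [hR.interior_closure]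
    · refine ⟨subset_closure (hcl (right_mem_segment _ _ _)), ?_⟩
      rwa [hR.interior_closure]
  have hdist : dist p a < dist p b := by
    rw [ha, hb, dist_self_add_right, dist_self_add_right, norm_smul, norm_smul,
      Real.norm_of_nonneg (by linarith), Real.norm_of_nonneg (by linarith)]
    exact mul_lt_mul_of_pos_right (by linarith) (norm_pos_iff.2 hyp0)
  refine ⟨a, b, hgap, hdist, fun C D s' hS hpD => ?_⟩
  obtain ⟨hch, -, -⟩ := hR.radialChord hgap hdist
  have hWD : closure (interior V) ⊆ closure D := fun w hw => hch.mem_closure_right hS hpD hw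
  have hyab : y ∈ openSegment ℝ a b := by
    refine mem_openSegment_iff.2 ⟨(1 - α) / (β - α), div_pos (by linarith) hαβ, ?_, ?_⟩
    · rw [div_lt_one hαβ]; linarith
    · rw [hab', smul_smul, div_mul_cancel₀ _ hαβ.ne', ha]; module
  obtain ⟨ε, hε, hcol⟩ := hS.collar y hyab
  obtain ⟨δ, hδ, hnear⟩ := exists_ball_subset_closure_interior_of_not_blocked
    (neg_ne_zero.2 hs0) hyp hpE hyE hnbl
  have hw : ∀ q, wedge (b - a) (q - a) = (β - α) * wedge (y - p) (q - p) := by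
    intro q
    have : q - a = (q - p) - α • (y - p) := by rw [ha]; abel
    rw [hab', this, wedge_smul_left, wedge_sub_right, wedge_smul_right, wedge_self, mul_zero,
      sub_zero]
  -- The unblocked side is seen near `y` and so lies in `closure D`; thus `C` is on the blocked
  -- side, where `U` approaches `y`.
  have hss : 0 < s * s' := by
    by_contra hc
    have hc' : s * s' < 0 := lt_of_le_of_ne (not_lt.1 hc) (mul_ne_zero hs0 hS.sign_ne)
    obtain ⟨q, hq, hpos⟩ := exists_mem_ball_wedge_sub_pos hab hS.sign_ne hyab (lt_min hε hδ)
    have hqC := (hcol q (ball_subset_ball (min_le_left _ _) hq)).1 hpos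
    rw [hw] at hpos
    have h1 : 0 < s' * wedge (y - p) (q - p) := by
      rw [mul_left_comm] at hpos
      exact (mul_pos_iff_of_pos_left hαβ).1 hpos
    have hs2 : 0 < s' ^ 2 := by have := hS.sign_ne; positivity
    have h2 : 0 ≤ -s * wedge (y - p) (q - p) := by
      have h3 : 0 < -(s * s') * (s' * wedge (y - p) (q - p)) := mul_pos (by linarith) h1
      have h4 : 0 < s' ^ 2 * (-s * wedge (y - p) (q - p)) := by nlinarith
      exact ((mul_pos_iff_of_pos_left hs2).1 h4).le
    exact disjoint_left.1 hS.disjoint_closure_right hqC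
      (hWD (hnear q (ball_subset_ball (min_le_right _ _) hq) h2))
  obtain ⟨q, hq, hqU⟩ := mem_closure_iff_nhds.1 hyU _ (ball_mem_nhds y (lt_min hε hδ))
  have hqC : q ∈ C := by
    refine (hcol q (ball_subset_ball (min_le_left _ _) hq)).1 ?_
    have h1 : 0 < s * wedge (y - p) (q - p) := by
      by_contra hc
      exact (hUsub hqU).2 (hnear q (ball_subset_ball (min_le_right _ _) hq) (by linarith))
    rw [hw, mul_left_comm]
    refine mul_pos hαβ ?_
    have hs2 : 0 < s ^ 2 := by positivity
    have h4 : 0 < s ^ 2 * (s' * wedge (y - p) (q - p)) := by nlinarith [mul_pos hss h1]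
    exact (mul_pos_iff_of_pos_left hs2).1 h4
  have hUCD : U ⊆ C ∪ D := by
    rw [hS.union_eq]
    intro z hz
    refine ⟨hR.subset_interior (hUsub hz).1, fun hzs => (hUsub hz).2 (hgap.2 hzs)⟩
  rcases (isPreconnected_connectedComponentIn (F := Ω \ closure (interior V)) (x := x)
    ).subset_or_subset hS.isOpen_left hS.isOpen_right hS.disjoint hUCD with h | h
  · exact h hxU
  · exact absurd (h hqU) (disjoint_left.1 hS.disjoint hqC)

end PolygonalEnvironment

/-! ### The tree of agents: counting and coverage -/

/-- An agent, described by the interior of the region in its charge, the near end of the gap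
through which it was deployed, and its final position. -/
structure AgentState where
  inside : Set Plane
  near : Plane
  pos : Plane

namespace PolygonalEnvironment

variable {n : ℕ} (E : PolygonalEnvironment n)

/-- The state of an agent fits a region of the environment. -/
def IsValid (σ : AgentState) : Prop := E.Region σ.inside σ.near σ.pos

/-- The agent `τ` is a child of the agent `σ`. -/
structure IsChild (σ τ : AgentState) : Prop where
  gap : IsDividingGap E.carrier (closure σ.inside) σ.pos τ.near τ.pos
  dist_lt : dist σ.pos τ.near < dist σ.pos τ.pos
  closure_eq : closure τ.inside = regionAcross (closure σ.inside) σ.pos τ.near τ.pos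
  valid : E.IsValid τ

/-- The agent `τ` is a proper descendant of the agent `σ`. -/
inductive Descends (σ : AgentState) : AgentState → Prop
  | single {τ : AgentState} : E.IsChild σ τ → Descends σ τ
  | tail {τ υ : AgentState} : Descends σ τ → E.IsChild τ υ → Descends σ υ

/-- The reflex vertices that an agent and its descendants may still straddle. -/
def pending (σ : AgentState) : Set Plane :=
  E.vertex '' {i | E.IsReflex i} ∩ (closure σ.inside \ segment ℝ σ.near σ.pos)

/-- The state of the root. -/
def rootState (p₀ : Plane) : AgentState := ⟨interior E.carrier, p₀, p₀⟩

variable {E}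

lemma finite_pending (σ : AgentState) : (E.pending σ).Finite := by
  have := E.neZero
  exact ((toFinite _).image _).subset inter_subset_left

lemma isValid_rootState {p₀ : Plane} (hp : p₀ ∈ E.carrier) : E.IsValid (E.rootState p₀) where
  isOpen := isOpen_interior
  isPreconnected := E.isPreconnected_interior
  subset_interior := subset_rfl
  interior_closure := by simp only [rootState, E.closure_interior]
  frontier_subset := by
    simp only [rootState, E.closure_interior]
    exact subset_union_left
  segment_subset := by
    simp only [rootState, E.closure_interior, segment_same]
    simpa using hp
  ray := fun w _ _ x hx _ => by simpa [rootState] using hx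

lemma IsChild.ext {σ τ τ' : AgentState} (h : E.IsChild σ τ) (h' : E.IsChild σ τ')
    (hn : τ.near = τ'.near) (hp : τ.pos = τ'.pos) : τ = τ' := by
  have h1 := h.closure_eq
  rw [hn, hp, ← h'.closure_eq] at h1
  have h2 : τ.inside = τ'.inside := by
    rw [← Region.interior_closure h.valid, ← Region.interior_closure h'.valid, h1]
  cases τ; cases τ'
  simp_all

lemma IsChild.exists_sides {σ τ : AgentState} (hσ : E.IsValid σ) (h : E.IsChild σ τ) :
    E.RadialChord σ.pos τ.near τ.pos ∧ openSegment ℝ τ.near τ.pos ⊆ σ.inside ∧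
      Disjoint (segment ℝ σ.near σ.pos) (segment ℝ τ.near τ.pos) ∧ τ.inside ⊆ σ.inside ∧
      ∃ D s, Sides (interior E.carrier) τ.near τ.pos τ.inside D s ∧ σ.pos ∈ closure D := by
  obtain ⟨hch, hsub, hdis⟩ := Region.radialChord hσ h.gap h.dist_lt
  obtain ⟨C, D, s, hs, hp⟩ := hch.exists_sides
  have heq : τ.inside = C := by
    rw [← Region.interior_closure h.valid, h.closure_eq, hσ.regionAcross_eq hch hsub hdis hs hp,
      hs.interior_closure_left]
  refine ⟨hch, hsub, hdis, ?_, D, s, ?_, hp⟩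
  · rw [heq]
    exact hσ.left_subset hsub hdis hs hp
  · rwa [heq]

lemma exists_isChild {σ : AgentState} (hσ : E.IsValid σ) {a b : Plane}
    (hg : IsDividingGap E.carrier (closure σ.inside) σ.pos a b)
    (hd : dist σ.pos a < dist σ.pos b) : ∃ C, E.IsChild σ ⟨C, a, b⟩ := by
  obtain ⟨hch, hsub, hdis⟩ := Region.radialChord hσ hg hd
  obtain ⟨C, D, s, hs, hp⟩ := hch.exists_sides
  exact ⟨C, hg, hd, (hσ.regionAcross_eq hch hsub hdis hs hp).symm, hch.region hs hp⟩

lemma IsChild.near_mem_pending {σ τ : AgentState} (hσ : E.IsValid σ) (h : E.IsChild σ τ) :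
    τ.near ∈ E.pending σ := by
  obtain ⟨hch, hsub, hdis, -, -⟩ := h.exists_sides hσ
  obtain ⟨i, hi, hi'⟩ := hch.exists_isReflexCorner
  refine ⟨⟨i + 1, hi.isReflex, hi'.symm⟩, ?_, fun h => ?_⟩
  · exact (segment_subset_closure_openSegment.trans (closure_mono hsub)) (left_mem_segment _ _ _)
  · exact disjoint_left.1 hdis h (left_mem_segment _ _ _)

/-- The parent's own gap lies on the parent's side of the new one, so a point of it in the child's
region would lie on the new gap, which is excluded. -/
lemma IsChild.pending_subset {σ τ : AgentState} (hσ : E.IsValid σ) (h : E.IsChild σ τ) :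
    E.pending τ ⊆ E.pending σ := by
  obtain ⟨hch, hsub, hdis, hle, D, s, hs, hp⟩ := h.exists_sides hσ
  rintro v ⟨hv, hvτ, hvs⟩
  refine ⟨hv, closure_mono hle hvτ, fun hk => hvs (hs.closure_inter_closure_subset ⟨hvτ, ?_⟩)⟩
  exact hs.subset_closure_right_of_mem (isPreconnected_segment _ _)
    (hσ.segment_subset.trans hσ.closure_subset) hdis (right_mem_segment _ _ _) hp hk

lemma near_notMem_pending (τ : AgentState) : τ.near ∉ E.pending τ := fun h =>
  h.2.2 (left_mem_segment _ _ _)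

/-- The region of `τ` lies in the closed side of the gap of `τ'` that contains the parent. It meets
the region of `τ'` at most in that gap, whose points are not pending for `τ'`. -/
lemma IsChild.siblings {σ τ τ' : AgentState} (hσ : E.IsValid σ) (h : E.IsChild σ τ)
    (h' : E.IsChild σ τ') (hne : τ ≠ τ') : τ.near ≠ τ'.near ∧ τ.near ∉ E.pending τ' ∧
      Disjoint (E.pending τ) (E.pending τ') := by
  obtain ⟨hch, -, -, -, D, s, hs, hp⟩ := h.exists_sides hσ
  obtain ⟨hch', -, -, -, D', s', hs', hp'⟩ := h'.exists_sides hσ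
  have hsub := hch.closure_subset_closure hch' (fun he => hne (h.ext h' he.1 he.2)) hs hp hs' hp'
  have hno : ∀ v ∈ closure τ.inside, v ∉ E.pending τ' := fun v hv hv' =>
    hv'.2.2 (hs'.closure_inter_closure_subset ⟨hv'.2.1, hsub hv⟩)
  refine ⟨fun he => ?_, hno _ (hs.segment_subset_closure_left (left_mem_segment _ _ _)),
    disjoint_left.2 fun v hv => hno v hv.2.1⟩
  have he' := hch.eq_of_left_eq (he ▸ hch' : E.RadialChord σ.pos τ.near τ'.pos)
  exact hne (h.ext h' he he')

lemma Descends.valid {σ τ : AgentState} (h : E.Descends σ τ) : E.IsValid τ := by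
  cases h with
  | single h => exact h.valid
  | tail _ h => exact h.valid

lemma Descends.cases_head {σ τ : AgentState} (h : E.Descends σ τ) :
    E.IsChild σ τ ∨ ∃ υ, E.IsChild σ υ ∧ E.Descends υ τ := by
  induction h with
  | single h => exact Or.inl h
  | tail _ h ih =>
    rcases ih with ih | ⟨υ, h1, h2⟩
    · exact Or.inr ⟨_, ih, .single h⟩
    · exact Or.inr ⟨υ, h1, h2.tail h⟩

lemma Descends.near_mem_pending {σ τ : AgentState} (hσ : E.IsValid σ) (h : E.Descends σ τ) :
    τ.near ∈ E.pending σ := by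
  have key : ∀ τ, E.Descends σ τ → E.pending τ ⊆ E.pending σ := by
    intro τ h
    induction h with
    | single h => exact h.pending_subset hσ
    | tail h' h ih => exact (h.pending_subset h'.valid).trans ih
  cases h with
  | single h => exact h.near_mem_pending hσ
  | tail h' h => exact key _ h' (h.near_mem_pending h'.valid)

/-- Different agents straddle different reflex vertices. -/
lemma Descends.eq_of_near_eq {σ τ τ' : AgentState} (hσ : E.IsValid σ) (h : E.Descends σ τ)
    (h' : E.Descends σ τ') (hn : τ.near = τ'.near) : τ = τ' := by
  obtain ⟨N, hN⟩ : ∃ N, (E.pending σ).ncard = N := ⟨_, rfl⟩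
  -- The number of pending vertices drops at each child: its near end is pending for the parent but
  -- not for itself. Only two descendants in one branch need the induction; the other cases are
  -- settled by `siblings` and by a near end not being pending for its own agent.
  induction N using Nat.strong_induction_on generalizing σ with
  | _ N ih =>
    rcases h.cases_head with h1 | ⟨υ, h1, h2⟩ <;> rcases h'.cases_head with h1' | ⟨υ', h1', h2'⟩
    · by_contra hne
      exact (h1.siblings hσ h1' hne).1 hn
    · exfalso
      have hm := h2'.near_mem_pending h1'.valid
      rw [← hn] at hm
      by_cases he : τ = υ'
      · subst he; exact near_notMem_pending τ hm
      · exact (h1.siblings hσ h1' he).2.1 hm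
    · exfalso
      have hm := h2.near_mem_pending h1.valid
      rw [hn] at hm
      by_cases he : τ' = υ
      · subst he; exact near_notMem_pending τ' hm
      · exact (h1'.siblings hσ h1 he).2.1 hm
    · by_cases he : υ = υ'
      · subst he
        refine ih _ ?_ h1.valid h2 h2' rfl
        rw [← hN]
        exact ncard_lt_ncard ⟨h1.pending_subset hσ, fun hle =>
          near_notMem_pending υ (hle (h1.near_mem_pending hσ))⟩ (finite_pending σ)
      · have hm := h2'.near_mem_pending h1'.valid
        rw [← hn] at hm
        exact absurd hm (disjoint_left.1 (h1.siblings hσ h1' he).2.2 (h2.near_mem_pending h1.valid))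

/-- The deployment records only region and position. A state also keeps the near end of the gap,
which is what gets counted. -/
lemma exists_state_of_agent {p₀ : Plane} (hp : p₀ ∈ E.carrier) {R : Set Plane} {p : Plane}
    (h : RVSAgent E.carrier p₀ R p) : ∃ σ : AgentState, R = closure σ.inside ∧ p = σ.pos ∧
      (σ = E.rootState p₀ ∨ E.Descends (E.rootState p₀) σ) := by
  induction h with
  | base => exact ⟨E.rootState p₀, E.closure_interior.symm, rfl, Or.inl rfl⟩
  | @child R p a b h hg hd ih =>
    obtain ⟨σ, rfl, rfl, hσ⟩ := ih
    have hv : E.IsValid σ := by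
      rcases hσ with rfl | hσ
      · exact isValid_rootState hp
      · exact hσ.valid
    obtain ⟨C, hC⟩ := exists_isChild hv hg hd
    refine ⟨_, hC.closure_eq.symm, rfl, Or.inr ?_⟩
    rcases hσ with rfl | hσ
    · exact .single hC
    · exact hσ.tail hC

/-- Proper descendants of the root inject by their near ends into its pending vertices; the root
accounts for the extra one. -/
lemma finite_agents_and_ncard_le {p₀ : Plane} (hp : p₀ ∈ E.carrier) :
    (rvsAgents E.carrier p₀).Finite ∧
      (rvsAgents E.carrier p₀).ncard ≤ (E.pending (E.rootState p₀)).ncard + 1 := by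
  have hroot := isValid_rootState hp
  set S : Set AgentState := {τ | E.Descends (E.rootState p₀) τ}
  have hinj : InjOn AgentState.near S := fun τ hτ τ' hτ' hn => hτ.eq_of_near_eq hroot hτ' hn
  have hmaps : MapsTo AgentState.near S (E.pending (E.rootState p₀)) := fun τ hτ =>
    hτ.near_mem_pending hroot
  have hfin : S.Finite := (finite_pending _).of_injOn hmaps hinj
  have hcard : S.ncard ≤ (E.pending (E.rootState p₀)).ncard :=
    ncard_le_ncard_of_injOn _ hmaps hinj (finite_pending _)
  have hsub : rvsAgents E.carrier p₀ ⊆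
      (fun σ : AgentState => (closure σ.inside, σ.pos)) '' insert (E.rootState p₀) S := by
    rintro ⟨R, p⟩ hA
    obtain ⟨σ, hR, hp, hσ⟩ := exists_state_of_agent hp hA
    exact ⟨σ, hσ, Prod.ext hR.symm hp.symm⟩
  have hfin' := (hfin.insert (E.rootState p₀)).image
    (fun σ : AgentState => (closure σ.inside, σ.pos))
  refine ⟨hfin'.subset hsub, ?_⟩
  calc (rvsAgents E.carrier p₀).ncard ≤ _ := ncard_le_ncard hsub hfin'
    _ ≤ (insert (E.rootState p₀) S).ncard := ncard_image_le (hfin.insert _)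
    _ ≤ S.ncard + 1 := ncard_insert_le _ _
    _ ≤ _ := by omega

lemma ncard_pending_rootState_le (p₀ : Plane) :
    (E.pending (E.rootState p₀)).ncard ≤ E.numReflex := by
  have := E.neZero
  exact (ncard_le_ncard inter_subset_left ((toFinite _).image _)).trans (ncard_image_le (toFinite _))

/-- The degenerate segment `[p₀, p₀]` attached to the root removes its own position from the pending
vertices. -/
lemma ncard_pending_rootState_lt {i : ZMod n} (hi : E.IsReflex i) :
    (E.pending (E.rootState (E.vertex i))).ncard < E.numReflex := by
  have := E.neZero
  refine (ncard_lt_ncard ⟨inter_subset_left, fun hle => ?_⟩ ((toFinite _).image _)).trans_le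
    (ncard_image_le (toFinite _))
  exact near_notMem_pending (E.rootState (E.vertex i)) (hle ⟨i, hi, rfl⟩)

/-- As long as `x` is unseen it passes to the child across a gap, and the number of pending vertices
drops. -/
lemma exists_agent_seeing {p₀ : Plane} {x : Plane} {σ : AgentState} (hσ : E.IsValid σ)
    (hA : RVSAgent E.carrier p₀ (closure σ.inside) σ.pos) (hx : x ∈ σ.inside) :
    ∃ A ∈ rvsAgents E.carrier p₀, x ∈ visibilitySet E.carrier A.2 := by
  obtain ⟨N, hN⟩ : ∃ N, (E.pending σ).ncard = N := ⟨_, rfl⟩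
  induction N using Nat.strong_induction_on generalizing σ with
  | _ N ih =>
    by_cases hxV : x ∈ visibilitySet E.carrier σ.pos
    · exact ⟨(closure σ.inside, σ.pos), hA, hxV⟩
    · obtain ⟨a, b, hg, hd, hside⟩ := Region.exists_gap_of_unseen hσ hx hxV
      obtain ⟨C, hC⟩ := exists_isChild hσ hg hd
      obtain ⟨-, -, -, -, D, s, hs, hp⟩ := hC.exists_sides hσ
      refine ih _ ?_ hC.valid ?_ (hside _ _ _ hs hp) rfl
      · rw [← hN]
        exact ncard_lt_ncard ⟨hC.pending_subset hσ, fun hle =>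
          near_notMem_pending _ (hle (hC.near_mem_pending hσ))⟩ (finite_pending σ)
      · rw [hC.closure_eq]
        exact .child hA hg hd

/-- Every point of the environment is seen by an agent. -/
lemma exists_agent_seeing_of_mem {p₀ : Plane} (hp : p₀ ∈ E.carrier) {x : Plane}
    (hx : x ∈ E.carrier) :
    ∃ A ∈ rvsAgents E.carrier p₀, x ∈ visibilitySet E.carrier A.2 := by
  have hcl : IsClosed (⋃ A ∈ rvsAgents E.carrier p₀, visibilitySet E.carrier A.2) :=
    (finite_agents_and_ncard_le hp).1.isClosed_biUnion fun A _ =>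
      isClosed_visibilitySet E.isClosed A.2
  have hsub : E.carrier ⊆ ⋃ A ∈ rvsAgents E.carrier p₀, visibilitySet E.carrier A.2 := by
    nth_rw 1 [← E.closure_interior]
    refine closure_minimal (fun y hy => ?_) hcl
    obtain ⟨A, hA, hyA⟩ := exists_agent_seeing (σ := E.rootState p₀) (isValid_rootState hp)
      (by
        have : closure (E.rootState p₀).inside = E.carrier := E.closure_interior
        rw [this]
        exact .base) hy
    exact mem_biUnion hA hyA
  simpa using hsub hx

end PolygonalEnvironment

/-! ### Total turning of a closed polygon -/

/-- The oriented angle between two complex numbers. -/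
noncomputable def turnAngle (u v : ℂ) : ℝ := (v / u).arg

/-- The complex number `z` lies in the open half-plane around the direction `c`. -/
def InHalfPlane (c z : ℂ) : Prop := 0 < (z * (starRingEnd ℂ) c).re

/-- Measured from `c`, the arguments lie strictly between `-π / 2` and `π / 2`, so their difference
needs no correction by `2 * π`. Hence oriented angles add up within a half-plane. -/
lemma InHalfPlane.turnAngle_eq {c u v : ℂ} (hu : InHalfPlane c u) (hv : InHalfPlane c v) :
    turnAngle u v = (v * (starRingEnd ℂ) c).arg - (u * (starRingEnd ℂ) c).arg := by
  have hu' : 0 < (u * (starRingEnd ℂ) c).re := hu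
  have hv' : 0 < (v * (starRingEnd ℂ) c).re := hv
  have hc : (starRingEnd ℂ) c ≠ 0 := by rintro h; simp [h] at hu'
  have hu0 : u ≠ 0 := by rintro rfl; simp at hu'
  have hv0 : v ≠ 0 := by rintro rfl; simp at hv'
  have e : v / u = (v * (starRingEnd ℂ) c) * (u * (starRingEnd ℂ) c)⁻¹ := by
    field_simp
  have a1 := abs_lt.1 (Complex.abs_arg_lt_pi_div_two_iff.2 (Or.inl hu'))
  have a2 := abs_lt.1 (Complex.abs_arg_lt_pi_div_two_iff.2 (Or.inl hv'))
  have hinv : (u * (starRingEnd ℂ) c)⁻¹.arg = -(u * (starRingEnd ℂ) c).arg := by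
    rw [Complex.arg_inv, if_neg (by linarith [Real.pi_pos])]
  rw [turnAngle, e, Complex.arg_mul (mul_ne_zero hv0 hc) (inv_ne_zero (mul_ne_zero hu0 hc)), hinv]
  · ring
  · rw [hinv]
    constructor <;> linarith

lemma InHalfPlane.turnAngle_add {c u v w : ℂ} (hu : InHalfPlane c u) (hv : InHalfPlane c v)
    (hw : InHalfPlane c w) : turnAngle u v + turnAngle v w = turnAngle u w := by
  rw [hu.turnAngle_eq hv, hv.turnAngle_eq hw, hu.turnAngle_eq hw]; ring

lemma turnAngle_neg_neg (u v : ℂ) : turnAngle (-u) (-v) = turnAngle u v := by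
  rw [turnAngle, turnAngle, neg_div_neg_eq]

lemma turnAngle_pos {u v : ℂ} (h : 0 < (v * (starRingEnd ℂ) u).im) :
    0 < turnAngle u v ∧ turnAngle u v < Real.pi := by
  have hu : u ≠ 0 := by rintro rfl; simp at h
  have him : 0 < (v / u).im := by
    rw [div_eq_mul_inv, Complex.inv_def, ← mul_assoc, Complex.im_mul_ofReal]
    exact mul_pos h (inv_pos.2 (Complex.normSq_pos.2 hu))
  refine ⟨lt_of_le_of_ne (Complex.arg_nonneg_iff.2 him.le) fun h0 => ?_,
    Complex.arg_lt_pi_iff.2 (Or.inr him.ne')⟩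
  exact him.ne' (Complex.arg_eq_zero_iff.1 h0.symm).2

lemma turnAngle_neg {u v : ℂ} (h : (v * (starRingEnd ℂ) u).im < 0) :
    -Real.pi < turnAngle u v ∧ turnAngle u v < 0 := by
  have hu : u ≠ 0 := by rintro rfl; simp at h
  have him : (v / u).im < 0 := by
    rw [div_eq_mul_inv, Complex.inv_def, ← mul_assoc, Complex.im_mul_ofReal]
    exact mul_neg_of_neg_of_pos h (inv_pos.2 (Complex.normSq_pos.2 hu))
  exact ⟨Complex.neg_pi_lt_arg _, Complex.arg_neg_iff.2 him⟩

lemma turnAngle_eq_pi_div_two {u v : ℂ} (h0 : (v * (starRingEnd ℂ) u).re = 0)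
    (h : 0 < (v * (starRingEnd ℂ) u).im) : turnAngle u v = Real.pi / 2 := by
  have hu : u ≠ 0 := by rintro rfl; simp at h
  rw [turnAngle, Complex.arg_eq_pi_div_two_iff, div_eq_mul_inv, Complex.inv_def, ← mul_assoc,
    Complex.im_mul_ofReal, Complex.re_mul_ofReal, h0, zero_mul]
  exact ⟨rfl, mul_pos h (inv_pos.2 (Complex.normSq_pos.2 hu))⟩

lemma turnAngle_eq_neg_pi_div_two {u v : ℂ} (h0 : (v * (starRingEnd ℂ) u).re = 0)
    (h : (v * (starRingEnd ℂ) u).im < 0) : turnAngle u v = -(Real.pi / 2) := by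
  have hu : u ≠ 0 := by rintro rfl; simp at h
  rw [turnAngle, Complex.arg_eq_neg_pi_div_two_iff, div_eq_mul_inv, Complex.inv_def, ← mul_assoc,
    Complex.im_mul_ofReal, Complex.re_mul_ofReal, h0, zero_mul]
  exact ⟨rfl, mul_neg_of_neg_of_pos h (inv_pos.2 (Complex.normSq_pos.2 hu))⟩

lemma turnAngle_add_turnAngle_neg {u w : ℂ} (h : (w * (starRingEnd ℂ) u).im ≠ 0) :
    (0 < (-w * (starRingEnd ℂ) u).im ∧ turnAngle w u + turnAngle u (-w) = Real.pi) ∨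
    ((-w * (starRingEnd ℂ) u).im < 0 ∧ turnAngle w u + turnAngle u (-w) = -Real.pi) := by
  have hu : u ≠ 0 := by rintro rfl; simp at h
  have hn : 0 < (Complex.normSq u)⁻¹ := inv_pos.2 (Complex.normSq_pos.2 hu)
  have him : (w / u).im = (w * (starRingEnd ℂ) u).im * (Complex.normSq u)⁻¹ := by
    rw [div_eq_mul_inv, Complex.inv_def, ← mul_assoc, Complex.im_mul_ofReal]
  have hwu : turnAngle w u = -(w / u).arg := by
    rw [turnAngle, ← inv_div, Complex.arg_inv, if_neg]
    rw [Complex.arg_eq_pi_iff]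
    rintro ⟨-, h0⟩
    rw [him] at h0
    exact (mul_ne_zero h hn.ne') h0
  rw [hwu, turnAngle, neg_div, neg_mul, Complex.neg_im]
  rcases lt_or_gt_of_ne h with h | h
  · left
    refine ⟨by linarith, ?_⟩
    rw [Complex.arg_neg_eq_arg_add_pi_of_im_neg (by rw [him]; exact mul_neg_of_neg_of_pos h hn)]
    ring
  · right
    refine ⟨by linarith, ?_⟩
    rw [Complex.arg_neg_eq_arg_sub_pi_of_im_pos (by rw [him]; exact mul_pos h hn)]
    ring

/-- The total turning of a closed polygon, for which suitable differences of vertices lie in common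
half-planes, is `2 * π` or `-2 * π`. -/
lemma sum_turnAngle {w : ℕ → ℂ} {n : ℕ} (hn : 3 ≤ n) (hper : ∀ k, w (k + n) = w k)
    (hsq : ∀ i j, i + 1 < j → j < n → ¬ (i = 0 ∧ j + 1 = n) → ∃ c, InHalfPlane c (w j - w i) ∧
      InHalfPlane c (w (j + 1) - w i) ∧ InHalfPlane c (w j - w (i + 1)) ∧
      InHalfPlane c (w (j + 1) - w (i + 1)))
    (htri : ∀ i, ∃ c, InHalfPlane c (w (i + 1) - w i) ∧ InHalfPlane c (w (i + 2) - w i) ∧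
      InHalfPlane c (w (i + 2) - w (i + 1)))
    (hbase : ∃ c, ∀ j, 0 < j → j < n → InHalfPlane c (w j - w 0))
    (hcorner : ((w 1 - w 0) * (starRingEnd ℂ) (w n - w (n - 1))).im ≠ 0) :
    ∃ s : ℝ, (s = 1 ∨ s = -1) ∧
      ∑ i ∈ Finset.range n, turnAngle (w (i + 1) - w i) (w (i + 2) - w (i + 1)) =
        s * (2 * Real.pi) ∧
      0 < s * ((w 1 - w 0) * (starRingEnd ℂ) (w n - w (n - 1))).im := by
  obtain ⟨N, rfl⟩ : ∃ N, n = N + 3 := ⟨n - 3, by omega⟩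
  obtain ⟨cb, hb⟩ := hbase
  -- Hopf's argument on the grid of secants `w j - w i`: the angle change around a unit square
  -- vanishes. The square at `i = 0`, `j = n - 1` is excluded, since it contains the zero secant `w
  -- n - w 0`.
  have hsquare : ∀ i j, i + 1 < j → j < N + 3 → ¬ (i = 0 ∧ j + 1 = N + 3) →
      turnAngle (w j - w i) (w j - w (i + 1)) + turnAngle (w j - w (i + 1)) (w (j + 1) - w (i + 1)) =
      turnAngle (w j - w i) (w (j + 1) - w i) +
        turnAngle (w (j + 1) - w i) (w (j + 1) - w (i + 1)) := by
    intro i j h1 h2 h3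
    obtain ⟨c, ha, hb, hc, hd⟩ := hsq i j h1 h2 h3
    rw [ha.turnAngle_add hc hd, ha.turnAngle_add hb hd]
  have htriangle : ∀ i, turnAngle (w (i + 1) - w i) (w (i + 2) - w (i + 1)) =
      turnAngle (w (i + 1) - w i) (w (i + 2) - w i) +
        turnAngle (w (i + 2) - w i) (w (i + 2) - w (i + 1)) := by
    intro i
    obtain ⟨c, ha, hb, hc⟩ := htri i
    rw [ha.turnAngle_add hb hc]
  -- column sums
  have hcol : ∀ a j l, a + l + 1 < j + 1 → j < N + 3 → ¬ (a = 0 ∧ j + 1 = N + 3) →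
      ∑ i ∈ Finset.range l, turnAngle (w j - w (a + i)) (w j - w (a + i + 1)) +
        turnAngle (w j - w (a + l)) (w (j + 1) - w (a + l)) =
      turnAngle (w j - w a) (w (j + 1) - w a) +
        ∑ i ∈ Finset.range l, turnAngle (w (j + 1) - w (a + i)) (w (j + 1) - w (a + i + 1)) := by
    intro a j l
    induction l with
    | zero => intros; simp
    | succ l ih =>
      intro h1 h2 h3
      have h4 := ih (by omega) h2 h3
      have h5 := hsquare (a + l) j (by omega) h2 (by omega)
      rw [Finset.sum_range_succ, Finset.sum_range_succ, ← add_assoc a l 1]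
      linarith
  -- The turning along the diagonal equals the change along secants that start at `w 0`, followed by
  -- the change along secants that end at `w (k + 1)`.
  have hstair : ∀ k, k < N + 2 →
      ∑ i ∈ Finset.range k, turnAngle (w (i + 1) - w i) (w (i + 2) - w (i + 1)) =
      turnAngle (w 1 - w 0) (w (k + 1) - w 0) +
        ∑ i ∈ Finset.range k, turnAngle (w (k + 1) - w i) (w (k + 1) - w (i + 1)) := by
    intro k
    induction k with
    | zero =>
      intro _
      have h1 := hb 1 (by omega) (by omega)
      simp [h1.turnAngle_eq h1]
    | succ k ih =>
      intro hk
      have h1 := ih (by omega)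
      have h2 := hcol 0 (k + 1) k (by omega) (by omega) (by omega)
      simp only [zero_add] at h2
      have h3 := (hb 1 (by omega) (by omega)).turnAngle_add (hb (k + 1) (by omega) (by omega))
        (hb (k + 1 + 1) (by omega) (by omega))
      rw [Finset.sum_range_succ, Finset.sum_range_succ, h1, htriangle k]
      linarith
  have hw0 : w (N + 3) = w 0 := by simpa using hper 0
  have hw1 : w (N + 3 + 1) = w 1 := by
    rw [← hper 1]; congr 1; omega
  -- Secants that end at `w n = w 0` are the negatives of those that start at `w 0`, so they turn by
  -- the same angles.
  have hlast : ∀ k, k < N + 2 →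
      ∑ i ∈ Finset.range k, turnAngle (w (N + 3) - w (1 + i)) (w (N + 3) - w (1 + i + 1)) =
      turnAngle (w 1 - w 0) (w (k + 1) - w 0) := by
    intro k
    induction k with
    | zero =>
      intro _
      have h1 := hb 1 (by omega) (by omega)
      simp [h1.turnAngle_eq h1]
    | succ k ih =>
      intro hk
      rw [Finset.sum_range_succ, ih (by omega), hw0, ← turnAngle_neg_neg (w 0 - _), neg_sub, neg_sub,
        add_comm 1 k]
      exact (hb 1 (by omega) (by omega)).turnAngle_add (hb (k + 1) (by omega) (by omega))
        (hb (k + 1 + 1) (by omega) (by omega))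
  have hN : N + 3 - 1 = N + 2 := by omega
  rw [hN] at hcorner ⊢
  set u := w (N + 2) - w 0 with hu
  set v := w 1 - w 0 with hv
  have hu' : w (N + 3) - w (N + 2) = -u := by rw [hw0, hu]; ring
  have hv' : w (N + 3) - w 1 = -v := by rw [hw0, hv]; ring
  have e1 : ∑ i ∈ Finset.range (N + 1), turnAngle (w (i + 1) - w i) (w (i + 2) - w (i + 1)) =
      turnAngle v u +
        ∑ i ∈ Finset.range (N + 1), turnAngle (w (N + 2) - w i) (w (N + 2) - w (i + 1)) :=
    hstair (N + 1) (by omega)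
  rw [Finset.sum_range_succ' (fun i => turnAngle (w (N + 2) - w i) (w (N + 2) - w (i + 1)))] at e1
  have e2 : ∑ i ∈ Finset.range N, turnAngle (w (N + 2) - w (1 + i)) (w (N + 2) - w (1 + i + 1)) +
        turnAngle (w (N + 2) - w (1 + N)) (w (N + 3) - w (1 + N)) =
      turnAngle (w (N + 2) - w 1) (w (N + 3) - w 1) +
        ∑ i ∈ Finset.range N, turnAngle (w (N + 3) - w (1 + i)) (w (N + 3) - w (1 + i + 1)) :=
    hcol 1 (N + 2) N (by omega) (by omega) (by omega)
  have e3 : ∑ i ∈ Finset.range (N + 1),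
      turnAngle (w (N + 3) - w (1 + i)) (w (N + 3) - w (1 + i + 1)) = turnAngle v u :=
    hlast (N + 1) (by omega)
  rw [Finset.sum_range_succ] at e3
  simp only [add_comm 1, hv'] at e2 e3
  have e4 : turnAngle (w (N + 2) - w (N + 1)) (w (N + 3) - w (N + 2)) =
      turnAngle (w (N + 2) - w (N + 1)) (w (N + 3) - w (N + 1)) +
        turnAngle (w (N + 3) - w (N + 1)) (w (N + 3) - w (N + 2)) := htriangle (N + 1)
  -- The triangle of `w (n - 1)`, `w 0`, `w 1` leads the path round the excluded corner of the grid.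
  have e5 : turnAngle u (w (N + 2) - w 1) + turnAngle (w (N + 2) - w 1) (-v) = turnAngle u (-v) := by
    obtain ⟨c, ha, hb, hc⟩ := htri (N + 2)
    have hneg : ∀ z, InHalfPlane c z → InHalfPlane (-c) (-z) := by
      intro z hz
      rwa [InHalfPlane, map_neg, neg_mul_neg]
    have ha' := hneg _ ha
    have hb' := hneg _ hb
    have hc' := hneg _ hc
    have i1 : -(w (N + 2 + 1) - w (N + 2)) = u := by rw [hu']; ring
    have i2 : -(w (N + 2 + 2) - w (N + 2)) = w (N + 2) - w 1 := by
      rw [show N + 2 + 2 = N + 3 + 1 by omega, hw1]; ring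
    have i3 : -(w (N + 2 + 2) - w (N + 2 + 1)) = -v := by
      rw [show N + 2 + 2 = N + 3 + 1 by omega, hw1, show N + 2 + 1 = N + 3 by omega, hw0]
    rw [i1] at ha'
    rw [i2] at hb'
    rw [i3] at hc'
    exact ha'.turnAngle_add hb' hc'
  have e6 : turnAngle (w (N + 2 + 1) - w (N + 2)) (w (N + 2 + 2) - w (N + 2 + 1)) =
      turnAngle u (-v) := by
    rw [show N + 2 + 2 = N + 3 + 1 by omega, hw1, show N + 2 + 1 = N + 3 by omega, hu', hw0, ← hv,
      ← turnAngle_neg_neg, neg_neg]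
  -- The path of secants goes from `v` through `u` to `-v` and then through `-u` back to `v`: two
  -- half turns in the same sense.
  have key : ∑ i ∈ Finset.range (N + 3), turnAngle (w (i + 1) - w i) (w (i + 2) - w (i + 1)) =
      2 * (turnAngle v u + turnAngle u (-v)) := by
    have e7 : turnAngle (w (N + 1 + 1) - w (N + 1)) (w (N + 1 + 2) - w (N + 1 + 1)) =
        turnAngle (w (N + 2) - w (N + 1)) (w (N + 3) - w (N + 2)) := rfl
    have e8 : turnAngle (w (N + 3) - w (N + 1)) (w (N + 3) - w (N + 1 + 1)) =
        turnAngle (w (N + 3) - w (N + 1)) (w (N + 3) - w (N + 2)) := rfl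
    have e9 : turnAngle (w (N + 2) - w 0) (w (N + 2) - w (0 + 1)) =
        turnAngle u (w (N + 2) - w 1) := rfl
    rw [Finset.sum_range_succ, Finset.sum_range_succ, e6, e7]
    linarith
  have him : (v * (starRingEnd ℂ) u).im ≠ 0 := by
    rw [hu', map_neg, mul_neg, Complex.neg_im] at hcorner
    exact neg_ne_zero.1 hcorner
  rw [key, hu', map_neg, mul_neg, ← neg_mul]
  rcases turnAngle_add_turnAngle_neg him with ⟨h1, h2⟩ | ⟨h1, h2⟩
  · refine ⟨1, Or.inl rfl, by rw [h2]; ring, ?_⟩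
    linarith
  · refine ⟨-1, Or.inr rfl, by rw [h2]; ring, ?_⟩
    linarith

lemma exists_inHalfPlane (f : StrongDual ℝ Plane) :
    ∃ c, ∀ z, 0 < f z → InHalfPlane c (toComplex z) := by
  refine ⟨⟨f !₂[1, 0], f !₂[0, 1]⟩, fun z hz => ?_⟩
  have h : z = z 0 • (!₂[1, 0] : Plane) + z 1 • (!₂[0, 1] : Plane) := by
    apply Plane.ext' <;> simp
  have : f z = z 0 * f !₂[1, 0] + z 1 * f !₂[0, 1] := by
    conv_lhs => rw [h]
    simp only [map_add, map_smul, smul_eq_mul]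
  rw [this] at hz
  simpa [InHalfPlane, toComplex] using hz

lemma exists_dual_pos_of_wedge_ne_zero {u v : Plane} (h : wedge u v ≠ 0) :
    ∃ f : StrongDual ℝ Plane, 0 < f u ∧ 0 < f v := by
  have h0 : (0 : Plane) ∉ segment ℝ u v := by
    intro hs
    have := wedge_sub_eq_zero_of_mem_segment hs
    rw [zero_sub, wedge_neg_right, wedge_sub_left, wedge_self, wedge_swap] at this
    simp at this
    exact h this
  obtain ⟨f, r, hr, hf⟩ := geometric_hahn_banach_point_closed (convex_segment u v)
    (isClosed_segment u v) h0
  rw [map_zero] at hr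
  exact ⟨f, hr.trans (hf u (left_mem_segment _ _ _)), hr.trans (hf v (right_mem_segment _ _ _))⟩

lemma re_toComplex_mul_conj (u v : Plane) :
    (toComplex v * (starRingEnd ℂ) (toComplex u)).re = inner ℝ u v := by
  simp [toComplex, PiLp.inner_apply, Fin.sum_univ_two]

/-! ### Extreme vertices and the total turning of the boundary -/

namespace PolygonalEnvironment

variable {n : ℕ} (E : PolygonalEnvironment n)

lemma vertex_injective : Function.Injective E.vertex := by
  intro i j h
  have h1 : E.vertex i ∈ E.edge (i - 1) := by
    rw [edge, sub_add_cancel]; exact right_mem_segment _ _ _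
  have h2 : E.vertex (i - 1 + 1) ∈ E.edge j := by
    rw [sub_add_cancel, h]; exact left_mem_segment _ _ _
  rcases E.vertex_mem_edge h2 with h3 | h3
  · exfalso
    subst h3
    apply E.dir_ne_zero (i - 1)
    rw [dir, sub_add_cancel, ← h, sub_self]
  · rw [h3]; ring

lemma exists_mem_frontier_of_ray {x d : Plane} (hx : x ∈ E.carrier) (hd : d ≠ 0) :
    ∃ t : ℝ, 0 ≤ t ∧ x + t • d ∈ frontier E.carrier := by
  obtain ⟨M, hM⟩ := E.isCompact.isBounded.subset_closedBall x
  have hn : 0 < ‖d‖ := norm_pos_iff.2 hd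
  have hM0 : 0 ≤ M := dist_nonneg.trans (mem_closedBall.1 (hM hx))
  have hfar : x + ((M + 1) / ‖d‖) • d ∉ E.carrier := by
    intro h
    have h1 := mem_closedBall.1 (hM h)
    rw [dist_self_add_left, norm_smul, Real.norm_of_nonneg (by positivity),
      div_mul_cancel₀ _ hn.ne'] at h1
    linarith
  by_contra hno
  push Not at hno
  rcases (isPreconnected_segment x (x + ((M + 1) / ‖d‖) • d)).subset_interior_or_subset_compl
    (E := E.carrier) (by
      rw [disjoint_left]
      intro y hy
      obtain ⟨t, h0, -, rfl⟩ := mem_segment_iff.1 hy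
      rw [add_sub_cancel_left, smul_smul]
      exact hno _ (by positivity)) with h | h
  · exact hfar (interior_subset (h (right_mem_segment _ _ _)))
  · exact h (left_mem_segment _ _ _) (subset_closure hx)

/-- A vertex of maximal norm is strictly extreme. -/
lemma inner_lt_of_norm_le {i j : ZMod n} (h : ∀ j, ‖E.vertex j‖ ≤ ‖E.vertex i‖) (hij : j ≠ i) :
    inner ℝ (E.vertex i) (E.vertex j) < inner ℝ (E.vertex i) (E.vertex i) := by
  have h1 : 0 < ‖E.vertex i - E.vertex j‖ :=
    norm_pos_iff.2 (sub_ne_zero.2 fun he => hij (E.vertex_injective he).symm)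
  have h2 := norm_sub_sq_real (E.vertex i) (E.vertex j)
  have h3 : 0 < ‖E.vertex i - E.vertex j‖ ^ 2 := by positivity
  have h4 : ‖E.vertex j‖ ^ 2 ≤ ‖E.vertex i‖ ^ 2 := by gcongr; exact h j
  rw [real_inner_self_eq_norm_sq]
  linarith

/-- At a reflex corner the direction `dir i - dir (i + 1)` stays in the environment, but at this
vertex it points beyond the supporting line. A ray outwards from there must meet the boundary, every
point of which is on an edge and so not beyond that line. -/
lemma isConvexCorner_of_norm_le {i : ZMod n} (h : ∀ j, ‖E.vertex j‖ ≤ ‖E.vertex (i + 1)‖) :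
    E.IsConvexCorner i := by
  rcases E.isConvexCorner_or_isReflexCorner i with hc | ⟨ε, hε, hr⟩
  · exact hc
  exfalso
  have hK := E.wedge_dir_ne_zero i
  have hK2 : 0 < wedge (E.dir i) (E.dir (i + 1)) ^ 2 := by positivity
  have hne : E.dir i - E.dir (i + 1) ≠ 0 := by
    intro h0
    rw [sub_eq_zero] at h0
    rw [← h0, wedge_self] at hK
    exact hK rfl
  have hi : i ≠ i + 1 := by
    intro he
    apply E.dir_ne_zero i
    rw [dir, ← he, sub_self]
  have hi' : i + 1 + 1 ≠ i + 1 := by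
    intro he
    apply E.dir_ne_zero (i + 1)
    rw [dir, he, sub_self]
  have h1 := E.inner_lt_of_norm_le h hi
  have h2 := E.inner_lt_of_norm_le h hi'
  have hv0 : E.vertex (i + 1) ≠ 0 := by
    intro h0
    rw [h0] at h1
    simp at h1
  obtain ⟨η, hη, hb⟩ := add_smul_mem_ball (z := E.vertex (i + 1)) hne hε
  have hq := hb η (by rw [abs_of_pos hη])
  have hqE := (hr _ hq).1.2 (Or.inl (by
    rw [add_sub_cancel_left, wedge_smul_right, wedge_sub_right, wedge_self]
    have := mul_pos hη hK2
    linarith))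
  obtain ⟨t, ht, hF⟩ := E.exists_mem_frontier_of_ray hqE hv0
  obtain ⟨j, hj⟩ := E.mem_frontier_iff.1 hF
  obtain ⟨θ, h0, h1', hθ⟩ := mem_segment_iff.1 hj
  have hle : ∀ j, inner ℝ (E.vertex (i + 1)) (E.vertex j) ≤
      inner ℝ (E.vertex (i + 1)) (E.vertex (i + 1)) := by
    intro j
    by_cases he : j = i + 1
    · rw [he]
    · exact (E.inner_lt_of_norm_le h he).le
  have e1 := congrArg (fun z => inner ℝ (E.vertex (i + 1)) z) hθ
  simp only [dir, inner_add_right, inner_smul_right, inner_sub_right] at e1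
  have a1 := hle j
  have a2 := hle (j + 1)
  have a3 : 0 ≤ t * inner ℝ (E.vertex (i + 1)) (E.vertex (i + 1)) :=
    mul_nonneg ht real_inner_self_nonneg
  set A := inner ℝ (E.vertex (i + 1)) (E.vertex (i + 1))
  have a4 : 0 < η * (A - inner ℝ (E.vertex (i + 1)) (E.vertex i) -
      (inner ℝ (E.vertex (i + 1)) (E.vertex (i + 1 + 1)) - A)) := mul_pos hη (by linarith)
  have a5 := mul_nonneg h0 (sub_nonneg.2 a2)
  have a6 := mul_nonneg (sub_nonneg.2 h1') (sub_nonneg.2 a1)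
  linarith

/-- The turning angle of the boundary at the vertex `i + 1`. -/
noncomputable def turn (i : ZMod n) : ℝ :=
  turnAngle (toComplex (E.dir i)) (toComplex (E.dir (i + 1)))

lemma sum_range_natCast [NeZero n] (f : ZMod n → ℝ) (i₀ : ZMod n) :
    ∑ k ∈ Finset.range n, f (i₀ + k) = ∑ i, f i := by
  rw [← Equiv.sum_comp (Equiv.addLeft i₀) f]
  refine Finset.sum_bij (fun k _ => (k : ZMod n)) (fun _ _ => Finset.mem_univ _) ?_ ?_
    (fun _ _ => rfl)
  · intro a ha b hb hab
    rw [ZMod.natCast_eq_natCast_iff'] at hab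
    rwa [Nat.mod_eq_of_lt (Finset.mem_range.1 ha), Nat.mod_eq_of_lt (Finset.mem_range.1 hb)] at hab
  · intro b _
    exact ⟨b.val, Finset.mem_range.2 (ZMod.val_lt b), ZMod.natCast_zmod_val b⟩

lemma natCast_ne {i j : ℕ} (hi : i < n) (hj : j < n) (h : i ≠ j) : (i : ZMod n) ≠ j := by
  rw [Ne, ZMod.natCast_eq_natCast_iff', Nat.mod_eq_of_lt hi, Nat.mod_eq_of_lt hj]
  exact h

/-- The boundary makes one full turn, in the direction of its convex corners. -/
lemma exists_turning [NeZero n] : ∃ s : ℝ, (s = 1 ∨ s = -1) ∧ ∑ i, s * E.turn i = 2 * Real.pi ∧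
    ∀ i, (E.IsConvexCorner i → 0 < s * wedge (E.dir i) (E.dir (i + 1))) ∧
      (E.IsReflexCorner i → s * wedge (E.dir i) (E.dir (i + 1)) < 0) := by
  -- Starting at a vertex of maximal norm puts all secants from it in one half-plane.
  obtain ⟨i₀, hmax⟩ := Finite.exists_max fun i => ‖E.vertex i‖
  have hn := E.three_le
  have hcast : ∀ (k m : ℕ), i₀ + ((k + m : ℕ) : ZMod n) = i₀ + (k : ZMod n) + (m : ZMod n) := by
    intro k m; push_cast; ring
  obtain ⟨σ, hσ, hsum, hcor⟩ := sum_turnAngle (w := fun k => toComplex (E.vertex (i₀ + (k : ZMod n))))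
    hn (fun k => by simp) (by
      intro i j hij hj hne
      have hdis := E.edges_disjoint (i₀ + i) (i₀ + j)
        (by
          rw [Ne, add_right_inj]
          exact natCast_ne hj (by omega) (by omega))
        (by
          rw [add_assoc, Ne, add_right_inj]
          exact_mod_cast natCast_ne (n := n) (i := j) (j := i + 1) hj (by omega) (by omega))
        (by
          rw [add_assoc, Ne, add_right_inj]
          by_cases h : j + 1 = n
          · have h1 : (j : ZMod n) + 1 = ((0 : ℕ) : ZMod n) := by
              rw [← Nat.cast_succ, Nat.succ_eq_add_one, h]; simp
            rw [h1]
            exact natCast_ne (by omega) (by omega) (by omega)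
          · exact_mod_cast natCast_ne (n := n) (i := i) (j := j + 1) (by omega) (by omega)
              (by omega))
      -- Disjoint edges are strictly separated by a functional, and it is positive on all four
      -- differences of their ends.
      obtain ⟨f, a, b, ha, hab, hb⟩ := geometric_hahn_banach_compact_closed (convex_segment _ _)
        (isCompact_segment _ _) (convex_segment _ _) (isClosed_segment _ _) hdis
      obtain ⟨c, hc⟩ := exists_inHalfPlane f
      have key : ∀ {x y : Plane}, x ∈ segment ℝ (E.vertex (i₀ + i)) (E.vertex (i₀ + i + 1)) →
          y ∈ segment ℝ (E.vertex (i₀ + j)) (E.vertex (i₀ + j + 1)) →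
          InHalfPlane c (toComplex y - toComplex x) := by
        intro x y hx hy
        rw [← toComplex_sub]
        apply hc
        rw [map_sub]
        linarith [ha x hx, hb y hy]
      simp only [Nat.cast_add, Nat.cast_one, ← add_assoc]
      exact ⟨c, key (left_mem_segment _ _ _) (left_mem_segment _ _ _),
        key (left_mem_segment _ _ _) (right_mem_segment _ _ _),
        key (right_mem_segment _ _ _) (left_mem_segment _ _ _),
        key (right_mem_segment _ _ _) (right_mem_segment _ _ _)⟩) (by
      intro i
      obtain ⟨f, h1, h2⟩ := exists_dual_pos_of_wedge_ne_zero (E.wedge_dir_ne_zero (i₀ + i))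
      obtain ⟨c, hc⟩ := exists_inHalfPlane f
      have e : i₀ + ((i + 2 : ℕ) : ZMod n) = i₀ + (i : ZMod n) + 1 + 1 := by push_cast; ring
      have e' : i₀ + ((i + 1 : ℕ) : ZMod n) = i₀ + (i : ZMod n) + 1 := by push_cast; ring
      simp only [e, e', ← toComplex_sub]
      refine ⟨c, hc _ h1, hc _ ?_, hc _ h2⟩
      rw [← sub_add_sub_cancel _ (E.vertex (i₀ + i + 1)), map_add]
      exact add_pos h2 h1) (by
      obtain ⟨c, hc⟩ := exists_inHalfPlane (innerSL ℝ (-E.vertex i₀))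
      refine ⟨c, fun j h0 hj => ?_⟩
      have hne : i₀ + (j : ZMod n) ≠ i₀ := by
        rw [Ne, add_eq_left]
        exact_mod_cast natCast_ne (n := n) hj (j := 0) (by omega) (by omega)
      have := E.inner_lt_of_norm_le hmax hne
      simp only [Nat.cast_zero, add_zero, ← toComplex_sub]
      apply hc
      rw [innerSL_apply_apply, inner_neg_left, inner_sub_right]
      linarith) (by
      have e : i₀ + ((n - 1 : ℕ) : ZMod n) = i₀ - 1 := by
        rw [Nat.cast_sub (by omega)]; simp [sub_eq_add_neg]
      simp only [e, ← toComplex_sub, im_toComplex_mul_conj, Nat.cast_zero, add_zero, Nat.cast_one,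
        CharP.cast_eq_zero]
      have := E.wedge_dir_ne_zero (i₀ - 1)
      simpa [dir] using this)
  obtain ⟨s, hs, hor⟩ := E.exists_orientation
  have hturn : ∑ k ∈ Finset.range n, E.turn (i₀ + k) = σ * (2 * Real.pi) := by
    rw [← hsum]
    refine Finset.sum_congr rfl fun k _ => ?_
    simp only [turn, dir, toComplex_sub, Nat.cast_add, Nat.cast_one, Nat.cast_ofNat]
    rw [show i₀ + ((k : ZMod n) + 2) = i₀ + k + 1 + 1 by ring,
      show i₀ + ((k : ZMod n) + 1) = i₀ + k + 1 by ring]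
  rw [sum_range_natCast] at hturn
  -- The corner at the extreme vertex is convex; comparing its sign in both descriptions identifies
  -- the sense of turning with the orientation.
  have hconv : E.IsConvexCorner (i₀ - 1) := E.isConvexCorner_of_norm_le (by simpa using hmax)
  have h1 := (hor _).1 hconv
  have h2 : 0 < σ * wedge (E.dir (i₀ - 1)) (E.dir (i₀ - 1 + 1)) := by
    have e : i₀ + ((n - 1 : ℕ) : ZMod n) = i₀ - 1 := by
      rw [Nat.cast_sub (by omega)]; simp [sub_eq_add_neg]
    simp only [e, ← toComplex_sub, im_toComplex_mul_conj, Nat.cast_zero, add_zero, Nat.cast_one,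
        CharP.cast_eq_zero] at hcor
    simpa [dir] using hcor
  have hσs : s = σ := by
    rcases hs with rfl | rfl <;> rcases hσ with rfl | rfl <;> first | rfl | (exfalso; linarith)
  refine ⟨s, hs, ?_, hor⟩
  rw [← Finset.mul_sum, hturn, ← hσs, ← mul_assoc]
  rcases hs with rfl | rfl <;> norm_num

end PolygonalEnvironment

/-! ### Counting corners, and the theorem -/

namespace PolygonalEnvironment

variable {n : ℕ} (E : PolygonalEnvironment n)

lemma mul_turn_lt_pi {s : ℝ} (hs : s = 1 ∨ s = -1) (i : ZMod n) : s * E.turn i < Real.pi := by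
  have h := E.wedge_dir_ne_zero i
  rw [← im_toComplex_mul_conj] at h
  rcases lt_or_gt_of_ne h with h | h
  · have := turnAngle_neg h
    rcases hs with rfl | rfl <;> rw [turn] <;> linarith [Real.pi_pos]
  · have := turnAngle_pos h
    rcases hs with rfl | rfl <;> rw [turn] <;> linarith [Real.pi_pos]

lemma mul_turn_neg {s : ℝ} (hs : s = 1 ∨ s = -1) {i : ZMod n}
    (h : s * wedge (E.dir i) (E.dir (i + 1)) < 0) : s * E.turn i < 0 := by
  rw [← im_toComplex_mul_conj] at h
  rcases hs with rfl | rfl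
  · rw [one_mul] at h ⊢
    exact (turnAngle_neg h).2
  · have := (turnAngle_pos (u := toComplex (E.dir i)) (v := toComplex (E.dir (i + 1)))
      (by linarith)).1
    rw [turn]
    linarith

lemma IsOrthogonal.mul_turn_eq {E : PolygonalEnvironment n} (ho : E.IsOrthogonal) {s : ℝ}
    (hs : s = 1 ∨ s = -1) (i : ZMod n) :
    (0 < s * wedge (E.dir i) (E.dir (i + 1)) → s * E.turn i = Real.pi / 2) ∧
    (s * wedge (E.dir i) (E.dir (i + 1)) < 0 → s * E.turn i = -(Real.pi / 2)) := by
  have h0 := (re_toComplex_mul_conj (E.dir i) (E.dir (i + 1))).trans (ho i)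
  rw [← im_toComplex_mul_conj, turn]
  rcases hs with rfl | rfl
  · simp only [one_mul]
    exact ⟨turnAngle_eq_pi_div_two h0, turnAngle_eq_neg_pi_div_two h0⟩
  · simp only [neg_mul, one_mul, Left.neg_pos_iff, Left.neg_neg_iff]
    exact ⟨fun h => by rw [turnAngle_eq_neg_pi_div_two h0 h, neg_neg],
      fun h => by rw [turnAngle_eq_pi_div_two h0 h]⟩

open scoped Classical in
lemma numReflex_eq_card [NeZero n] :
    E.numReflex = (Finset.univ.filter fun i => E.IsReflexCorner i).card := by
  rw [numReflex, ← Set.ncard_coe_finset]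
  symm
  refine Set.ncard_congr (fun i _ => i + 1) ?_ ?_ ?_
  · intro i hi
    exact (E.isReflexCorner_iff i).1 (by simpa using hi)
  · intro i j _ _ h
    exact add_right_cancel h
  · intro i hi
    exact ⟨i - 1, by simpa [isReflexCorner_iff] using hi, by ring⟩

lemma isConvexCorner_iff (i : ZMod n) : E.IsConvexCorner i ↔ ¬ E.IsReflexCorner i :=
  ⟨fun h h' => h.not_isReflex ((E.isReflexCorner_iff i).1 h'),
    fun h => (E.isConvexCorner_or_isReflexCorner i).resolve_right h⟩

open scoped Classical in
lemma sum_ite_isReflexCorner [NeZero n] (a b : ℝ) :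
    ∑ i, (if E.IsReflexCorner i then a else b) = E.numReflex * a + (n - E.numReflex) * b := by
  rw [Finset.sum_ite, Finset.sum_const, Finset.sum_const, nsmul_eq_mul, nsmul_eq_mul,
    ← numReflex_eq_card]
  congr 2
  rw [eq_sub_iff_add_eq, numReflex_eq_card]
  have := Finset.card_filter_add_card_filter_not (s := (Finset.univ : Finset (ZMod n)))
    (fun i => E.IsReflexCorner i)
  rw [Finset.card_univ, ZMod.card] at this
  rw [add_comm]
  exact_mod_cast this

/-- A polygon has at least three convex corners. -/
lemma numReflex_add_three_le : E.numReflex + 3 ≤ n := by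
  classical
  have := E.neZero
  obtain ⟨s, hs, hsum, hor⟩ := E.exists_turning
  by_contra! hlt
  -- Thus `2 * π < (n - r) * π`, which leaves more than two convex corners.
  have hle : ∑ i, s * E.turn i < ∑ i, (if E.IsReflexCorner i then 0 else Real.pi) := by
    refine Finset.sum_lt_sum_of_nonempty Finset.univ_nonempty fun i _ => ?_
    split_ifs with h
    · exact E.mul_turn_neg hs ((hor i).2 h)
    · exact E.mul_turn_lt_pi hs i
  rw [hsum, sum_ite_isReflexCorner, mul_zero, zero_add] at hle
  have h2 : (n : ℝ) ≤ E.numReflex + 2 := by exact_mod_cast Nat.lt_succ_iff.1 hlt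
  nlinarith [Real.pi_pos]

/-- Every turn is a quarter turn, so `2 * π = (n - r) * (π / 2) - r * (π / 2)`. -/
lemma IsOrthogonal.eq_two_mul_numReflex_add_four {E : PolygonalEnvironment n}
    (ho : E.IsOrthogonal) : n = 2 * E.numReflex + 4 := by
  classical
  have := E.neZero
  obtain ⟨s, hs, hsum, hor⟩ := E.exists_turning
  have heq : ∑ i, s * E.turn i =
      ∑ i, (if E.IsReflexCorner i then -(Real.pi / 2) else Real.pi / 2) := by
    refine Finset.sum_congr rfl fun i _ => ?_
    split_ifs with h
    · exact (ho.mul_turn_eq hs i).2 ((hor i).2 h)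
    · exact (ho.mul_turn_eq hs i).1 ((hor i).1 ((E.isConvexCorner_iff i).2 h))
  rw [hsum, sum_ite_isReflexCorner] at heq
  have h2 : Real.pi * ((n : ℝ) - (2 * E.numReflex + 4)) = 0 := by linarith
  have h3 := (mul_eq_zero.1 h2).resolve_left Real.pi_ne_zero
  exact_mod_cast sub_eq_zero.1 h3

end PolygonalEnvironment

theorem mainTheorem7 {n : ℕ} (E : PolygonalEnvironment n) :
    (∀ p₀ ∈ E.carrier,
      (rvsAgents E.carrier p₀).Finite ∧
      (rvsAgents E.carrier p₀).ncard ≤ E.numReflex + 1 ∧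
      (∀ x ∈ E.carrier, ∃ A ∈ rvsAgents E.carrier p₀, x ∈ visibilitySet E.carrier A.2)) ∧
    E.numReflex + 1 ≤ n - 2 ∧
    (E.IsOrthogonal →
      (∀ p₀ ∈ E.carrier, ((rvsAgents E.carrier p₀).ncard : ℝ) ≤ (n : ℝ) / 2 - 1) ∧
      (∀ i, E.IsReflex i →
        ((rvsAgents E.carrier (E.vertex i)).ncard : ℝ) ≤ (n : ℝ) / 2 - 2) ∧
      (n ≠ 4 → ∃ i, E.IsReflex i)) := by
  have hle : ∀ p₀ ∈ E.carrier, (rvsAgents E.carrier p₀).ncard ≤ E.numReflex + 1 := fun p₀ hp =>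
    (E.finite_agents_and_ncard_le hp).2.trans
      (Nat.add_le_add_right (E.ncard_pending_rootState_le p₀) 1)
  refine ⟨fun p₀ hp => ⟨(E.finite_agents_and_ncard_le hp).1, hle p₀ hp,
    fun x hx => E.exists_agent_seeing_of_mem hp hx⟩, ?_, fun ho => ?_⟩
  · have := E.numReflex_add_three_le
    omega
  · have hn := ho.eq_two_mul_numReflex_add_four
    have hn' : (n : ℝ) = 2 * E.numReflex + 4 := by exact_mod_cast hn
    refine ⟨fun p₀ hp => ?_, fun i hi => ?_, fun h4 => ?_⟩
    · have : ((rvsAgents E.carrier p₀).ncard : ℝ) ≤ E.numReflex + 1 := by exact_mod_cast hle p₀ hp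
      linarith
    · have h1 : (rvsAgents E.carrier (E.vertex i)).ncard ≤ E.numReflex :=
        (E.finite_agents_and_ncard_le (E.frontier_subset (E.vertex_mem_frontier i))).2.trans
          (E.ncard_pending_rootState_lt hi)
      have : ((rvsAgents E.carrier (E.vertex i)).ncard : ℝ) ≤ E.numReflex := by exact_mod_cast h1
      linarith
    · by_contra! hno
      apply h4
      have h0 : {i : ZMod n | E.IsReflex i} = ∅ := Set.eq_empty_of_forall_notMem hno
      rw [hn, PolygonalEnvironment.numReflex, h0, Set.ncard_empty]
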